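/- Let $A$ be a finite alphabet. A one-sided subshift $\Sigma\subset A^{\mathbb N}$ is a closed set with $\sigma(\Sigma)\subset\Sigma$, where $\sigma(z)_i=z_{i+1}$. It is of finite type (SFT) if it is the set of infinite words avoiding a finite set of forbidden words, and sofic if the language of its finite factors is regular (equivalently, if it is the set of labels of infinite paths of a finite labelled graph). $\Sigma$ contains a deterministic subshift if there are a nonempty $A'\subset A$ and $\xi:A'\to A'$ with $\mathcal O_\xi=\{(\xi^j(a))_{j\in\mathbb N}: a\in A'\}\subset\Sigma$. A cellular automaton (CA) $G$ on $A$ with anchor $m\in\mathbb Z$, diameter $d>0$ and local rule $f:A^d\to A$ is the map $G:A^{\mathbb Z}\to A^{\mathbb Z}$, $G(x)_i=f(x_{i-m}\cdots x_{i-m+d-1})$; its trace is $\tau_G=\{(G^j(x)_0)_{j\in\mathbb N}: x\in A^{\mathbb Z}\}$. $\Sigma$ is ultimately traceable if there are a CA $G$ on $A$ and $J\in\mathbb N$ with $\sigma^J(\tau_G)=\sigma^J(\Sigma)$. Theorem. Every SFT that contains a deterministic subshift, and every uncountable sofic subshift that contains a deterministic subshift, is ultimately traceable. Moreover this is effective: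 (a) there is an algorithm which, given $n$ and a finite list of forbidden words defining an SFT $\Sigma\subset\{0,\dots,n-1\}^{\mathbb N}$ that contains a deterministic subshift, outputs a CA $G$ on $\{0,\dots,n-1\}$ (anchor, diameter and table of the local rule) and $J\in\mathbb N$ with $\sigma^J(\tau_G)=\sigma^J(\Sigma)$; (b) there is an algorithm which, given $n$ and a finite graph with edges labelled in $\{0,\dots,n-1\}$ such that the set $\Sigma$ of labels of its infinite paths is uncountable and contains a deterministic subshift, outputs a CA $G$ on $\{0,\dots,n-1\}$ and $J\in\mathbb N$ with $\sigma^J(\tau_G)=\sigma^J(\Sigma)$. -/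

import Mathlib

universe u

namespace UltimateTrace

open SymbolicDynamics.FullShift

/-! ## Words, languages, subshifts of finite type, sofic subshifts -/

/-- The finite word `w` is a factor of the infinite word `z`. -/
def IsFactor {A : Type u} (w : List A) (z : ℕ → A) : Prop :=
  ∃ i : ℕ, w = List.ofFn (fun j : Fin w.length => z (i + j))

/-- The infinite words having no factor in `F`. -/
def avoiding {A : Type u} (F : Set (List A)) : Set (ℕ → A) :=
  {z | ∀ w ∈ F, ¬ IsFactor w z}

/-- The language of a set of infinite words: all their finite factors. -/
def language {A : Type u} (S : Set (ℕ → A)) : Language A :=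
  {w | ∃ z ∈ S, IsFactor w z}

/-- A subshift of finite type: it is defined by a finite set of forbidden words. -/
def IsSFT {A : Type u} [TopologicalSpace A] (S : Subshift A ℕ) : Prop :=
  ∃ F : Set (List A), F.Finite ∧ S.carrier = avoiding F

/-- A sofic subshift: its language is regular. -/
def IsSofic {A : Type u} [TopologicalSpace A] (S : Subshift A ℕ) : Prop :=
  (language S.carrier).IsRegular

/-- The deterministic subshift of `ξ : A' → A'`, where `A' ⊆ A`, seen as a set of infinite
words on `A`: the orbits of `ξ`. -/
def deterministic {A : Type u} {A' : Set A} (ξ : A' → A') : Set (ℕ → A) :=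
  {z | ∃ a : A', z = fun j => ((ξ^[j] a : A') : A)}

/-- `S` contains the deterministic subshift of some self-map of a nonempty sub-alphabet. -/
def ContainsDeterministic {A : Type u} (S : Set (ℕ → A)) : Prop :=
  ∃ (A' : Set A) (ξ : A' → A'), A'.Nonempty ∧ deterministic ξ ⊆ S

/-! ## Cellular automata and their traces -/

/-- A one-dimensional cellular automaton on the alphabet `A`. -/
structure CellularAutomaton (A : Type u) where
  /-- the anchor `m` -/
  anchor : ℤ
  /-- the diameter `d` -/
  diameter : ℕ
  diameter_pos : 0 < diameter
  /-- the local rule -/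
  rule : (Fin diameter → A) → A

/-- The global function: `F(x)_i = f(x_{i-m} ... x_{i-m+d-1})`. -/
def CellularAutomaton.global {A : Type u} (G : CellularAutomaton A) (x : ℤ → A) : ℤ → A :=
  fun i => G.rule (fun j => x (i - G.anchor + ((j : ℕ) : ℤ)))

/-- The trace: the sequences of states taken by the cell `0`, over all initial
configurations. -/
def CellularAutomaton.trace {A : Type u} (G : CellularAutomaton A) : Set (ℕ → A) :=
  Set.range fun (x : ℤ → A) (j : ℕ) => (G.global^[j] x) 0

/-- `σ^J(S) = σ^J(T)`. -/
def CoincideFrom {A : Type u} (J : ℕ) (S T : Set (ℕ → A)) : Prop :=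
  shift J '' S = shift J '' T

/-- Some cellular automaton on the same alphabet has a trace that ultimately coincides
with `S`. -/
def UltimatelyTraceable {A : Type u} (S : Set (ℕ → A)) : Prop :=
  ∃ G : CellularAutomaton A, ∃ J : ℕ, CoincideFrom J G.trace S

/-! ## Finite representations, on the alphabets `Fin n` -/

/-- `(n, L)`: the alphabet size and a finite list of forbidden words. Words with a letter
outside `{0, ..., n-1}` forbid nothing. -/
abbrev SFTCode : Type := ℕ × List (List ℕ)

/-- The subshift of finite type represented by a code. -/
def SFTCode.shift (c : SFTCode) : Set (ℕ → Fin c.1) :=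
  avoiding {w : List (Fin c.1) | w.map Fin.val ∈ c.2}

/-- `(n, E)`: the alphabet size and the finite list of the edges `(source, label, target)` of
a finite graph. Edges with a label outside `{0, ..., n-1}` play no role. -/
abbrev GraphCode : Type := ℕ × List (ℕ × ℕ × ℕ)

/-- The sofic subshift of the labels of the infinite paths of the graph. -/
def GraphCode.shift (c : GraphCode) : Set (ℕ → Fin c.1) :=
  {z | ∃ v : ℕ → ℕ, ∀ i, (v i, (z i : ℕ), v (i + 1)) ∈ c.2}

/-- `(m, d, T)`: anchor, diameter, and the table of the local rule, a list of pairs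
`(word, letter)` in which the first entry of a word is the one that counts. -/
abbrev CACode : Type := ℤ × ℕ × List (List ℕ × ℕ)

/-- The code `c` represents the cellular automaton `G`. -/
def CACode.Represents {n : ℕ} (c : CACode) (G : CellularAutomaton (Fin n)) : Prop :=
  c.1 = G.anchor ∧ c.2.1 = G.diameter ∧
    ∀ w : Fin G.diameter → Fin n,
      c.2.2.lookup (List.ofFn fun j => (w j : ℕ)) = some (G.rule w : ℕ)

/-- There is one algorithm which, on every representation `c` satisfying the promise `P`, halts
and outputs a cellular automaton `G` on the alphabet of `shiftOf c` and a generation `J` with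
`σ^J(τ_G) = σ^J(shiftOf c)`. -/
def EffectivelyUltimatelyTraceable {D : Type} [Primcodable D] (size : D → ℕ)
    (shiftOf : (c : D) → Set (ℕ → Fin (size c))) (P : D → Prop) : Prop :=
  ∃ φ : D →. CACode × ℕ, Partrec φ ∧ ∀ c, P c → ∃ r ∈ φ c,
    ∃ G : CellularAutomaton (Fin (size c)), CACode.Represents r.1 G ∧
      CoincideFrom r.2 G.trace (shiftOf c)

end UltimateTrace

namespace UltimateTrace

/-! Present Σ as the labels of the infinite paths of a finite graph. After at least as many shifts
as there are edges, exactly the labels of bi-infinite paths remain (`image_shift_eq`), because a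
path has repeated an edge by then and can be prolonged backwards around the resulting cycle. An
automaton therefore suits as soon as, up to finitely many generations, all its columns are labels of
paths (`Covers`) and every bi-infinite path can be read in some column (`Realizes`);
`coincideFrom_of_cover` concludes.

By default the cells of the automaton follow a map `bg` obtained from ξ, whose orbits lie in Σ. In
this background, blocks recognised by their padding carry data, which evolve as a one-sided
automaton reading the data of the block to the right; blocks that clash are ignored. After finitely
many generations no block appears and none clashes (`SettledFrom`), so that a column is for ever a
background cell or one data cell of one block. If ξ fixes a letter `a`, the background is constant
and the data cells stand at powers of two: two letters other than `a` then locate the block. If ξ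
fixes no letter, the alternation of `a` and `bg a` provides a marker that cannot overlap another one
harmfully.

The data have to show an arbitrary path while every column of them, even in a badly formed row, is
the label of a path (`DataSystem`). For an SFT, the vertices are determined by the labels: a block
holds a long window of a legal sequence, moves it by one cell at each step, and completes it with
the letter proposed by its neighbour if this is legal, with another one otherwise. For an
uncountable sofic subshift, a pumping argument gives a set `U` of vertices and two distinct words of
the same length that both carry `U` onto `U` (`exists_loops_of_not_countable`). All concatenations
of these words are labels of paths, so they serve as bits: registers written with them hold the
edges to come, the primitivity of one of them gives the phase, and a last cell displays the path
that is decoded.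

Effectiveness needs no analysis of the construction. An automaton, a finite cover and a finite code
of the paths form a `Certificate`, whose validity is primitive recursive (`primrecPred_valid`) and
implies the coincidence (`Certificate.Valid.exists_coincideFrom`). The construction shows that valid
certificates exist, and the algorithm searches for one. -/

/-! ## Block automata -/

/-- Data for a cellular automaton whose configurations contain blocks of cells: the cells of a
block at the offsets `pos` carry a state, the other ones follow the background map. -/
structure BlockSystem (A ι : Type*) where
  width : ℕ
  pos : ι → ℕ
  pos_injective : Function.Injective pos
  pos_lt : ∀ k, pos k < width
  /-- the cell at the offset `l` of a block carries `bg^[pat l] a` if it carries no data -/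
  pat : ℕ → ℕ
  bg : A → A
  palette : Set A
  bg_mem : ∀ a ∈ palette, bg a ∈ palette
  states : Set (ι → A)
  next : (ι → A) → (ι → A) → ι → A
  next_mem : ∀ q ∈ states, ∀ r, next q r ∈ states

namespace BlockSystem

variable {A ι : Type*} (S : BlockSystem A ι)

/-- The data of the block at `j`. -/
def read (x : ℤ → A) (j : ℤ) : ι → A := fun k => x (j + S.pos k)

/-- The configuration `x` has a block at `j`. -/
def Occurs (x : ℤ → A) (j : ℤ) : Prop :=
  (∃ a ∈ S.palette, ∀ l < S.width, l ∉ Set.range S.pos → x (j + l) = S.bg^[S.pat l] a) ∧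
    S.read x j ∈ S.states

/-- A data cell of one of the blocks at `j` and `j'` lies in the other one. -/
def Clash (j j' : ℤ) : Prop :=
  ∃ k, (j' ≤ j + S.pos k ∧ j + S.pos k < j' + S.width) ∨
    (j ≤ j' + S.pos k ∧ j' + S.pos k < j + S.width)

/-- A block that clashes with no other one. -/
def Active (x : ℤ → A) (j : ℤ) : Prop :=
  S.Occurs x j ∧ ∀ j', S.Occurs x j' → S.Clash j j' → j' = j

open Classical in
/-- The global map of the block automaton. -/
noncomputable def step (x : ℤ → A) (i : ℤ) : A :=
  if h : ∃ p : ℤ × ι, i = p.1 + S.pos p.2 ∧ S.Active x p.1 then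
    S.next (S.read x h.choose.1) (S.read x (h.choose.1 + S.width)) h.choose.2
  else S.bg (x i)

variable {S}

theorem Clash.symm {j j' : ℤ} (h : S.Clash j j') : S.Clash j' j := by
  obtain ⟨k, h | h⟩ := h
  · exact ⟨k, Or.inr h⟩
  · exact ⟨k, Or.inl h⟩

theorem Clash.abs_lt {j j' : ℤ} (h : S.Clash j j') : |j - j'| < S.width := by
  obtain ⟨k, h⟩ := h
  have := S.pos_lt k
  rw [_root_.abs_lt]
  omega

theorem Active.eq_of_clash {x : ℤ → A} {j j' : ℤ} (h : S.Active x j) (h' : S.Occurs x j')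
    (hc : S.Clash j j') : j' = j := h.2 j' h' hc

theorem Active.unique {x : ℤ → A} {j j' : ℤ} {k k' : ι} (h : S.Active x j) (h' : S.Active x j')
    (e : j + (S.pos k : ℤ) = j' + S.pos k') : j = j' ∧ k = k' := by
  have hj : j' = j := h.eq_of_clash h'.1 ⟨k', Or.inr (by have := S.pos_lt k; omega)⟩
  subst hj
  exact ⟨rfl, S.pos_injective (by omega)⟩

theorem Active.step_data {x : ℤ → A} {j : ℤ} (h : S.Active x j) (k : ι) :
    S.step x (j + S.pos k) = S.next (S.read x j) (S.read x (j + S.width)) k := by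
  have hex : ∃ p : ℤ × ι, j + (S.pos k : ℤ) = p.1 + S.pos p.2 ∧ S.Active x p.1 := ⟨(j, k), rfl, h⟩
  rw [step, dif_pos hex]
  obtain ⟨e1, e2⟩ := h.unique hex.choose_spec.2 hex.choose_spec.1
  rw [← e1, ← e2]

theorem step_bg {x : ℤ → A} {i : ℤ} (h : ∀ j k, i = j + S.pos k → ¬ S.Active x j) :
    S.step x i = S.bg (x i) := by
  rw [step, dif_neg]
  rintro ⟨p, h1, h2⟩
  exact h _ _ h1 h2

theorem Active.step_pad {x : ℤ → A} {j : ℤ} (h : S.Active x j) {l : ℕ} (hl : l < S.width)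
    (hl' : l ∉ Set.range S.pos) : S.step x (j + l) = S.bg (x (j + l)) := by
  refine step_bg fun j' k e h' => hl' ⟨k, ?_⟩
  have : j = j' := h'.eq_of_clash h.1 ⟨k, Or.inl (by omega)⟩
  omega

theorem Active.read_step {x : ℤ → A} {j : ℤ} (h : S.Active x j) :
    S.read (S.step x) j = S.next (S.read x j) (S.read x (j + S.width)) :=
  funext fun k => h.step_data k

/-- The padding keeps its pattern, with `bg a` instead of `a`, since the iterates of `bg` commute.
The data stay in `states` whatever stands to the right, even if no block does. -/
theorem Active.occurs_step {x : ℤ → A} {j : ℤ} (h : S.Active x j) : S.Occurs (S.step x) j := by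
  obtain ⟨⟨a, ha, hp⟩, hq⟩ := h.1
  refine ⟨⟨S.bg a, S.bg_mem a ha, fun l hl hl' => ?_⟩, ?_⟩
  · rw [h.step_pad hl hl', hp l hl hl', ← Function.iterate_succ_apply' S.bg,
      Function.iterate_succ_apply]
  · rw [h.read_step]
    exact S.next_mem _ hq _

/-! ### Locality and commutation with the shift -/

theorem read_add (x : ℤ → A) (m j : ℤ) : S.read (fun i => x (i + m)) j = S.read x (j + m) := by
  funext k
  simp only [read]
  congr 1
  ring

theorem occurs_add (x : ℤ → A) (m j : ℤ) :
    S.Occurs (fun i => x (i + m)) j ↔ S.Occurs x (j + m) := by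
  have e : ∀ l : ℕ, j + (l : ℤ) + m = j + m + l := fun l => by ring
  simp only [Occurs, read_add, e]

theorem clash_add (m j j' : ℤ) : S.Clash (j + m) (j' + m) ↔ S.Clash j j' := by
  refine exists_congr fun k => ?_
  omega

theorem active_add (x : ℤ → A) (m j : ℤ) :
    S.Active (fun i => x (i + m)) j ↔ S.Active x (j + m) := by
  simp only [Active, occurs_add]
  refine and_congr_right fun _ => ⟨fun h j' h1 h2 => ?_, fun h j' h1 h2 => ?_⟩
  · have := h (j' - m) (by simpa using h1) (by rw [← clash_add m]; simpa using h2)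
    omega
  · have := h (j' + m) h1 ((clash_add m j j').2 h2)
    omega

theorem step_add (x : ℤ → A) (m i : ℤ) : S.step (fun i => x (i + m)) i = S.step x (i + m) := by
  by_cases h : ∃ j k, i = j + S.pos k ∧ S.Active (fun i => x (i + m)) j
  · obtain ⟨j, k, rfl, h⟩ := h
    have h' := (active_add x m j).1 h
    rw [h.step_data, read_add, read_add, show j + (S.pos k : ℤ) + m = j + m + S.pos k by ring,
      h'.step_data, show j + (S.width : ℤ) + m = j + m + S.width by ring]
  · push Not at h
    rw [step_bg h, step_bg]
    intro j k e h'
    exact h (j - m) k (by omega) ((active_add x m _).2 (by simpa using h'))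

theorem read_congr {x y : ℤ → A} {j : ℤ} (h : ∀ i, j ≤ i → i < j + S.width → x i = y i) :
    S.read x j = S.read y j :=
  funext fun k => h _ (by omega) (by have := S.pos_lt k; omega)

theorem Occurs.congr {x y : ℤ → A} {j : ℤ} (hx : S.Occurs x j)
    (h : ∀ i, j ≤ i → i < j + S.width → x i = y i) : S.Occurs y j := by
  obtain ⟨⟨a, ha, hp⟩, hq⟩ := hx
  refine ⟨⟨a, ha, fun l hl hl' => ?_⟩, read_congr h ▸ hq⟩
  rw [← hp l hl hl', h _ (by omega) (by omega)]

theorem Active.congr {x y : ℤ → A} {j : ℤ} (hx : S.Active x j)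
    (h : ∀ i, j - S.width ≤ i → i < j + 2 * S.width → x i = y i) : S.Active y j := by
  refine ⟨hx.1.congr fun i h1 h2 => h i (by omega) (by omega), fun j' h1 h2 => ?_⟩
  have := h2.abs_lt
  rw [_root_.abs_lt] at this
  exact hx.2 j' (h1.congr fun i h3 h4 => (h i (by omega) (by omega)).symm) h2

/-- Clashing blocks start less than a width apart, and the data read on the right end two widths
after the start of the block: two widths on each side decide everything. -/
theorem step_congr {x y : ℤ → A} {i : ℤ}
    (h : ∀ i', i - 2 * S.width ≤ i' → i' ≤ i + 2 * S.width → x i' = y i') :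
    S.step x i = S.step y i := by
  by_cases hx : ∃ j k, i = j + S.pos k ∧ S.Active x j
  · obtain ⟨j, k, rfl, hx⟩ := hx
    have := S.pos_lt k
    have hy := hx.congr fun i h1 h2 => h i (by omega) (by omega)
    rw [hx.step_data, hy.step_data, read_congr fun i h1 h2 => h i (by omega) (by omega),
      read_congr (j := j + S.width) fun i h1 h2 => h i (by omega) (by omega)]
  · push Not at hx
    rw [step_bg hx, step_bg, h i (by omega) (by omega)]
    intro j k e hy
    have := S.pos_lt k
    exact hx j k e (hy.congr fun i h1 h2 => (h i (by omega) (by omega)).symm)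

/-! ### Stabilisation -/

/-- From the generation `J` on, there are neither new blocks nor clashes. -/
def SettledFrom (S : BlockSystem A ι) (J : ℕ) : Prop :=
  ∀ x : ℤ → A, ∀ t, J ≤ t → ∀ j, S.Occurs (S.step^[t + 1] x) j → S.Active (S.step^[t] x) j

/-- Active blocks persist, and a block that would clash later would already be there now. The set of
active positions is thus constant, which fixes the nature of each column. -/
theorem SettledFrom.active_succ {J : ℕ} (h : S.SettledFrom J) (x : ℤ → A) {t : ℕ} (ht : J ≤ t)
    (j : ℤ) : S.Active (S.step^[t + 1] x) j ↔ S.Active (S.step^[t] x) j := by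
  refine ⟨fun h' => h x t ht j h'.1, fun h' => ⟨?_, fun j' h1 h2 => ?_⟩⟩
  · rw [Function.iterate_succ_apply']
    exact h'.occurs_step
  · exact h'.2 j' (h x t ht j' h1).1 h2

theorem SettledFrom.active {J : ℕ} (h : S.SettledFrom J) (x : ℤ → A) {t : ℕ} (ht : J ≤ t)
    (j : ℤ) : S.Active (S.step^[t] x) j ↔ S.Active (S.step^[J] x) j := by
  induction t, ht using Nat.le_induction with
  | base => rfl
  | succ t ht ih => rw [h.active_succ x ht, ih]

/-! ### Rows of contiguous blocks -/

/-- Wherever blocks are contiguous, they are active. -/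
def Stackable (S : BlockSystem A ι) : Prop :=
  ∀ x : ℤ → A, (∀ i : ℤ, S.Occurs x (i * S.width)) → ∀ i : ℤ, S.Active x (i * S.width)

open Classical in
/-- The row of contiguous blocks with the data `q`, with backgrounds from the letter `a`. -/
noncomputable def row (S : BlockSystem A ι) (a : A) (q : ℤ → ι → A) (i : ℤ) : A :=
  if h : ∃ k, i % S.width = S.pos k then q (i / S.width) h.choose
  else S.bg^[S.pat (i % S.width).toNat] a

theorem row_data (a : A) (q : ℤ → ι → A) (i : ℤ) (k : ι) :
    S.row a q (i * S.width + S.pos k) = q i k := by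
  have hk := S.pos_lt k
  have h1 : (i * S.width + S.pos k) % (S.width : ℤ) = S.pos k := by
    rw [add_comm, Int.add_mul_emod_self_right, Int.emod_eq_of_lt] <;> omega
  have h2 : (i * S.width + S.pos k) / (S.width : ℤ) = i := by
    rw [add_comm, Int.add_mul_ediv_right _ _ (by omega), Int.ediv_eq_zero_of_lt] <;> omega
  have hex : ∃ k', (i * S.width + S.pos k) % (S.width : ℤ) = S.pos k' := ⟨k, h1⟩
  rw [row, dif_pos hex, h2]
  congr 1
  exact S.pos_injective (by have := hex.choose_spec; omega)

theorem row_pad (a : A) (q : ℤ → ι → A) (i : ℤ) {l : ℕ} (hl : l < S.width)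
    (hl' : l ∉ Set.range S.pos) : S.row a q (i * S.width + l) = S.bg^[S.pat l] a := by
  have h1 : (i * S.width + l) % (S.width : ℤ) = l := by
    rw [add_comm, Int.add_mul_emod_self_right, Int.emod_eq_of_lt] <;> omega
  rw [row, dif_neg, h1, Int.toNat_natCast]
  rintro ⟨k, hk⟩
  exact hl' ⟨k, by omega⟩

theorem read_row (a : A) (q : ℤ → ι → A) (i : ℤ) : S.read (S.row a q) (i * S.width) = q i :=
  funext fun k => row_data a q i k

theorem occurs_row {a : A} (ha : a ∈ S.palette) {q : ℤ → ι → A} (hq : ∀ i, q i ∈ S.states)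
    (i : ℤ) : S.Occurs (S.row a q) (i * S.width) :=
  ⟨⟨a, ha, fun _ hl hl' => row_pad a q i hl hl'⟩, by rw [read_row]; exact hq i⟩

theorem row_ext (hw : 0 < S.width) {x y : ℤ → A}
    (h1 : ∀ (i : ℤ) k, x (i * S.width + S.pos k) = y (i * S.width + S.pos k))
    (h2 : ∀ (i : ℤ) (l : ℕ), l < S.width → l ∉ Set.range S.pos →
      x (i * S.width + l) = y (i * S.width + l)) : x = y := by
  funext i
  obtain ⟨l, hl⟩ := Int.eq_ofNat_of_zero_le (Int.emod_nonneg i (b := S.width) (by omega))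
  have hi : i = i / S.width * S.width + l := by
    rw [← hl, mul_comm]; exact (Int.mul_ediv_add_emod i S.width).symm
  have hl' : l < S.width := by
    have := Int.emod_lt_of_pos i (b := S.width) (by omega); omega
  rw [hi]
  by_cases h : l ∈ Set.range S.pos
  · obtain ⟨k, rfl⟩ := h
    exact h1 _ k
  · exact h2 _ l hl' h

theorem Stackable.step_row (h : S.Stackable) (hw : 0 < S.width) {a : A} (ha : a ∈ S.palette)
    {q : ℤ → ι → A} (hq : ∀ i, q i ∈ S.states) :
    S.step (S.row a q) = S.row (S.bg a) fun i => S.next (q i) (q (i + 1)) := by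
  have hact := h _ (occurs_row ha hq)
  refine row_ext hw (fun i k => ?_) fun i l hl hl' => ?_
  · rw [(hact i).step_data, row_data, read_row,
      show i * (S.width : ℤ) + S.width = (i + 1) * S.width by ring, read_row]
  · rw [(hact i).step_pad hl hl', row_pad _ _ _ hl hl', row_pad _ _ _ hl hl',
      ← Function.iterate_succ_apply' S.bg, Function.iterate_succ_apply]

theorem Stackable.iterate_step_row (h : S.Stackable) (hw : 0 < S.width) {a : A}
    (ha : a ∈ S.palette) {q : ℕ → ℤ → ι → A} (hq : ∀ t i, q t i ∈ S.states)
    (hs : ∀ t i, q (t + 1) i = S.next (q t i) (q t (i + 1))) (t : ℕ) :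
    S.step^[t] (S.row a (q 0)) = S.row (S.bg^[t] a) (q t) := by
  induction t with
  | zero => rfl
  | succ t ih =>
    have hm : S.bg^[t] a ∈ S.palette := by
      clear ih
      induction t with
      | zero => exact ha
      | succ t ih => rw [Function.iterate_succ_apply']; exact S.bg_mem _ ih
    rw [Function.iterate_succ_apply', ih, h.step_row hw hm (hq t), Function.iterate_succ_apply']
    congr 1
    funext i
    exact (hs t i).symm

end BlockSystem

/-! ### Two ways of placing data so that blocks can be located -/

namespace BlockSystem

variable {A ι : Type*}

theorem eq_of_clash_mul {S : BlockSystem A ι} {i i' : ℤ}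
    (h : S.Clash (i * S.width) (i' * S.width)) : i = i' := by
  have h1 := h.abs_lt
  rw [← sub_mul, abs_mul, Nat.abs_cast] at h1
  have h2 : |i - i'| < 1 := by
    by_contra h3
    push Not at h3
    have : (0 : ℤ) ≤ S.width := by positivity
    nlinarith
  rw [Int.abs_lt_one_iff] at h2
  omega

/-- The powers of two form a Sidon set: a power larger than two others is at least their sum, so
neither side can contain an exponent exceeding both exponents of the other side. -/
theorem two_pow_add_two_pow_cancel {a b c d : ℕ} (h : 2 ^ a + 2 ^ b = 2 ^ c + 2 ^ d) :
    a = c ∨ a = d := by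
  by_contra hne
  push Not at hne
  obtain ⟨h1, h2⟩ := hne
  have key : ∀ {p q r s : ℕ}, 2 ^ p + 2 ^ q = 2 ^ r + 2 ^ s → r < p → s < p → False := by
    intro p q r s h h1 h2
    have e1 : 2 * 2 ^ r ≤ 2 ^ p := by rw [← pow_succ']; exact Nat.pow_le_pow_right (by norm_num) h1
    have e2 : 2 * 2 ^ s ≤ 2 ^ p := by rw [← pow_succ']; exact Nat.pow_le_pow_right (by norm_num) h2
    have := Nat.two_pow_pos q
    omega
  rcases lt_trichotomy a b with hab | rfl | hab
  · by_cases hbc : b = c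
    · subst hbc
      have : 2 ^ a = 2 ^ d := by omega
      exact h2 (Nat.pow_right_injective le_rfl this)
    by_cases hbd : b = d
    · subst hbd
      have : 2 ^ a = 2 ^ c := by omega
      exact h1 (Nat.pow_right_injective le_rfl this)
    rcases lt_or_gt_of_ne hbc with h3 | h3 <;> rcases lt_or_gt_of_ne hbd with h4 | h4
    · rcases le_total c d with h5 | h5
      · rcases h5.eq_or_lt with rfl | h5
        · exact key (h.symm.trans (add_comm _ _)) h3 (hab.trans h3)
        · exact key ((add_comm _ _).trans h.symm) (hab.trans h4) h4
      · exact key h.symm (hab.trans h3) h3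
    · exact key h.symm (hab.trans h3) h3
    · exact key ((add_comm _ _).trans h.symm) (hab.trans h4) h4
    · exact key ((add_comm _ _).trans h) h3 h4
  · rcases lt_or_gt_of_ne h1 with h3 | h3 <;> rcases lt_or_gt_of_ne h2 with h4 | h4
    · exact key h.symm h3 h3
    · exact key h.symm h3 h3
    · exact key ((add_comm _ _).trans h.symm) h4 h4
    · exact key h h3 h4
  · rcases lt_or_gt_of_ne h1 with h3 | h3
    · exact key h.symm h3 (hab.trans h3)
    rcases lt_or_gt_of_ne h2 with h4 | h4
    · exact key ((add_comm _ _).trans h.symm) h4 (hab.trans h4)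
    · exact key h h3 h4

/-! ### Blocks on a constant background -/

/-- Blocks on the background `c`: the differences of the positions of the data cells are
distinct. -/
def onConstant (c : A) {D : ℕ} (e : ι ↪ Fin D) (states : Set (ι → A))
    (next : (ι → A) → (ι → A) → ι → A) (next_mem : ∀ q ∈ states, ∀ r, next q r ∈ states) :
    BlockSystem A ι where
  -- The data lie between the offsets `2 * 2 ^ D` and `3 * 2 ^ D`, with margins wide enough that
  -- data cells less than `2 ^ D` apart make their blocks clash.
  width := 5 * 2 ^ D
  pos k := 2 * 2 ^ D + 2 ^ (e k : ℕ)
  pos_injective k k' h := by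
    have h : 2 ^ (e k : ℕ) = 2 ^ (e k' : ℕ) := by simpa using h
    exact e.injective (Fin.ext (Nat.pow_right_injective le_rfl h))
  pos_lt k := by
    have := Nat.pow_lt_pow_right (show 1 < 2 by norm_num) (e k).isLt
    omega
  pat _ := 0
  bg _ := c
  palette := {c}
  bg_mem _ _ := rfl
  states := states
  next := next
  next_mem := next_mem

section OnConstant

variable {c : A} {D : ℕ} {e : ι ↪ Fin D} {states : Set (ι → A)}
  {next : (ι → A) → (ι → A) → ι → A} {next_mem : ∀ q ∈ states, ∀ r, next q r ∈ states}

/-- Two letters other than `c` in the data of a block come from data cells of blocks of `I`. These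
cells are close, so they belong to the same block, and their distance, a difference of two powers of
two, determines which cells they are, hence the position. -/
theorem mem_of_occurs_onConstant
    (hq : ∀ q ∈ states, ∃ k₁ k₂, k₁ ≠ k₂ ∧ q k₁ ≠ c ∧ q k₂ ≠ c) {x : ℤ → A} {I : Set ℤ}
    (hI : ∀ j ∈ I, ∀ j' ∈ I, (onConstant c e states next next_mem).Clash j j' → j = j')
    (hx : ∀ i, x i ≠ c → ∃ j ∈ I, ∃ k, i = j + (onConstant c e states next next_mem).pos k)
    {j : ℤ} (hj : (onConstant c e states next next_mem).Occurs x j) : j ∈ I := by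
  obtain ⟨k₁, k₂, hne, h1, h2⟩ := hq _ hj.2
  obtain ⟨j₁, hj₁, m₁, e₁⟩ := hx _ h1
  obtain ⟨j₂, hj₂, m₂, e₂⟩ := hx _ h2
  have lt : ∀ k, 2 ^ (e k : ℕ) < 2 ^ D := fun k =>
    Nat.pow_lt_pow_right (show 1 < 2 by norm_num) (e k).isLt
  have l1 := lt k₁
  have l2 := lt k₂
  have l3 := lt m₁
  have l4 := lt m₂
  simp only [onConstant] at e₁ e₂
  zify at l1 l2 l3 l4
  push_cast at e₁ e₂
  have p : ∀ n : ℕ, (0 : ℤ) < 2 ^ n := fun n => by positivity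
  have p1 := p (e k₁)
  have p2 := p (e k₂)
  have p3 := p (e m₁)
  have p4 := p (e m₂)
  -- Two data cells of the block at `j` are less than `2 ^ D` apart, so blocks of `I` containing
  -- them at data offsets clash.
  have hjj : j₁ = j₂ := by
    refine hI _ hj₁ _ hj₂ ⟨m₁, Or.inl ?_⟩
    simp only [onConstant]
    push_cast
    omega
  subst hjj
  have hs : (2 : ℤ) ^ (e m₁ : ℕ) + 2 ^ (e k₂ : ℕ) = 2 ^ (e m₂ : ℕ) + 2 ^ (e k₁ : ℕ) := by omega
  have hs' : 2 ^ (e k₂ : ℕ) + 2 ^ (e m₁ : ℕ) = 2 ^ (e k₁ : ℕ) + 2 ^ (e m₂ : ℕ) := by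
    zify; omega
  rcases two_pow_add_two_pow_cancel hs' with h | h
  · exact absurd (e.injective (Fin.ext h)).symm hne
  · have : j = j₁ := by rw [h] at e₂; omega
    exact this ▸ hj₁

/-- After a step, only active blocks have written letters other than `c`; so `I` can be the set of
their positions, and no block arises elsewhere. -/
theorem settledFrom_onConstant
    (hq : ∀ q ∈ states, ∃ k₁ k₂, k₁ ≠ k₂ ∧ q k₁ ≠ c ∧ q k₂ ≠ c) :
    (onConstant c e states next next_mem).SettledFrom 0 := by
  intro x t _ j hj
  rw [Function.iterate_succ_apply'] at hj
  refine mem_of_occurs_onConstant hq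
    (I := {j | (onConstant c e states next next_mem).Active _ j})
    (fun j hj j' hj' hc => (Active.eq_of_clash hj hj'.1 hc).symm) (fun i hi => ?_) hj
  by_contra h
  push Not at h
  exact hi (step_bg fun j k e ha => h j ha k e)

/-- Here `I` consists of the multiples of the width: in a row of contiguous blocks, no block can be
seen at another position. -/
theorem stackable_onConstant
    (hq : ∀ q ∈ states, ∃ k₁ k₂, k₁ ≠ k₂ ∧ q k₁ ≠ c ∧ q k₂ ≠ c) :
    (onConstant c e states next next_mem).Stackable := by
  intro x hx i
  refine ⟨hx i, fun j' h1 h2 => ?_⟩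
  have hm := mem_of_occurs_onConstant hq
    (I := Set.range fun i : ℤ => i * (onConstant c e states next next_mem).width)
    (by rintro _ ⟨i, rfl⟩ _ ⟨i', rfl⟩ hc; simp only [eq_of_clash_mul hc]) ?_ h1
  · obtain ⟨i', rfl⟩ := hm
    simp only [eq_of_clash_mul h2]
  · intro m hm
    set S := onConstant c e states next next_mem with hS
    have hw : 0 < S.width := by simp [hS, onConstant]
    refine ⟨m / S.width * S.width, ⟨_, rfl⟩, ?_⟩
    obtain ⟨l, hl⟩ := Int.eq_ofNat_of_zero_le (Int.emod_nonneg m (b := S.width) (by omega))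
    have hi : m = m / S.width * S.width + l := by
      rw [← hl, mul_comm]; exact (Int.mul_ediv_add_emod m S.width).symm
    have hl' : l < S.width := by
      have := Int.emod_lt_of_pos m (b := S.width) (by omega); omega
    by_cases h : l ∈ Set.range S.pos
    · obtain ⟨k, rfl⟩ := h
      exact ⟨k, hi⟩
    · obtain ⟨⟨a, ha, hp⟩, -⟩ := hx (m / S.width)
      have := hp l hl' h
      rw [← hi] at this
      exact absurd (this.trans ha) hm

end OnConstant

/-! ### Blocks on a background without fixed letters -/

/-- Blocks on a moving background: they read `a⁴ b⁴ (a b *)^D a b`, where `b = bg a`. -/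
def onMoving (bg : A → A) (palette : Set A) (bg_mem : ∀ a ∈ palette, bg a ∈ palette) {D : ℕ}
    (e : ι ≃ Fin D) (states : Set (ι → A)) (next : (ι → A) → (ι → A) → ι → A)
    (next_mem : ∀ q ∈ states, ∀ r, next q r ∈ states) : BlockSystem A ι where
  width := 10 + 3 * D
  pos k := 10 + 3 * (e k : ℕ)
  pos_injective k k' h := e.injective (Fin.ext (by simpa using h))
  pos_lt k := by have := (e k).isLt; omega
  pat l := if l < 4 then 0 else if l < 8 then 1 else (l - 8) % 3
  bg := bg
  palette := palette
  bg_mem := bg_mem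
  states := states
  next := next
  next_mem := next_mem

section OnMoving

variable {bg : A → A} {palette : Set A} {bg_mem : ∀ a ∈ palette, bg a ∈ palette} {D : ℕ}
  {e : ι ≃ Fin D} {states : Set (ι → A)} {next : (ι → A) → (ι → A) → ι → A}
  {next_mem : ∀ q ∈ states, ∀ r, next q r ∈ states}

theorem occurs_onMoving_pad {x : ℤ → A} {j : ℤ}
    (h : (onMoving bg palette bg_mem e states next next_mem).Occurs x j) : ∃ a ∈ palette,
      (∀ l : ℕ, l < 4 → x (j + l) = a) ∧ (∀ l : ℕ, 4 ≤ l → l < 8 → x (j + l) = bg a) ∧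
      (∀ l : ℕ, 8 ≤ l → l < 10 + 3 * D → (l - 8) % 3 = 0 → x (j + l) = a) ∧
      (∀ l : ℕ, 8 ≤ l → l < 10 + 3 * D → (l - 8) % 3 = 1 → x (j + l) = bg a) := by
  obtain ⟨⟨a, ha, hp⟩, -⟩ := h
  refine ⟨a, ha, fun l hl => ?_, fun l hl hl' => ?_, fun l hl hl' h0 => ?_, fun l hl hl' h1 => ?_⟩
  all_goals
    refine (hp l (by simp only [onMoving]; omega) ?_).trans ?_
    · rintro ⟨k, hk⟩
      simp only [onMoving] at hk
      omega
  · simp [onMoving, hl]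
  · simp [onMoving, hl', show ¬ l < 4 by omega]
  · simp [onMoving, h0, show ¬ l < 8 by omega, show ¬ l < 4 by omega]
  · simp [onMoving, h1, show ¬ l < 8 by omega, show ¬ l < 4 by omega]

/-- If the second block starts `s` cells after the first one, a factor `a (bg a)` of the padding of
the first falls inside one of the two constant runs of length 4 of the second, although its letters
differ. -/
theorem not_clash_onMoving (hbg : ∀ a ∈ palette, bg a ≠ a) {x : ℤ → A} {j j' : ℤ}
    (h : (onMoving bg palette bg_mem e states next next_mem).Occurs x j)
    (h' : (onMoving bg palette bg_mem e states next next_mem).Occurs x j')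
    (hc : (onMoving bg palette bg_mem e states next next_mem).Clash j j') : j' = j := by
  wlog hlt : j < j' generalizing j j'
  · rcases (not_lt.1 hlt).eq_or_lt with h1 | h1
    · exact h1
    · exact (this h' h hc.symm h1).symm
  exfalso
  obtain ⟨s, hs⟩ := Int.eq_ofNat_of_zero_le (sub_nonneg.2 hlt.le)
  obtain rfl : j' = j + s := by omega
  have hs0 : 0 < s := by omega
  -- The last data cell has offset `7 + 3 * D`. A larger `s` only overlaps padding with padding,
  -- which is not a clash.
  have hsD : s ≤ 7 + 3 * D := by
    obtain ⟨k, hk⟩ := hc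
    have := (e k).isLt
    simp only [onMoving] at hk
    omega
  obtain ⟨a, ha, f1, f2, f3, f4⟩ := occurs_onMoving_pad h
  obtain ⟨a', -, g1, g2, -, -⟩ := occurs_onMoving_pad h'
  have key : ∀ l u : ℕ, x (j + l) = a → x (j + (l + 1 : ℕ)) = bg a → l = s + u →
      x (j + s + u) = x (j + s + (u + 1 : ℕ)) → False := by
    intro l u e1 e2 e3 e4
    subst e3
    refine hbg a ha ?_
    refine e2.symm.trans (Eq.trans ?_ e1)
    push_cast at e4 ⊢
    simpa only [add_assoc] using e4.symm
  have k1 : ∀ u : ℕ, u + 1 < 4 → x (j + s + u) = x (j + s + (u + 1 : ℕ)) := fun u hu => by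
    rw [g1 u (by omega), g1 (u + 1) hu]
  have k2 : ∀ u : ℕ, 4 ≤ u → u + 1 < 8 → x (j + s + u) = x (j + s + (u + 1 : ℕ)) :=
    fun u hu hu' => by rw [g2 u (by omega) (by omega), g2 (u + 1) (by omega) hu']
  have k3 : ∀ l : ℕ, 8 ≤ l → l + 1 < 10 + 3 * D → (l - 8) % 3 = 0 →
      x (j + l) = a ∧ x (j + (l + 1 : ℕ)) = bg a := fun l h1 h2 h3 =>
    ⟨f3 l h1 (by omega) h3, f4 (l + 1) (by omega) h2 (by omega)⟩
  rcases lt_or_ge s 4 with h4 | h4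
  · exact key 3 (3 - s) (f1 3 (by norm_num)) (f2 4 (by norm_num) (by norm_num)) (by omega)
      (k1 _ (by omega))
  rcases Nat.lt_or_ge s 5 with h5 | h5
  · obtain ⟨e1, e2⟩ := k3 8 le_rfl (by omega) rfl
    exact key 8 (8 - s) e1 e2 (by omega) (k2 _ (by omega) (by omega))
  rcases Nat.lt_or_ge s 8 with h8 | h8
  · have hD : 0 < D := by
      obtain ⟨k, -⟩ := hc
      exact Fin.pos (e k)
    obtain ⟨e1, e2⟩ := k3 11 (by norm_num) (by omega) rfl
    exact key 11 (11 - s) e1 e2 (by omega) (k2 _ (by omega) (by omega))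
  -- In the periodic part, a factor `a (bg a)` starts every third cell, so one lies within the first
  -- four cells of the second block.
  obtain ⟨u, hu1, hu2⟩ : ∃ u, u + 1 < 4 ∧ (s + u - 8) % 3 = 0 ∧ s + u + 1 < 10 + 3 * D := by
    have : (s - 8) % 3 = 0 ∨ (s - 8) % 3 = 1 ∨ (s - 8) % 3 = 2 := by omega
    rcases this with h | h | h
    · exact ⟨0, by omega⟩
    · exact ⟨2, by omega⟩
    · exact ⟨1, by omega⟩
  obtain ⟨e1, e2⟩ := k3 (s + u) (by omega) (by omega) hu2.1
  exact key (s + u) u e1 e2 rfl (k1 _ hu1)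

theorem active_onMoving (hbg : ∀ a ∈ palette, bg a ≠ a) {x : ℤ → A} {j : ℤ}
    (h : (onMoving bg palette bg_mem e states next next_mem).Occurs x j) :
    (onMoving bg palette bg_mem e states next next_mem).Active x j :=
  ⟨h, fun _ h' hc => not_clash_onMoving hbg h h' hc⟩

theorem stackable_onMoving (hbg : ∀ a ∈ palette, bg a ≠ a) :
    (onMoving bg palette bg_mem e states next next_mem).Stackable :=
  fun _ hx i => active_onMoving hbg (hx i)

theorem occurs_onMoving_iterate (hbg : ∀ a ∈ palette, bg a ≠ a) {x : ℤ → A} {j : ℤ} {s t : ℕ}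
    (hst : s ≤ t)
    (h : (onMoving bg palette bg_mem e states next next_mem).Occurs
      ((onMoving bg palette bg_mem e states next next_mem).step^[s] x) j) :
    (onMoving bg palette bg_mem e states next next_mem).Occurs
      ((onMoving bg palette bg_mem e states next next_mem).step^[t] x) j := by
  induction t, hst using Nat.le_induction with
  | base => exact h
  | succ t _ ih =>
    rw [Function.iterate_succ_apply']
    exact (active_onMoving hbg ih).occurs_step

/-- A block that appeared later would consist of cells that have always followed the background. As
the background is periodic from `J` on, the same block would have been seen `N` generations earlier,
and blocks do not disappear. -/
theorem settledFrom_onMoving (hbg : ∀ a ∈ palette, bg a ≠ a) {J N : ℕ} (hN : 0 < N)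
    (hJ : bg^[J + N] = bg^[J]) :
    (onMoving bg palette bg_mem e states next next_mem).SettledFrom (J + N) := by
  intro x t ht j hj
  set S := onMoving bg palette bg_mem e states next next_mem with hS
  refine active_onMoving hbg ?_
  by_contra hno
  -- An active block with a data cell in this interval would still be there at `t + 1`; not clashing
  -- with the block at `j`, it would be that block, already present.
  have free : ∀ s ≤ t + 1, ∀ i, j ≤ i → i < j + S.width → S.step^[s] x i = bg^[s] (x i) := by
    intro s
    induction s with
    | zero => intros; rfl
    | succ s ih =>
      intro hs i h1 h2
      rw [Function.iterate_succ_apply', Function.iterate_succ_apply', ← ih (by omega) i h1 h2]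
      refine step_bg fun j' k e' ha => ?_
      have h3 : S.Occurs (S.step^[t + 1] x) j' := occurs_onMoving_iterate hbg (by omega) ha.1
      have h4 : j' = j := not_clash_onMoving hbg hj h3
        (show S.Clash j j' from ⟨k, Or.inr ⟨by omega, by omega⟩⟩)
      subst h4
      exact hno (occurs_onMoving_iterate hbg (by omega) ha.1)
  have per : bg^[t + 1] = bg^[t + 1 - N] := by
    have e1 : t + 1 = (t + 1 - N - J) + (J + N) := by omega
    have e2 : t + 1 - N = (t + 1 - N - J) + J := by omega
    conv_lhs => rw [e1, Function.iterate_add, hJ, ← Function.iterate_add, ← e2]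
  have h5 : S.Occurs (S.step^[t + 1 - N] x) j := hj.congr fun i h1 h2 => by
    rw [free (t + 1) le_rfl i h1 h2, free (t + 1 - N) (by omega) i h1 h2, per]
  exact hno (occurs_onMoving_iterate hbg (by omega) h5)

end OnMoving

end BlockSystem

open SymbolicDynamics.FullShift

/-! ## Bi-infinite paths of a finite graph -/

/-- An infinite path of the graph. -/
def IsPath (c : GraphCode) (f : ℕ → ℕ × ℕ × ℕ) : Prop :=
  ∀ i, f i ∈ c.2 ∧ (f i).2.1 < c.1 ∧ (f i).2.2 = (f (i + 1)).1

/-- A bi-infinite path of the graph. -/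
def IsBiPath (c : GraphCode) (f : ℤ → ℕ × ℕ × ℕ) : Prop :=
  ∀ i, f i ∈ c.2 ∧ (f i).2.1 < c.1 ∧ (f i).2.2 = (f (i + 1)).1

theorem IsBiPath.add {c : GraphCode} {f : ℤ → ℕ × ℕ × ℕ} (h : IsBiPath c f) (m : ℤ) :
    IsBiPath c fun i => f (i + m) := fun i => by
  have := h (i + m)
  rwa [add_right_comm] at this

theorem mem_shift_of_isPath {c : GraphCode} {z : ℕ → Fin c.1} {f : ℕ → ℕ × ℕ × ℕ}
    (hf : IsPath c f) (h : ∀ i, (f i).2.1 = z i) : z ∈ c.shift := by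
  refine ⟨fun i => (f i).1, fun i => ?_⟩
  have := hf i
  change ((f i).1, (z i : ℕ), (f (i + 1)).1) ∈ c.2
  rw [← this.2.2, ← h i]
  exact this.1

theorem exists_isPath_of_mem_shift {c : GraphCode} {z : ℕ → Fin c.1} (h : z ∈ c.shift) :
    ∃ f, IsPath c f ∧ ∀ i, (f i).2.1 = z i := by
  obtain ⟨v, hv⟩ := h
  exact ⟨fun i => (v i, z i, v (i + 1)), fun i => ⟨hv i, (z i).isLt, rfl⟩, fun i => rfl⟩

theorem exists_repeat {E : List (ℕ × ℕ × ℕ)} (f : ℕ → ℕ × ℕ × ℕ)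
    (hf : ∀ i ≤ E.length, f i ∈ E) : ∃ i j, i < j ∧ j ≤ E.length ∧ f i = f j := by
  obtain ⟨i, hi, j, hj, hne, h⟩ := Finset.exists_ne_map_eq_of_card_lt_of_maps_to
    (s := Finset.range (E.length + 1)) (t := E.toFinset) (f := f)
    (by rw [Finset.card_range]; exact Nat.lt_succ_of_le E.toFinset_card_le)
    (fun i hi => by simpa using hf i (by simpa [Nat.lt_succ_iff] using hi))
  simp only [Finset.mem_range] at hi hj
  rcases lt_or_gt_of_ne hne with h' | h'
  · exact ⟨i, j, h', by omega, h⟩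
  · exact ⟨j, i, h', by omega, h.symm⟩

/-- Some edge is taken twice among the first `c.2.length + 1` ones. The past before its first
occurrence is replaced by endless turns around the cycle. -/
theorem IsPath.exists_isBiPath {c : GraphCode} {f : ℕ → ℕ × ℕ × ℕ} (hf : IsPath c f) :
    ∃ g, IsBiPath c g ∧ ∀ i, c.2.length ≤ i → g i = f i := by
  obtain ⟨i, j, hij, hj, h⟩ := exists_repeat (E := c.2) f fun i _ => (hf i).1
  set p : ℤ := j - i with hp
  have hp0 : 0 < p := by omega
  set u : ℤ → ℕ := fun k => if (i : ℤ) ≤ k then k.toNat else i + ((k - i) % p).toNat with hu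
  refine ⟨fun k => f (u k), fun k => ⟨(hf _).1, (hf _).2.1, ?_⟩, fun k hk => ?_⟩
  · rw [(hf _).2.2]
    by_cases h1 : (i : ℤ) ≤ k
    · simp only [hu, if_pos h1, if_pos (show (i : ℤ) ≤ k + 1 by omega)]
      congr 2
      omega
    · have hm := Int.emod_nonneg (k - i) hp0.ne'
      have hm' := Int.emod_lt_of_pos (k - i) hp0
      by_cases h2 : (k - i) % p + 1 = p
      · have e1 : u k + 1 = j := by simp only [hu, if_neg h1]; omega
        have e2 : u (k + 1) = i := by
          by_cases h3 : (i : ℤ) ≤ k + 1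
          · simp only [hu, if_pos h3]; omega
          · have : (k + 1 - i) % p = 0 := by
              rw [show k + 1 - i = (k - i) + 1 by ring, Int.add_emod, ← Int.add_emod,
                ← Int.emod_add_emod, h2, Int.emod_self]
            simp only [hu, if_neg h3, this]
            simp
        change (f (u k + 1)).1 = (f (u (k + 1))).1
        rw [e1, e2, h]
      · have h3 : (k + 1 - i) % p = (k - i) % p + 1 := by
          rw [show k + 1 - i = (k - i) + 1 by ring, ← Int.emod_add_emod]
          exact Int.emod_eq_of_lt (by omega) (by omega)
        have h4 : ¬ (i : ℤ) ≤ k + 1 := by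
          intro h4
          have : k + 1 - i = 0 := by omega
          rw [this] at h3
          simp at h3
          omega
        simp only [hu, if_neg h1, if_neg h4, h3]
        congr 2
        omega
  · simp only [hu]
    rw [if_pos (by omega), Int.toNat_natCast]

theorem exists_isPath_of_finite {c : GraphCode} {f : ℕ → ℕ × ℕ × ℕ} {n : ℕ}
    (hf : ∀ i < n + c.2.length, f i ∈ c.2 ∧ (f i).2.1 < c.1)
    (hf' : ∀ i, i + 1 < n + c.2.length → (f i).2.2 = (f (i + 1)).1) (hn : 0 < n) :
    ∃ g, IsPath c g ∧ ∀ i < n, g i = f i := by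
  obtain ⟨i, j, hij, hj, h⟩ := exists_repeat (E := c.2) (fun k => f (n - 1 + k))
    fun i _ => (hf _ (by omega)).1
  set p := j - i with hp
  have hp0 : 0 < p := by omega
  set a := n - 1 + i with ha
  set u : ℕ → ℕ := fun k => if k < a then k else a + (k - a) % p with hu
  have hlt : ∀ k, u k + 1 < n + c.2.length := by
    intro k
    have := Nat.mod_lt (k - a) hp0
    simp only [hu]
    split_ifs <;> omega
  refine ⟨fun k => f (u k), fun k => ⟨(hf _ (by have := hlt k; omega)).1,
    (hf _ (by have := hlt k; omega)).2, ?_⟩, fun k hk => ?_⟩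
  · rw [hf' _ (hlt k)]
    by_cases h1 : k + 1 < a
    · simp only [hu, if_pos h1, if_pos (show k < a by omega)]
    by_cases h2 : k < a
    · have : k + 1 = a := by omega
      simp only [hu, if_pos h2, this]
      simp
    simp only [hu, if_neg h1, if_neg h2]
    have hm := Nat.mod_lt (k - a) hp0
    by_cases h3 : (k - a) % p + 1 = p
    · have : (k + 1 - a) % p = 0 := by
        rw [show k + 1 - a = (k - a) + 1 by omega, ← Nat.mod_add_mod, h3, Nat.mod_self]
      rw [this, show a + (k - a) % p + 1 = n - 1 + j by omega, ← h]
      rfl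
    · have : (k + 1 - a) % p = (k - a) % p + 1 := by
        rw [show k + 1 - a = (k - a) + 1 by omega, ← Nat.mod_add_mod]
        exact Nat.mod_eq_of_lt (by omega)
      rw [this]
      rfl
  · simp only [hu]
    split_ifs with h1
    · rfl
    · have : k = a := by omega
      rw [this]
      simp

/-- A margin of `c.2.length` edges on each side contains a cycle, around which the path can turn for
ever. This makes membership in a bi-infinite path a finite condition, up to margins. -/
theorem exists_isBiPath_of_finite {c : GraphCode} {f : ℕ → ℕ × ℕ × ℕ} {n : ℕ} (hn : 0 < n)
    (hf : ∀ i < c.2.length + n + c.2.length, f i ∈ c.2 ∧ (f i).2.1 < c.1)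
    (hf' : ∀ i, i + 1 < c.2.length + n + c.2.length → (f i).2.2 = (f (i + 1)).1) :
    ∃ g, IsBiPath c g ∧ ∀ i : ℕ, i < n → g i = f (c.2.length + i) := by
  obtain ⟨g, hg, hgf⟩ := exists_isPath_of_finite hf hf' (by omega)
  obtain ⟨k, hk, hkg⟩ := hg.exists_isBiPath
  refine ⟨_, hk.add c.2.length, fun i hi => ?_⟩
  rw [← hgf _ (by omega), ← hkg _ (by omega)]
  congr 1
  push_cast
  ring

/-! ## The trace from a covering by paths and a representation of the paths -/

/-- A form of König's lemma: the limit of the finite sequences along a nonprincipal ultrafilter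
exists because `s` is finite. -/
theorem exists_seq_of_forall_finite {α : Type*} {s : Set α} (hs : s.Finite)
    {R : ℕ → α → α → Prop}
    (h : ∀ m : ℕ, ∃ f : ℕ → α, (∀ t ≤ m, f t ∈ s) ∧ ∀ t < m, R t (f t) (f (t + 1))) :
    ∃ f : ℕ → α, (∀ t, f t ∈ s) ∧ ∀ t, R t (f t) (f (t + 1)) := by
  choose f hf hR using h
  have ev : ∀ t : ℕ, ∀ᶠ m in (Filter.hyperfilter ℕ : Filter ℕ), t ≤ m := fun t =>
    (Nat.hyperfilter_le_atTop) (Filter.eventually_ge_atTop t)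
  have lim : ∀ t : ℕ, ∃ a ∈ s, ∀ᶠ m in (Filter.hyperfilter ℕ : Filter ℕ), f m t = a := fun t => by
    have : (⋃ a ∈ s, {m | f m t = a}) ∈ Filter.hyperfilter ℕ := by
      refine Filter.mem_of_superset (ev t) fun m hm => ?_
      simpa using hf m t hm
    rwa [Ultrafilter.finite_biUnion_mem_iff hs] at this
  choose g hg hgl using lim
  refine ⟨g, hg, fun t => ?_⟩
  obtain ⟨m, h1, h2, h3⟩ := ((hgl t).and ((hgl (t + 1)).and (ev (t + 1)))).exists
  rw [← h1, ← h2]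
  exact hR m t h3

/-- Only predecessors are provided, so finite sequences are built backwards from each time `m`, and
compactness gives an infinite one. -/
theorem exists_seq_of_backward {α : Type*} {s : Set α} (hs : s.Finite) {S : ℕ → Set α}
    (hS : ∀ t, (S t).Nonempty) (hSs : ∀ t, S t ⊆ s) {R : ℕ → α → α → Prop}
    (hR : ∀ t, ∀ v' ∈ S (t + 1), ∃ v ∈ S t, R t v v') :
    ∃ f : ℕ → α, (∀ t, f t ∈ s) ∧ ∀ t, R t (f t) (f (t + 1)) := by
  have key : ∀ m, ∀ v ∈ S m, ∃ f : ℕ → α, f m = v ∧ (∀ t ≤ m, f t ∈ S t) ∧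
      ∀ t < m, R t (f t) (f (t + 1)) := by
    intro m
    induction m with
    | zero => exact fun v hv => ⟨fun _ => v, rfl, fun t ht => by rwa [Nat.le_zero.1 ht], by simp⟩
    | succ m ih =>
      intro v hv
      obtain ⟨w, hw, hwv⟩ := hR m v hv
      obtain ⟨f, h1, h2, h3⟩ := ih w hw
      refine ⟨fun t => if t = m + 1 then v else f t, if_pos rfl, fun t ht => ?_, fun t ht => ?_⟩
      · dsimp only
        split_ifs with h
        · rwa [h]
        · exact h2 t (by omega)
      · dsimp only
        rw [if_neg (by omega)]
        split_ifs with h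
        · obtain rfl : t = m := by omega
          rwa [h1]
        · exact h3 t (by omega)
  refine exists_seq_of_forall_finite hs fun m => ?_
  obtain ⟨v, hv⟩ := hS m
  obtain ⟨f, -, h1, h2⟩ := key m v hv
  exact ⟨f, fun t ht => hSs t (h1 t ht), h2⟩

theorem image_shift_eq {c : GraphCode} {j : ℕ} (hj : c.2.length ≤ j) :
    shift j '' c.shift = {z : ℕ → Fin c.1 | ∃ f, IsBiPath c f ∧ ∀ i : ℕ, (f i).2.1 = z i} := by
  ext z
  constructor
  · rintro ⟨y, hy, rfl⟩
    obtain ⟨f, hf, hfy⟩ := exists_isPath_of_mem_shift hy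
    obtain ⟨g, hg, hgf⟩ := hf.exists_isBiPath
    refine ⟨_, hg.add j, fun i => ?_⟩
    rw [shift_apply, ← hfy, ← hgf _ (by omega)]
    congr 3
    push_cast
    ring
  · rintro ⟨f, hf, hfz⟩
    refine ⟨fun i => ⟨(f (i - j)).2.1, (hf _).2.1⟩, ?_, ?_⟩
    · refine mem_shift_of_isPath (f := fun i : ℕ => f (i - j)) (fun i => ?_) fun i => rfl
      have := hf (i - j)
      refine ⟨this.1, this.2.1, this.2.2.trans ?_⟩
      congr 2
      push_cast
      ring
    · funext i
      rw [shift_apply, Fin.ext_iff, ← hfz]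
      simp

theorem coincideFrom_of_cover {c : GraphCode} {G : CellularAutomaton (Fin c.1)} {J L : ℕ}
    (hJ : ∀ x : ℤ → Fin c.1, (fun t => (G.global^[t + J] x) 0) ∈ c.shift)
    (hL : ∀ f, IsBiPath c f → ∃ x : ℤ → Fin c.1, ∀ t : ℕ,
      ((G.global^[t + 1] x 0 : Fin c.1) : ℕ) = (f (t + L)).2.1) :
    CoincideFrom (J + c.2.length + 1) G.trace c.shift := by
  rw [CoincideFrom, image_shift_eq (by omega)]
  ext z
  constructor
  · rintro ⟨_, ⟨x, rfl⟩, rfl⟩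
    have := Set.mem_image_of_mem (shift (c.2.length + 1)) (hJ x)
    rw [image_shift_eq (by omega)] at this
    convert this using 1
    funext t
    simp only [shift_apply]
    rw [show J + c.2.length + 1 + t = c.2.length + 1 + t + J by omega]
  · rintro ⟨f, hf, hfz⟩
    -- Moving a bi-infinite path backwards absorbs both the offset `L` of the encoding and the
    -- generations that are erased.
    obtain ⟨x, hx⟩ := hL _ (hf.add (-(L + (J + c.2.length : ℕ) : ℤ)))
    refine ⟨_, ⟨x, rfl⟩, funext fun t => Fin.ext ?_⟩
    rw [shift_apply, ← hfz, show J + c.2.length + 1 + t = (t + (J + c.2.length)) + 1 by omega, hx]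
    congr 3
    push_cast
    ring

/-! ## Finite words -/

/-- The words of length `d` on the letters of `L`. -/
def words {α : Type*} (L : List α) : ℕ → List (List α)
  | 0 => [[]]
  | d + 1 => (words L d).flatMap fun w => L.map fun a => a :: w

theorem mem_words {α : Type*} {L : List α} {d : ℕ} {w : List α} :
    w ∈ words L d ↔ w.length = d ∧ ∀ a ∈ w, a ∈ L := by
  induction d generalizing w with
  | zero =>
    simp only [words, List.mem_singleton, List.length_eq_zero_iff]
    exact ⟨fun h => by simp [h], fun h => h.1⟩
  | succ d ih =>
    simp only [words, List.mem_flatMap, List.mem_map, ih]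
    constructor
    · rintro ⟨v, ⟨h1, h2⟩, a, ha, rfl⟩
      exact ⟨by simp [h1], by simpa using ⟨ha, h2⟩⟩
    · rintro ⟨h1, h2⟩
      obtain ⟨a, v, rfl⟩ := List.exists_cons_of_length_eq_add_one h1
      exact ⟨v, ⟨by simpa using h1, fun b hb => h2 b (by simp [hb])⟩, a, h2 a (by simp), rfl⟩

/-- The word of `x` on the interval of length `len` from `lo`. -/
def segment {α : Type*} (x : ℤ → α) (lo : ℤ) (len : ℕ) : List α :=
  (List.range len).map fun j : ℕ => x (lo + j)

section Segment

variable {α : Type*} (x : ℤ → α) (lo : ℤ)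

@[simp] theorem length_segment (len : ℕ) : (segment x lo len).length = len := by simp [segment]

@[simp] theorem getElem_segment {len i : ℕ} (h : i < (segment x lo len).length) :
    (segment x lo len)[i] = x (lo + i) := by simp [segment]

theorem getD_segment {len i : ℕ} (h : i < len) (d : α) :
    (segment x lo len).getD i d = x (lo + i) := by
  rw [List.getD_eq_getElem _ _ (by simpa using h), getElem_segment]

theorem drop_segment (len i : ℕ) :
    (segment x lo len).drop i = segment x (lo + i) (len - i) := by
  refine List.ext_getElem (by simp) fun j h1 h2 => ?_
  simp only [List.getElem_drop, getElem_segment]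
  congr 1
  push_cast
  ring

theorem take_segment {len i : ℕ} (h : i ≤ len) :
    (segment x lo len).take i = segment x lo i := by
  refine List.ext_getElem (by simpa using h) fun j h1 h2 => ?_
  simp

theorem segment_append (a b : ℕ) :
    segment x lo (a + b) = segment x lo a ++ segment x (lo + a) b := by
  refine List.ext_getElem (by simp) fun j h1 h2 => ?_
  rw [List.getElem_append]
  split_ifs with h
  · simp
  · simp only [length_segment, not_lt] at h
    simp only [getElem_segment, length_segment]
    congr 1
    omega

theorem segment_mul (m b : ℕ) :
    segment x lo (m * b) = (List.range m).flatMap fun i : ℕ => segment x (lo + i * b) b := by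
  induction m with
  | zero => simp [segment]
  | succ m ih =>
    rw [add_mul, one_mul, segment_append, ih, List.range_succ, List.flatMap_append]
    simp

theorem segment_eq_ofFn (len : ℕ) :
    segment x lo len = List.ofFn fun j : Fin len => x (lo + (j : ℕ)) := by
  refine List.ext_getElem (by simp) fun j h1 h2 => ?_
  simp

variable {x lo}

theorem segment_congr {y : ℤ → α} {lo' : ℤ} {len : ℕ}
    (h : ∀ j : ℕ, j < len → x (lo + j) = y (lo' + j)) : segment x lo len = segment y lo' len := by
  refine List.ext_getElem (by simp) fun j h1 h2 => ?_
  simpa using h j (by simpa using h1)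

theorem eq_of_segment_eq {y : ℤ → α} {len : ℕ} (h : segment x lo len = segment y lo len)
    {i : ℤ} (h1 : lo ≤ i) (h2 : i < lo + len) : x i = y i := by
  obtain ⟨j, hj⟩ := Int.eq_ofNat_of_zero_le (sub_nonneg.2 h1)
  have e := congrArg (fun l => l[j]?) h
  simp only [segment, List.getElem?_map] at e
  rw [List.getElem?_range (by omega)] at e
  simp only [Option.map_some, Option.some.injEq] at e
  rwa [show lo + (j : ℤ) = i by omega] at e

end Segment

/-- The letters of a configuration, as natural numbers. -/
abbrev letters {n : ℕ} (x : ℤ → Fin n) : ℤ → ℕ := fun i => x i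

theorem segment_letters_mem_words {n : ℕ} (x : ℤ → Fin n) (lo : ℤ) (len : ℕ) :
    segment (letters x) lo len ∈ words (List.range n) len := by
  refine mem_words.2 ⟨by simp, fun a ha => ?_⟩
  simp only [segment, List.mem_map] at ha
  obtain ⟨j, -, rfl⟩ := ha
  simp

theorem exists_segment_of_mem_words {n : ℕ} {len : ℕ} (hlen : 0 < len) {w : List ℕ}
    (h : w ∈ words (List.range n) len) (lo : ℤ) :
    ∃ x : ℤ → Fin n, segment (letters x) lo len = w := by
  obtain ⟨h1, h2⟩ := mem_words.1 h
  have hn : ∀ i (hi : i < w.length), w[i] < n := fun i hi => by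
    simpa using h2 _ (List.getElem_mem hi)
  have hn0 : 0 < n := (Nat.zero_le _).trans_lt (hn 0 (by omega))
  refine ⟨fun i => if h : (i - lo).toNat < w.length then ⟨w[(i - lo).toNat], hn _ h⟩ else ⟨0, hn0⟩,
    List.ext_getElem (by simp [h1]) fun j h3 h4 => ?_⟩
  simp [letters, h4]

/-! ## Cellular automata acting on finite words -/

theorem CellularAutomaton.global_add {A : Type*} (G : CellularAutomaton A) (x : ℤ → A) (m i : ℤ) :
    G.global (fun k => x (k + m)) i = G.global x (i + m) := by
  simp only [CellularAutomaton.global]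
  congr 1
  funext j
  congr 1
  ring

theorem CellularAutomaton.iterate_global_add {A : Type*} (G : CellularAutomaton A) (x : ℤ → A)
    (m : ℤ) (t : ℕ) : G.global^[t] (fun k => x (k + m)) = fun i => G.global^[t] x (i + m) := by
  induction t with
  | zero => rfl
  | succ t ih =>
    funext i
    rw [Function.iterate_succ_apply', Function.iterate_succ_apply', ih, global_add]

/-- One step of the automaton of radius `r` and table `T` on a finite word. -/
def stepList (r : ℕ) (T : List (List ℕ × ℕ)) (w : List ℕ) : List ℕ :=
  (List.range (w.length - 2 * r)).map fun i =>
    (T.lookup ((w.drop i).take (2 * r + 1))).getD 0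

theorem stepList_segment {n r : ℕ} {T : List (List ℕ × ℕ)} {G : CellularAutomaton (Fin n)}
    (hG : CACode.Represents ((r : ℤ), 2 * r + 1, T) G) (x : ℤ → Fin n) (lo : ℤ) (len : ℕ) :
    stepList r T (segment (letters x) lo len) =
      segment (letters (G.global x)) (lo + r) (len - 2 * r) := by
  obtain ⟨h1, h2, h3⟩ := hG
  simp only at h1 h2 h3
  refine List.ext_getElem (by simp [stepList]) fun i hi hi' => ?_
  simp only [length_segment] at hi'
  have hl : List.lookup (segment (letters x) (lo + i) (2 * r + 1)) T =
      some (G.global x (lo + r + i) : ℕ) := by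
    rw [h2, segment_eq_ofFn, h3 fun j => x (lo + i + (j : ℕ)), CellularAutomaton.global, ← h1]
    congr 4
    funext j
    congr 1
    ring
  simp only [stepList, List.getElem_map, List.getElem_range, getElem_segment]
  rw [drop_segment, take_segment _ _ (by omega), hl]
  simp [letters]

theorem iterate_stepList_segment {n r : ℕ} {T : List (List ℕ × ℕ)} {G : CellularAutomaton (Fin n)}
    (hG : CACode.Represents ((r : ℤ), 2 * r + 1, T) G) (x : ℤ → Fin n) (lo : ℤ) (len t : ℕ) :
    (stepList r T)^[t] (segment (letters x) lo len) =
      segment (letters (G.global^[t] x)) (lo + (r * t : ℕ)) (len - 2 * (r * t)) := by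
  induction t with
  | zero => simp
  | succ t ih =>
    rw [Function.iterate_succ_apply', Function.iterate_succ_apply', ih, stepList_segment hG]
    congr 1
    · push_cast; ring
    · rw [Nat.sub_sub, mul_add, mul_one, mul_add]

/-! ## Checking a cellular automaton -/

/-- Every word of length `2r+1` has an image in the table. -/
def TableCheck (n r : ℕ) (T : List (List ℕ × ℕ)) : Prop :=
  ∀ w ∈ words (List.range n) (2 * r + 1), ∃ a ∈ List.range n, T.lookup w = some a

/-- `C` relates words of length `2R+1` to vertices of the graph, in such a way that the vertices
related to a configuration and to its image are the ends of an edge whose label is the letter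
of the cell `0` after `J` steps. -/
def CoverCheck (c : GraphCode) (r : ℕ) (T : List (List ℕ × ℕ)) (J R : ℕ)
    (C : List (List ℕ × ℕ)) : Prop :=
  r * J ≤ R ∧
  (∀ w ∈ words (List.range c.1) (2 * R + 1), ∃ p ∈ C, p.1 = w) ∧
  ∀ w ∈ words (List.range c.1) (2 * R + 1 + 2 * r), ∀ p ∈ C, p.1 = stepList r T w →
    ∃ p' ∈ C, p'.1 = (w.drop r).take (2 * R + 1) ∧
      (p'.2, ((stepList r T)^[J] w).getD (R + r - r * J) 0, p.2) ∈ c.2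

/-- The edges of the word `P` are labelled by letters and form a path. -/
def ChainCheck (n : ℕ) (P : List (ℕ × ℕ × ℕ)) : Prop :=
  (∀ e ∈ P, e.2.1 < n) ∧
  ∀ i ∈ List.range (P.length - 1), (P.getD i (0, 0, 0)).2.2 = (P.getD (i + 1) (0, 0, 0)).1

/-- The block that the code `e` associates to the `2L` edges of the path `P` from the `i`-th
segment on. -/
def block (L : ℕ) (e : List (List (ℕ × ℕ × ℕ) × List ℕ)) (P : List (ℕ × ℕ × ℕ)) (i : ℕ) :
    List ℕ :=
  (e.lookup ((P.drop (i * L)).take (2 * L))).getD []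

/-- `e` encodes the paths into rows of blocks of length `B`, in such a way that `L` steps of the
automaton shift the path by `L`, and that the cell `δ` of the block spells the labels. -/
def PathCheck (c : GraphCode) (r : ℕ) (T : List (List ℕ × ℕ)) (L B δ : ℕ)
    (e : List (List (ℕ × ℕ × ℕ) × List ℕ)) : Prop :=
  0 < L ∧ δ < B ∧
  ∀ P ∈ words c.2 (c.2.length + (2 * (r * L + 1) + 2) * L + c.2.length), ChainCheck c.1 P →
    (block L e (P.drop c.2.length) 0).length = B ∧
    (∀ a ∈ block L e (P.drop c.2.length) 0, a < c.1) ∧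
    (∀ l ∈ List.range B,
      ((stepList r T)^[L] ((List.range (2 * (r * L + 1) + 1)).flatMap
        (block L e (P.drop c.2.length)))).getD ((r * L + 1) * B - r * L + l) 0 =
      ((List.range (2 * (r * L + 1) + 1)).flatMap (block L e (P.drop c.2.length))).getD
        ((r * L + 2) * B + l) 0) ∧
    ∀ φ ∈ List.range L,
      ((stepList r T)^[φ + 1] ((List.range (2 * (r * L + 1) + 1)).flatMap
        (block L e (P.drop c.2.length)))).getD ((r * L + 1) * B + δ - r * (φ + 1)) 0 =
      (P.getD (c.2.length + (r * L + 2) * L + φ) (0, 0, 0)).2.1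

theorem TableCheck.exists_represents {n r : ℕ} {T : List (List ℕ × ℕ)} (h : TableCheck n r T) :
    ∃ G : CellularAutomaton (Fin n), CACode.Represents ((r : ℤ), 2 * r + 1, T) G := by
  have h' : ∀ w : Fin (2 * r + 1) → Fin n, ∃ a : Fin n,
      T.lookup (List.ofFn fun j => (w j : ℕ)) = some (a : ℕ) := fun w => by
    obtain ⟨a, ha, hw⟩ := h (List.ofFn fun j => (w j : ℕ)) (mem_words.2 ⟨by simp, by simp⟩)
    exact ⟨⟨a, by simpa using ha⟩, hw⟩
  choose f hf using h'
  exact ⟨⟨r, 2 * r + 1, by omega, f⟩, rfl, rfl, hf⟩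

/-- The vertices that `C` relates to the window around the cell `0` form a nonempty finite set at
each time, and each has a predecessor through an edge with the right label: `exists_seq_of_backward`
extracts a path. -/
theorem CoverCheck.mem_shift {c : GraphCode} {r J R : ℕ} {T C : List (List ℕ × ℕ)}
    {G : CellularAutomaton (Fin c.1)} (hG : CACode.Represents ((r : ℤ), 2 * r + 1, T) G)
    (h : CoverCheck c r T J R C) (x : ℤ → Fin c.1) :
    (fun t => (G.global^[t + J] x) 0) ∈ c.shift := by
  obtain ⟨hJR, h1, h2⟩ := h
  let S : ℕ → Set ℕ := fun t =>
    {v | (segment (letters (G.global^[t] x)) (-R) (2 * R + 1), v) ∈ C}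
  have hfin : (Set.range fun i : Fin C.length => C[i].2).Finite := Set.finite_range _
  have hne : ∀ t, (S t).Nonempty := fun t => by
    obtain ⟨⟨w, v⟩, hp, he⟩ := h1 _ (segment_letters_mem_words (G.global^[t] x) (-R) (2 * R + 1))
    simp only at he
    subst he
    exact ⟨v, hp⟩
  have hsub : ∀ t, S t ⊆ Set.range fun i : Fin C.length => C[i].2 := fun t v hv => by
    obtain ⟨i, hi, he⟩ := List.mem_iff_getElem.1 hv
    exact ⟨⟨i, hi⟩, by simp [he]⟩
  obtain ⟨v, -, hv⟩ := exists_seq_of_backward hfin hne hsub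
    (R := fun t v v' => (v, (G.global^[t + J] x 0 : ℕ), v') ∈ c.2) (by
      intro t v' hv'
      have hw := segment_letters_mem_words (G.global^[t] x) (-R - r) (2 * R + 1 + 2 * r)
      obtain ⟨⟨w, v⟩, hp, he, hE⟩ := h2 _ hw _ hv' (by
        rw [stepList_segment hG, ← Function.iterate_succ_apply' G.global]
        simp)
      refine ⟨v, ?_, ?_⟩
      · simp only at he
        rw [drop_segment, take_segment _ _ (by omega), sub_add_cancel] at he
        rw [he] at hp
        exact hp
      · have hlt : r * J ≤ R := hJR
        rw [iterate_stepList_segment hG, getD_segment _ _ (by omega)] at hE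
        rw [← Function.iterate_add_apply, add_comm J t] at hE
        dsimp only at hE
        rwa [show (-R - r + (r * J : ℕ) + (R + r - r * J : ℕ) : ℤ) = 0 by omega] at hE)
  exact ⟨v, hv⟩

/-- The blocks of the code are juxtaposed into a configuration `Φ`. Finite checks suffice: during
`L` steps information travels `r * L` cells, less than the `H` blocks that surround the middle one
in the checked words. -/
theorem PathCheck.exists_config {c : GraphCode} {r L B δ : ℕ} {T : List (List ℕ × ℕ)}
    {e : List (List (ℕ × ℕ × ℕ) × List ℕ)} {G : CellularAutomaton (Fin c.1)}
    (hG : CACode.Represents ((r : ℤ), 2 * r + 1, T) G) (h : PathCheck c r T L B δ e)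
    {f : ℤ → ℕ × ℕ × ℕ} (hf : IsBiPath c f) :
    ∃ x : ℤ → Fin c.1, ∀ t : ℕ, ((G.global^[t + 1] x 0 : Fin c.1) : ℕ) = (f (t + L)).2.1 := by
  obtain ⟨hL, hδ, h⟩ := h
  set s := c.2.length with hs
  set H := r * L + 1 with hH
  have hB : 0 < B := by omega
  have hrL : r * L ≤ H * B := (Nat.le_succ _).trans (Nat.le_mul_of_pos_right H hB)
  have hchain : ∀ lo len, ChainCheck c.1 (segment f lo len) := fun lo len => by
    refine ⟨fun a ha => ?_, fun i hi => ?_⟩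
    · simp only [segment, List.mem_map] at ha
      obtain ⟨j, -, rfl⟩ := ha
      exact (hf _).2.1
    · simp only [length_segment, List.mem_range] at hi
      rw [getD_segment _ _ (by omega), getD_segment _ _ (by omega), (hf _).2.2]
      push_cast
      rw [add_assoc]
  have hword : ∀ lo len, segment f lo len ∈ words c.2 len := fun lo len => by
    refine mem_words.2 ⟨by simp, fun a ha => ?_⟩
    simp only [segment, List.mem_map] at ha
    obtain ⟨j, -, rfl⟩ := ha
    exact (hf _).1
  set len := s + (2 * H + 2) * L + s with hlen
  have hmain := fun lo => h _ (hword lo len) (hchain lo len)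
  set blk : ℤ → List ℕ := fun k => (e.lookup (segment f (k * L) (2 * L))).getD [] with hblk
  have hLL : (2 * H + 2) * L = 2 * H * L + 2 * L := by ring
  have hblock : ∀ (lo : ℤ) (i : ℕ), i < 2 * H + 1 →
      block L e ((segment f (lo * L - s) len).drop s) i = blk (lo + i) := fun lo i hi => by
    have : i * L + 2 * L ≤ (2 * H + 2) * L := by
      rw [← add_mul]; exact Nat.mul_le_mul_right L (by omega)
    rw [block, drop_segment, drop_segment, take_segment _ _ (by omega), hblk]
    simp only
    congr 3
    push_cast
    ring
  have hblen : ∀ k, (blk k).length = B := fun k => by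
    have := (hmain (k * L - s)).1
    rwa [hblock k 0 (by omega), Nat.cast_zero, add_zero] at this
  have hblt : ∀ k, ∀ a ∈ blk k, a < c.1 := fun k => by
    have := (hmain (k * L - s)).2.1
    rwa [hblock k 0 (by omega), Nat.cast_zero, add_zero] at this
  have hmod : ∀ i : ℤ, (i % B).toNat < B := fun i => by
    have := Int.emod_lt_of_pos i (b := B) (by omega)
    have := Int.emod_nonneg i (b := B) (by omega)
    omega
  let Φ : ℤ → Fin c.1 := fun i => ⟨(blk (i / B))[(i % B).toNat]'(by rw [hblen]; exact hmod i),
    hblt _ _ (List.getElem_mem _)⟩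
  have hΦ : ∀ k, segment (letters Φ) (k * B) B = blk k := fun k => by
    refine List.ext_getElem (by simp [hblen]) fun l h1 h2 => ?_
    rw [hblen] at h2
    have e1 : (k * B + l) / (B : ℤ) = k := by
      rw [add_comm, Int.add_mul_ediv_right _ _ (by omega), Int.ediv_eq_zero_of_lt] <;> omega
    have e2 : (k * B + l) % (B : ℤ) = l := by
      rw [add_comm, Int.add_mul_emod_self_right, Int.emod_eq_of_lt] <;> omega
    simp [letters, Φ, e1, e2]
  have hrow : ∀ lo : ℤ, (List.range (2 * H + 1)).flatMap
      (block L e ((segment f (lo * L - s) len).drop s)) =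
      segment (letters Φ) (lo * B) ((2 * H + 1) * B) := fun lo => by
    rw [segment_mul]
    refine List.flatMap_congr fun i hi => ?_
    rw [List.mem_range] at hi
    rw [hblock lo i hi, ← hΦ]
    congr 1
    ring
  have hBB : (2 * H + 1) * B = 2 * (H * B) + B := by ring
  have hHB : (H + 1) * B = H * B + B := by ring
  have hH1 : 1 * B ≤ H * B := Nat.mul_le_mul_right B (by omega)
  have hiter : ∀ i, G.global^[L] Φ i = Φ (i + B) := by
    intro i
    obtain ⟨l, hl⟩ := Int.eq_ofNat_of_zero_le (Int.emod_nonneg i (b := B) (by omega))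
    have hi : i = i / B * B + l := by
      rw [← hl, mul_comm]; exact (Int.mul_ediv_add_emod i B).symm
    have hl' : l < B := by have := Int.emod_lt_of_pos i (b := B) (by omega); omega
    have := (hmain ((i / B - H) * L - s)).2.2.1 l (List.mem_range.2 hl')
    rw [hrow, iterate_stepList_segment hG, show r * L + 2 = H + 1 by omega,
      getD_segment _ _ (by omega), getD_segment _ _ (by omega)] at this
    have h2 := Fin.ext this
    rw [sub_mul] at h2
    convert h2 using 2
    · conv_lhs => rw [hi]
      push_cast [hrL]
      ring
    · conv_lhs => rw [hi]
      push_cast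
      ring
  have hiterm : ∀ m : ℕ, G.global^[m * L] Φ = fun i => Φ (i + m * B) := by
    intro m
    induction m with
    | zero => simp
    | succ m ih =>
      funext i
      rw [add_mul, one_mul, add_comm, Function.iterate_add_apply, ih, G.iterate_global_add]
      refine (hiter _).trans ?_
      congr 1
      push_cast
      ring
  refine ⟨fun i => Φ (i + δ), fun t => ?_⟩
  rw [G.iterate_global_add]
  -- Whole rounds of `L` steps merely move the row by whole blocks; the remaining `φ + 1 ≤ L` steps
  -- are those of the last clause of the check.
  obtain ⟨φ, hφ⟩ : ∃ φ, φ = t % L := ⟨_, rfl⟩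
  obtain ⟨m, hm⟩ : ∃ m, m = t / L := ⟨_, rfl⟩
  have hφL : φ < L := hφ ▸ Nat.mod_lt t hL
  have ht : t = φ + m * L := by rw [hφ, hm]; exact (Nat.mod_add_div' t L).symm
  have hrφ : r * (φ + 1) ≤ r * L := Nat.mul_le_mul_left r hφL
  rw [show t + 1 = (φ + 1) + m * L by omega, Function.iterate_add_apply, hiterm,
    G.iterate_global_add]
  have := (hmain ((m - H) * L - s)).2.2.2 φ (List.mem_range.2 hφL)
  have hb : s + (r * L + 2) * L + φ < len := by
    have : (r * L + 2) * L + L ≤ (2 * H + 2) * L := by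
      rw [← Nat.succ_mul]
      exact Nat.mul_le_mul_right L (by omega)
    omega
  rw [hrow, iterate_stepList_segment hG, getD_segment _ _ (by omega), getD_segment _ _ hb] at this
  convert this using 2
  · refine congrArg (G.global^[φ + 1] Φ) ?_
    rw [Nat.cast_sub (by omega)]
    push_cast
    ring
  · congr 2
    rw [ht, hH]
    push_cast
    ring

/-! ## The checks are primitive recursive -/

section Primrec

variable {α β γ : Type*} [Primcodable α] [Primcodable β] [Primcodable γ]

theorem primrecPred_forall_mem {f : α → List β} {p : α → β → Prop} (hf : Primrec f)
    (hp : PrimrecPred fun q : α × β => p q.1 q.2) : PrimrecPred fun a => ∀ b ∈ f a, p a b := by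
  have h : PrimrecRel fun (b : β) (a : α) => p a b :=
    hp.comp (Primrec.pair Primrec.snd Primrec.fst)
  exact (h.forall_mem_list).comp hf Primrec.id

theorem primrecPred_exists_mem {f : α → List β} {p : α → β → Prop} (hf : Primrec f)
    (hp : PrimrecPred fun q : α × β => p q.1 q.2) : PrimrecPred fun a => ∃ b ∈ f a, p a b := by
  have h : PrimrecRel fun (b : β) (a : α) => p a b :=
    hp.comp (Primrec.pair Primrec.snd Primrec.fst)
  exact (h.exists_mem_list).comp hf Primrec.id

theorem primrecPred_imp {p q : α → Prop} (hp : PrimrecPred p) (hq : PrimrecPred q) :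
    PrimrecPred fun a => p a → q a :=
  (hp.not.or hq).of_eq fun _ => imp_iff_not_or.symm

theorem primrecPred_mem [DecidableEq β] {f : α → β} {l : α → List β} (hf : Primrec f) (hl : Primrec l) :
    PrimrecPred fun a => f a ∈ l a :=
  (primrecPred_exists_mem (p := fun a b => b = f a) hl
    (Primrec.eq.comp Primrec.snd (hf.comp Primrec.fst))).of_eq fun a => by simp

theorem primrec_lookup [DecidableEq β] [i : BEq β] [LawfulBEq β] {f : α → β}
    {l : α → List (β × γ)} (hf : Primrec f) (hl : Primrec l) :
    Primrec fun a => (l a).lookup (f a) := by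
  -- All lawful equality tests agree, so the one derived from decidable equality can be used.
  have h : i = instBEqOfDecidableEq := by
    ext a b
    exact Bool.eq_iff_iff.2 (beq_iff_eq.trans (@beq_iff_eq _ instBEqOfDecidableEq _ a b).symm)
  subst h
  exact Primrec.listLookup.comp hf hl

theorem primrec_words {L : α → List β} {d : α → ℕ} (hL : Primrec L) (hd : Primrec d) :
    Primrec fun a => words (L a) (d a) := by
  have h : Primrec fun a => Nat.rec (motive := fun _ => List (List β)) [[]]
      (fun _ v => v.flatMap fun w => (L a).map fun b => b :: w) (d a) := by
    refine Primrec.nat_rec' (h := fun a p => p.2.flatMap fun w => (L a).map fun b => b :: w) hd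
      (Primrec.const ([[]] : List (List β))) ?_
    change Primrec fun _ : α × ℕ × List (List β) => _
    refine Primrec.list_flatMap (Primrec.snd.comp Primrec.snd) ?_
    change Primrec fun _ : (α × ℕ × List (List β)) × List β => _
    refine Primrec.list_map (hL.comp (Primrec.fst.comp Primrec.fst)) ?_
    change Primrec fun _ : ((α × ℕ × List (List β)) × List β) × β => _
    exact Primrec.list_cons.comp Primrec.snd (Primrec.snd.comp Primrec.fst)
  refine h.of_eq fun a => ?_
  generalize d a = n
  induction n with
  | zero => rfl
  | succ n ih => simp only [words, ← ih]

theorem primrec_stepList {r : α → ℕ} {T : α → List (List ℕ × ℕ)} {w : α → List ℕ}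
    (hr : Primrec r) (hT : Primrec T) (hw : Primrec w) :
    Primrec fun a => stepList (r a) (T a) (w a) := by
  have h2 : Primrec fun a => 2 * r a := Primrec.nat_mul.comp (Primrec.const 2) hr
  refine Primrec.list_map (Primrec.list_range.comp
    (Primrec.nat_sub.comp (Primrec.list_length.comp hw) h2)) ?_
  change Primrec fun _ : α × ℕ => _
  refine Primrec.option_getD.comp (primrec_lookup ?_ (hT.comp Primrec.fst)) (Primrec.const 0)
  exact Primrec.list_take.comp (Primrec.succ.comp (h2.comp Primrec.fst))
    (Primrec.list_drop.comp Primrec.snd (hw.comp Primrec.fst))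

theorem primrec_iterate_stepList {r t : α → ℕ} {T : α → List (List ℕ × ℕ)} {w : α → List ℕ}
    (hr : Primrec r) (hT : Primrec T) (ht : Primrec t) (hw : Primrec w) :
    Primrec fun a => (stepList (r a) (T a))^[t a] (w a) :=
  Primrec.nat_iterate ht hw (Primrec.to₂ (primrec_stepList (hr.comp Primrec.fst)
    (hT.comp Primrec.fst) Primrec.snd))

theorem primrecPred_tableCheck {n r : α → ℕ} {T : α → List (List ℕ × ℕ)} (hn : Primrec n)
    (hr : Primrec r) (hT : Primrec T) : PrimrecPred fun a => TableCheck (n a) (r a) (T a) := by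
  refine primrecPred_forall_mem (primrec_words (Primrec.list_range.comp hn)
    (Primrec.succ.comp (Primrec.nat_mul.comp (Primrec.const 2) hr))) ?_
  refine primrecPred_exists_mem (Primrec.list_range.comp (hn.comp Primrec.fst)) ?_
  exact Primrec.eq.comp (primrec_lookup (Primrec.snd.comp Primrec.fst)
    (hT.comp (Primrec.fst.comp Primrec.fst))) (Primrec.option_some.comp Primrec.snd)

theorem primrecPred_coverCheck {c : α → GraphCode} {r J R : α → ℕ} {T C : α → List (List ℕ × ℕ)}
    (hc : Primrec c) (hr : Primrec r) (hT : Primrec T) (hJ : Primrec J) (hR : Primrec R)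
    (hC : Primrec C) : PrimrecPred fun a => CoverCheck (c a) (r a) (T a) (J a) (R a) (C a) := by
  have hn : Primrec fun a => List.range (c a).1 := Primrec.list_range.comp (Primrec.fst.comp hc)
  have hR2 : Primrec fun a => 2 * R a + 1 :=
    Primrec.succ.comp (Primrec.nat_mul.comp (Primrec.const 2) hR)
  have hr2 : Primrec fun a => 2 * r a := Primrec.nat_mul.comp (Primrec.const 2) hr
  have hrJ : Primrec fun a => r a * J a := Primrec.nat_mul.comp hr hJ
  refine (Primrec.nat_le.comp hrJ hR).and ((?_ : PrimrecPred _).and ?_)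
  · refine primrecPred_forall_mem (primrec_words hn hR2) ?_
    refine primrecPred_exists_mem (hC.comp Primrec.fst) ?_
    exact Primrec.eq.comp (Primrec.fst.comp Primrec.snd) (Primrec.snd.comp Primrec.fst)
  · refine primrecPred_forall_mem (primrec_words hn (Primrec.nat_add.comp hR2 hr2)) ?_
    refine primrecPred_forall_mem (hC.comp Primrec.fst) ?_
    have p1 : Primrec fun q : (α × List ℕ) × List ℕ × ℕ => q.1.1 := Primrec.fst.comp Primrec.fst
    have p2 : Primrec fun q : (α × List ℕ) × List ℕ × ℕ => q.1.2 := Primrec.snd.comp Primrec.fst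
    refine primrecPred_imp (Primrec.eq.comp (Primrec.fst.comp Primrec.snd)
      (primrec_stepList (hr.comp p1) (hT.comp p1) p2)) ?_
    refine primrecPred_exists_mem (hC.comp p1) ?_
    have q0 : Primrec fun q : ((α × List ℕ) × List ℕ × ℕ) × List ℕ × ℕ => q.1 := Primrec.fst
    have q1 := p1.comp q0
    have q2 := p2.comp q0
    refine (Primrec.eq.comp (Primrec.fst.comp Primrec.snd) (Primrec.list_take.comp (hR2.comp q1)
      (Primrec.list_drop.comp (hr.comp q1) q2))).and ?_
    refine primrecPred_mem ?_ (Primrec.snd.comp (hc.comp q1))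
    refine Primrec.pair (Primrec.snd.comp Primrec.snd) (Primrec.pair ?_
      (Primrec.snd.comp (Primrec.snd.comp q0)))
    exact (Primrec.list_getD 0).comp (primrec_iterate_stepList (hr.comp q1) (hT.comp q1)
      (hJ.comp q1) q2) (Primrec.nat_sub.comp (Primrec.nat_add.comp (hR.comp q1) (hr.comp q1))
        (hrJ.comp q1))

theorem primrecPred_chainCheck {n : α → ℕ} {P : α → List (ℕ × ℕ × ℕ)} (hn : Primrec n)
    (hP : Primrec P) : PrimrecPred fun a => ChainCheck (n a) (P a) := by
  refine (primrecPred_forall_mem hP (Primrec.nat_lt.comp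
    (Primrec.fst.comp (Primrec.snd.comp Primrec.snd)) (hn.comp Primrec.fst))).and
    (primrecPred_forall_mem (Primrec.list_range.comp (Primrec.pred.comp
      (Primrec.list_length.comp hP))) ?_)
  have hg := Primrec.list_getD ((0, 0, 0) : ℕ × ℕ × ℕ)
  exact Primrec.eq.comp
    (Primrec.snd.comp (Primrec.snd.comp (hg.comp (hP.comp Primrec.fst) Primrec.snd)))
    (Primrec.fst.comp (hg.comp (hP.comp Primrec.fst) (Primrec.succ.comp Primrec.snd)))

theorem primrec_block {L i : α → ℕ} {e : α → List (List (ℕ × ℕ × ℕ) × List ℕ)}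
    {P : α → List (ℕ × ℕ × ℕ)} (hL : Primrec L) (he : Primrec e) (hP : Primrec P)
    (hi : Primrec i) : Primrec fun a => block (L a) (e a) (P a) (i a) :=
  Primrec.option_getD.comp (primrec_lookup
    (Primrec.list_take.comp (Primrec.nat_mul.comp (Primrec.const 2) hL)
      (Primrec.list_drop.comp (Primrec.nat_mul.comp hi hL) hP)) he) (Primrec.const [])

theorem primrecPred_pathCheck {c : α → GraphCode} {r L B δ : α → ℕ} {T : α → List (List ℕ × ℕ)}
    {e : α → List (List (ℕ × ℕ × ℕ) × List ℕ)} (hc : Primrec c) (hr : Primrec r) (hT : Primrec T)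
    (hL : Primrec L) (hB : Primrec B) (hδ : Primrec δ) (he : Primrec e) :
    PrimrecPred fun a => PathCheck (c a) (r a) (T a) (L a) (B a) (δ a) (e a) := by
  have hs : Primrec fun a => (c a).2.length := Primrec.list_length.comp (Primrec.snd.comp hc)
  have hrL : Primrec fun a => r a * L a := Primrec.nat_mul.comp hr hL
  have hH : Primrec fun a => r a * L a + 1 := Primrec.succ.comp hrL
  have hH2 : Primrec fun a => 2 * (r a * L a + 1) := Primrec.nat_mul.comp (Primrec.const 2) hH
  have hlen : Primrec fun a =>
      (c a).2.length + (2 * (r a * L a + 1) + 2) * L a + (c a).2.length :=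
    Primrec.nat_add.comp (Primrec.nat_add.comp hs (Primrec.nat_mul.comp
      (Primrec.nat_add.comp hH2 (Primrec.const 2)) hL)) hs
  refine (Primrec.nat_lt.comp (Primrec.const 0) hL).and ((Primrec.nat_lt.comp hδ hB).and ?_)
  refine primrecPred_forall_mem (primrec_words (Primrec.snd.comp hc) hlen) ?_
  have p1 : Primrec fun q : α × List (ℕ × ℕ × ℕ) => q.1 := Primrec.fst
  have p2 : Primrec fun q : α × List (ℕ × ℕ × ℕ) => q.2 := Primrec.snd
  refine primrecPred_imp (primrecPred_chainCheck (Primrec.fst.comp (hc.comp p1)) p2) ?_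
  have hd : Primrec fun q : α × List (ℕ × ℕ × ℕ) => q.2.drop (c q.1).2.length :=
    Primrec.list_drop.comp (hs.comp p1) p2
  have h0 := primrec_block (hL.comp p1) (he.comp p1) hd (Primrec.const 0)
  have hX : Primrec fun q : α × List (ℕ × ℕ × ℕ) =>
      (List.range (2 * (r q.1 * L q.1 + 1) + 1)).flatMap
        (block (L q.1) (e q.1) (q.2.drop (c q.1).2.length)) := by
    refine Primrec.list_flatMap (Primrec.list_range.comp (Primrec.succ.comp (hH2.comp p1))) ?_
    change Primrec fun _ : (α × List (ℕ × ℕ × ℕ)) × ℕ => _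
    exact primrec_block (hL.comp (p1.comp Primrec.fst)) (he.comp (p1.comp Primrec.fst))
      (hd.comp Primrec.fst) Primrec.snd
  refine (Primrec.eq.comp (Primrec.list_length.comp h0) (hB.comp p1)).and
    ((?_ : PrimrecPred _).and ((?_ : PrimrecPred _).and ?_))
  · exact primrecPred_forall_mem h0 (Primrec.nat_lt.comp Primrec.snd
      (Primrec.fst.comp (hc.comp (p1.comp Primrec.fst))))
  · refine primrecPred_forall_mem (Primrec.list_range.comp (hB.comp p1)) ?_
    have q1 := p1.comp (Primrec.fst (β := ℕ))
    refine Primrec.eq.comp ((Primrec.list_getD 0).comp (primrec_iterate_stepList (hr.comp q1)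
      (hT.comp q1) (hL.comp q1) (hX.comp Primrec.fst)) ?_)
      ((Primrec.list_getD 0).comp (hX.comp Primrec.fst) ?_)
    · exact Primrec.nat_add.comp (Primrec.nat_sub.comp (Primrec.nat_mul.comp (hH.comp q1)
        (hB.comp q1)) (hrL.comp q1)) Primrec.snd
    · exact Primrec.nat_add.comp (Primrec.nat_mul.comp (Primrec.succ.comp (hH.comp q1))
        (hB.comp q1)) Primrec.snd
  · refine primrecPred_forall_mem (Primrec.list_range.comp (hL.comp p1)) ?_
    have q1 := p1.comp (Primrec.fst (β := ℕ))
    refine Primrec.eq.comp ((Primrec.list_getD 0).comp (primrec_iterate_stepList (hr.comp q1)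
      (hT.comp q1) (Primrec.succ.comp Primrec.snd) (hX.comp Primrec.fst)) ?_)
      (Primrec.fst.comp (Primrec.snd.comp ((Primrec.list_getD (0, 0, 0)).comp
        (p2.comp Primrec.fst) ?_)))
    · exact Primrec.nat_sub.comp (Primrec.nat_add.comp (Primrec.nat_mul.comp (hH.comp q1)
        (hB.comp q1)) (hδ.comp q1)) (Primrec.nat_mul.comp (hr.comp q1)
          (Primrec.succ.comp Primrec.snd))
    · exact Primrec.nat_add.comp (Primrec.nat_add.comp (hs.comp q1) (Primrec.nat_mul.comp
        (Primrec.succ.comp (hH.comp q1)) (hL.comp q1))) Primrec.snd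

end Primrec

/-! ## The search algorithm -/

/-- `((r, T), (J, R, C), (L, B, δ, e))`: a cellular automaton of radius `r`, a covering and an
encoding of paths. -/
abbrev Certificate : Type :=
  (ℕ × List (List ℕ × ℕ)) × (ℕ × ℕ × List (List ℕ × ℕ)) ×
    (ℕ × ℕ × ℕ × List (List (ℕ × ℕ × ℕ) × List ℕ))

/-- The certificate is valid for the graph `c`. -/
def Certificate.Valid (c : GraphCode) (w : Certificate) : Prop :=
  TableCheck c.1 w.1.1 w.1.2 ∧ CoverCheck c w.1.1 w.1.2 w.2.1.1 w.2.1.2.1 w.2.1.2.2 ∧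
    PathCheck c w.1.1 w.1.2 w.2.2.1 w.2.2.2.1 w.2.2.2.2.1 w.2.2.2.2.2

theorem primrecPred_valid :
    PrimrecPred fun p : GraphCode × Certificate => Certificate.Valid p.1 p.2 := by
  have c : Primrec fun p : GraphCode × Certificate => p.1 := Primrec.fst
  have w : Primrec fun p : GraphCode × Certificate => p.2 := Primrec.snd
  have r := Primrec.fst.comp (Primrec.fst.comp w)
  have T := Primrec.snd.comp (Primrec.fst.comp w)
  have w2 := Primrec.snd.comp w
  have u := Primrec.fst.comp w2
  have v := Primrec.snd.comp w2
  refine (primrecPred_tableCheck (Primrec.fst.comp c) r T).and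
    ((primrecPred_coverCheck c r T (Primrec.fst.comp u) (Primrec.fst.comp (Primrec.snd.comp u))
      (Primrec.snd.comp (Primrec.snd.comp u))).and ?_)
  have v2 := Primrec.snd.comp v
  have v3 := Primrec.snd.comp v2
  exact primrecPred_pathCheck c r T (Primrec.fst.comp v) (Primrec.fst.comp v2)
    (Primrec.fst.comp v3) (Primrec.snd.comp v3)

theorem Certificate.Valid.exists_coincideFrom {c : GraphCode} {w : Certificate}
    (h : w.Valid c) : ∃ G : CellularAutomaton (Fin c.1),
      CACode.Represents ((w.1.1 : ℤ), 2 * w.1.1 + 1, w.1.2) G ∧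
      CoincideFrom (w.2.1.1 + c.2.length + 1) G.trace c.shift := by
  obtain ⟨h1, h2, h3⟩ := h
  obtain ⟨G, hG⟩ := h1.exists_represents
  exact ⟨G, hG, coincideFrom_of_cover (fun x => h2.mem_shift hG x)
    fun f hf => h3.exists_config hG hf⟩

theorem primrec_intCast : Primrec fun n : ℕ => (n : ℤ) := by
  rw [← Primrec.encode_iff]
  exact (Primrec.nat_mul.comp (Primrec.const 2) Primrec.id).of_eq fun n => rfl

/-- Searching for a valid certificate is an algorithm. -/
theorem effectivelyUltimatelyTraceable_of_certificate {D : Type} [Primcodable D] {size : D → ℕ}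
    {shiftOf : (d : D) → Set (ℕ → Fin (size d))} {P : D → Prop} {code : D → ℕ × List (ℕ × ℕ × ℕ)}
    (hcode : Primrec code)
    (h : ∀ d, P d → ∃ w : Certificate, w.Valid (code d))
    (hshift : ∀ d, P d → ∀ J, ∀ G : CellularAutomaton (Fin (code d).1), ∀ C : CACode,
      C.Represents G → CoincideFrom J G.trace (GraphCode.shift (code d)) →
      ∃ G' : CellularAutomaton (Fin (size d)), C.Represents G' ∧
        CoincideFrom J G'.trace (shiftOf d)) :
    EffectivelyUltimatelyTraceable size shiftOf P := by
  classical
  have hv : Primrec fun p : D × ℕ => (Encodable.decode (α := Certificate) p.2).bind fun w =>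
      if w.Valid (code p.1) then some w else none := by
    refine Primrec.option_bind (Primrec.decode.comp Primrec.snd) ?_
    change Primrec fun _ : (D × ℕ) × Certificate => _
    refine Primrec.ite ?_ (Primrec.option_some.comp Primrec.snd) (Primrec.const none)
    exact primrecPred_valid.comp (Primrec.pair
      (hcode.comp (Primrec.fst.comp Primrec.fst)) Primrec.snd)
  -- An unbounded search through all numbers, decoded as certificates. The promise makes it halt,
  -- and any certificate it finds is valid for the graph.
  let φ : D →. Certificate := fun d => Nat.rfindOpt fun n =>
    (Encodable.decode (α := Certificate) n).bind fun w =>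
      if w.Valid (code d) then some w else none
  have hφ : Partrec φ := Partrec.rfindOpt hv.to_comp.to₂
  refine ⟨fun d => (φ d).map fun w =>
    (((w.1.1 : ℤ), 2 * w.1.1 + 1, w.1.2), w.2.1.1 + (code d).2.length + 1), ?_, fun d hd => ?_⟩
  · refine hφ.map ?_
    change Computable fun _ : D × Certificate => _
    refine Primrec.to_comp ?_
    have w : Primrec fun p : D × Certificate => p.2 := Primrec.snd
    have r := Primrec.fst.comp (Primrec.fst.comp w)
    refine Primrec.pair (Primrec.pair (primrec_intCast.comp r) (Primrec.pair
      (Primrec.succ.comp (Primrec.nat_mul.comp (Primrec.const 2) r))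
      (Primrec.snd.comp (Primrec.fst.comp w)))) (Primrec.succ.comp (Primrec.nat_add.comp
        (Primrec.fst.comp (Primrec.fst.comp (Primrec.snd.comp w))) (Primrec.list_length.comp
          (Primrec.snd.comp (hcode.comp Primrec.fst)))))
  · have hdom : (φ d).Dom := by
      obtain ⟨w, hw⟩ := h d hd
      refine Nat.rfindOpt_dom.2 ⟨Encodable.encode w, w, ?_⟩
      rw [Encodable.encodek]
      simp [hw]
    obtain ⟨w, hw⟩ := Part.dom_iff_mem.1 hdom
    obtain ⟨n, hn⟩ := Nat.rfindOpt_spec hw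
    have hval : w.Valid (code d) := by
      simp only [Option.mem_def, Option.bind_eq_some_iff] at hn
      obtain ⟨w', -, hw'⟩ := hn
      split_ifs at hw' with h'
      exact Option.some_injective _ hw' ▸ h'
    obtain ⟨G, hG, hc⟩ := hval.exists_coincideFrom
    exact ⟨_, Part.mem_map _ hw, hshift d hd _ G _ hG hc⟩

/-! ## Existence of certificates -/

/-- `g` is the global function of a cellular automaton. -/
structure IsLocal {A : Type*} (g : (ℤ → A) → ℤ → A) (r : ℕ) : Prop where
  comm : ∀ x (m i : ℤ), g (fun k => x (k + m)) i = g x (i + m)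
  congr : ∀ x y (i : ℤ), (∀ i' : ℤ, |i' - i| ≤ (r : ℤ) → x i' = y i') → g x i = g y i

/-- Up to finitely many generations, the columns of the orbits of `g` are labels of paths. -/
def Covers (c : GraphCode) (g : (ℤ → Fin c.1) → ℤ → Fin c.1) : Prop :=
  ∃ (J m ρ : ℕ) (Λ : (ℤ → Fin c.1) → Set ℕ), (∀ x, (Λ x).Nonempty) ∧
    (∀ x y, (∀ t ≤ m, ∀ i, |i| ≤ (ρ : ℤ) → g^[t] x i = g^[t] y i) → Λ x = Λ y) ∧
    ∀ x, ∀ v' ∈ Λ (g x), ∃ v ∈ Λ x, (v, (g^[J] x 0 : ℕ), v') ∈ c.2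

/-- The labels of all paths can be read in a column of rows of blocks. -/
def Realizes (c : GraphCode) (g : (ℤ → Fin c.1) → ℤ → Fin c.1) : Prop :=
  ∃ (L B δ : ℕ) (Φ : (ℤ → ℕ × ℕ × ℕ) → ℤ → Fin c.1), 0 < L ∧ δ < B ∧
    (∀ f, IsBiPath c f → ∀ i, Φ f (i + B) = Φ (fun k => f (k + L)) i) ∧
    (∀ f f', IsBiPath c f → IsBiPath c f' → (∀ k : ℕ, k < 2 * L → f k = f' k) →
      ∀ i : ℕ, i < B → Φ f i = Φ f' i) ∧
    (∀ f, IsBiPath c f → g^[L] (Φ f) = Φ fun k => f (k + L)) ∧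
    ∀ f, IsBiPath c f → ∀ φ < L, (g^[φ + 1] (Φ f) δ : ℕ) = (f (φ + L : ℕ)).2.1

theorem lookup_map_self {α β : Type*} [BEq α] [LawfulBEq α] {l : List α} {v : α → β} {a : α}
    (h : a ∈ l) : (l.map fun a => (a, v a)).lookup a = some (v a) := by
  induction l with
  | nil => simp at h
  | cons b l ih =>
    rw [List.map_cons, List.lookup_cons]
    by_cases hab : a = b
    · simp [hab]
    · rw [beq_false_of_ne hab]
      exact ih ((List.mem_cons.1 h).resolve_left hab)

theorem IsLocal.iterate_congr {A : Type*} {g : (ℤ → A) → ℤ → A} {r : ℕ} (hg : IsLocal g r)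
    {x y : ℤ → A} {t : ℕ} {i : ℤ} (h : ∀ i', |i' - i| ≤ (r * t : ℕ) → x i' = y i') :
    g^[t] x i = g^[t] y i := by
  induction t generalizing i with
  | zero => exact h i (by simp)
  | succ t ih =>
    rw [Function.iterate_succ_apply', Function.iterate_succ_apply']
    refine hg.congr _ _ _ fun i' hi' => ih fun i'' hi'' => h i'' ?_
    rw [Nat.mul_succ]
    rw [abs_le] at *
    push_cast at *
    constructor <;> linarith [hi'.1, hi'.2, hi''.1, hi''.2]

theorem IsLocal.iterate_comm {A : Type*} {g : (ℤ → A) → ℤ → A} {r : ℕ} (hg : IsLocal g r)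
    (x : ℤ → A) (m : ℤ) (t : ℕ) : g^[t] (fun k => x (k + m)) = fun i => g^[t] x (i + m) := by
  induction t with
  | zero => rfl
  | succ t ih =>
    funext i
    rw [Function.iterate_succ_apply', Function.iterate_succ_apply', ih, hg.comm]

/-- The table lists, for each word, the value of `g` at the centre of any configuration that shows
it; locality makes the choice irrelevant. -/
theorem IsLocal.exists_represents {n r : ℕ} {g : (ℤ → Fin n) → ℤ → Fin n} (hg : IsLocal g r) :
    ∃ (T : List (List ℕ × ℕ)) (G : CellularAutomaton (Fin n)),
      CACode.Represents ((r : ℤ), 2 * r + 1, T) G ∧ TableCheck n r T ∧ G.global = g := by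
  classical
  set v : List ℕ → ℕ := fun w => if h : ∃ x : ℤ → Fin n, segment (letters x) (-r) (2 * r + 1) = w
    then g h.choose 0 else 0 with hv
  set T := (words (List.range n) (2 * r + 1)).map fun w => (w, v w) with hT
  have hvx : ∀ x : ℤ → Fin n, v (segment (letters x) (-r) (2 * r + 1)) = g x 0 := fun x => by
    have h : ∃ y : ℤ → Fin n, segment (letters y) (-r) (2 * r + 1) =
      segment (letters x) (-r) (2 * r + 1) := ⟨x, rfl⟩
    simp only [hv, dif_pos h]
    rw [hg.congr _ x 0 fun i hi => ?_]
    rw [abs_le] at hi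
    exact Fin.ext (eq_of_segment_eq h.choose_spec (by linarith [hi.1])
      (by push_cast; linarith [hi.2]))
  have hlook : ∀ x : ℤ → Fin n,
      T.lookup (segment (letters x) (-r) (2 * r + 1)) = some (g x 0 : ℕ) := fun x => by
    rw [hT, lookup_map_self (segment_letters_mem_words _ _ _), hvx]
  have hcheck : TableCheck n r T := fun w hw => by
    obtain ⟨x, rfl⟩ := exists_segment_of_mem_words (by omega) hw (-r)
    exact ⟨g x 0, by simp, hlook x⟩
  obtain ⟨G, hG⟩ := hcheck.exists_represents
  refine ⟨T, G, hG, hcheck, ?_⟩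
  funext x i
  have h0 : ∀ x, G.global x 0 = g x 0 := fun x => by
    have h1 := stepList_segment hG x (-r) (2 * r + 1)
    have h2 := congrArg (fun l => l.getD 0 0) h1
    simp only [stepList, length_segment] at h2
    rw [getD_segment _ _ (by omega), show 2 * r + 1 - 2 * r = 1 by omega] at h2
    simp only [List.range_one, List.map_cons, List.map_nil, List.getD_cons_zero,
      List.drop_zero] at h2
    rw [take_segment _ _ le_rfl, hlook] at h2
    simpa using (Fin.ext h2).symm
  have h1 := h0 fun k => x (k + i)
  rw [G.global_add, hg.comm] at h1
  simpa using h1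

theorem Covers.exists_coverCheck {c : GraphCode} {g : (ℤ → Fin c.1) → ℤ → Fin c.1} {r : ℕ}
    (hg : IsLocal g r) (h : Covers c g) {T : List (List ℕ × ℕ)} {G : CellularAutomaton (Fin c.1)}
    (hG : CACode.Represents ((r : ℤ), 2 * r + 1, T) G) (hGg : G.global = g) :
    ∃ J R C, CoverCheck c r T J R C := by
  classical
  obtain ⟨J, m, ρ, Λ, hne, hloc, hedge⟩ := h
  -- Wide enough to determine the letter of generation `J` and everything `Λ` depends on, namely the
  -- radius `ρ` during `m` generations.
  set R := r * J + (ρ + r * m) with hR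
  -- Only sources of edges are kept, to get a finite list; the vertices supplied by `hedge` are such
  -- sources.
  set C := ((words (List.range c.1) (2 * R + 1)) ×ˢ (c.2.map Prod.fst)).filter fun p =>
    ∃ x : ℤ → Fin c.1, segment (letters x) (-R) (2 * R + 1) = p.1 ∧ p.2 ∈ Λ x with hC
  have hCmem : ∀ x : ℤ → Fin c.1, ∀ v ∈ Λ x, ∀ b u, (v, b, u) ∈ c.2 →
      (segment (letters x) (-R) (2 * R + 1), v) ∈ C := fun x v hv b u he => by
    rw [hC, List.mem_filter, List.mem_product]
    exact ⟨⟨segment_letters_mem_words _ _ _, List.mem_map.2 ⟨_, he, rfl⟩⟩,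
      by simpa using ⟨x, rfl, hv⟩⟩
  have hΛ : ∀ x y : ℤ → Fin c.1, segment (letters x) (-R) (2 * R + 1) =
      segment (letters y) (-R) (2 * R + 1) → Λ x = Λ y := fun x y hxy => by
    refine hloc x y fun t ht i hi => hg.iterate_congr fun i' hi' => ?_
    have : r * t ≤ r * m := Nat.mul_le_mul_left r ht
    rw [abs_le] at hi hi'
    exact Fin.ext (eq_of_segment_eq hxy (by omega) (by omega))
  refine ⟨J, R, C, by omega, fun w hw => ?_, fun w hw p hp hpw => ?_⟩
  · obtain ⟨x, rfl⟩ := exists_segment_of_mem_words (by omega) hw (-R)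
    obtain ⟨v', hv'⟩ := hne (g x)
    obtain ⟨v, hv, he⟩ := hedge x v' hv'
    exact ⟨_, hCmem x v hv _ _ he, rfl⟩
  · obtain ⟨x, rfl⟩ := exists_segment_of_mem_words (by omega) hw (-R - r)
    rw [hC, List.mem_filter] at hp
    obtain ⟨y, hy, hyp⟩ : ∃ x : ℤ → Fin c.1,
      segment (letters x) (-R) (2 * R + 1) = p.1 ∧ p.2 ∈ Λ x := by simpa using hp.2
    rw [stepList_segment hG, hGg, sub_add_cancel, Nat.add_sub_cancel] at hpw
    rw [hΛ y (g x) (hy.trans hpw)] at hyp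
    obtain ⟨v, hv, he⟩ := hedge x _ hyp
    refine ⟨_, hCmem x v hv _ _ he, ?_, ?_⟩
    · rw [drop_segment, take_segment _ _ (by omega), sub_add_cancel]
    · rw [iterate_stepList_segment hG, getD_segment _ _ (by omega), hGg]
      convert he using 6
      omega

theorem Realizes.exists_pathCheck {c : GraphCode} {g : (ℤ → Fin c.1) → ℤ → Fin c.1} {r : ℕ}
    (hg : IsLocal g r) (h : Realizes c g) {T : List (List ℕ × ℕ)} {G : CellularAutomaton (Fin c.1)}
    (hG : CACode.Represents ((r : ℤ), 2 * r + 1, T) G) (hGg : G.global = g) :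
    ∃ L B δ e, PathCheck c r T L B δ e := by
  classical
  obtain ⟨L, B, δ, Φ, hL, hδ, hadd, hloc, hiter, hlab⟩ := h
  set v : List (ℕ × ℕ × ℕ) → List ℕ := fun P =>
    if h : ∃ f, IsBiPath c f ∧ segment f 0 (2 * L) = P then
      segment (letters (Φ h.choose)) 0 B else [] with hv
  set e := (words c.2 (2 * L)).map fun P => (P, v P) with he
  have hlook : ∀ f, IsBiPath c f →
      e.lookup (segment f 0 (2 * L)) = some (segment (letters (Φ f)) 0 B) := fun f hf => by
    rw [he, lookup_map_self]
    · have h : ∃ f', IsBiPath c f' ∧ segment f' 0 (2 * L) = segment f 0 (2 * L) := ⟨f, hf, rfl⟩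
      simp only [hv, dif_pos h]
      congr 1
      refine segment_congr fun j hj => ?_
      rw [zero_add]
      refine congrArg _ (hloc _ _ h.choose_spec.1 hf (fun k hk => ?_) j hj)
      exact eq_of_segment_eq h.choose_spec.2 (by omega) (by omega)
    · refine mem_words.2 ⟨by simp, fun a ha => ?_⟩
      simp only [segment, List.mem_map] at ha
      obtain ⟨j, -, rfl⟩ := ha
      exact (hf _).1
  have haddm : ∀ f, IsBiPath c f → ∀ (m : ℕ) (i : ℤ),
      Φ f (i + m * B) = Φ (fun k => f (k + m * L)) i := fun f hf m => by
    induction m with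
    | zero => simp
    | succ m ih =>
      intro i
      rw [show i + (m + 1 : ℕ) * B = (i + B) + m * B by push_cast; ring, ih,
        hadd _ (hf.add _)]
      congr 1
      funext k
      congr 1
      push_cast
      ring
  set H := r * L + 1 with hH
  have hB : 0 < B := by omega
  refine ⟨L, B, δ, e, hL, hδ, fun P hP hch => ?_⟩
  obtain ⟨hlen, hmem⟩ := mem_words.1 hP
  set s := c.2.length with hs
  rw [← hH] at hlen ⊢
  have hget : ∀ i, i < P.length → P.getD i (0, 0, 0) ∈ P := fun i hi => by
    rw [List.getD_eq_getElem _ _ hi]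
    exact List.getElem_mem hi
  -- The check concerns all chains of edges, while `Φ` is controlled on bi-infinite paths only. This
  -- is why `PathCheck` tests words with margins and looks only at their middle part.
  obtain ⟨f, hf, hfP⟩ := exists_isBiPath_of_finite (c := c) (f := fun i => P.getD i (0, 0, 0))
    (n := (2 * H + 2) * L) (by positivity)
    (fun i hi => ⟨hmem _ (hget i (by omega)), hch.1 _ (hget i (by omega))⟩)
    (fun i hi => hch.2 i (List.mem_range.2 (by omega)))
  have hblock : ∀ i < 2 * H + 1,
      block L e (P.drop s) i = segment (letters (Φ f)) (0 + i * B) B := fun i hi => by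
    have hi2 : i * L + 2 * L ≤ (2 * H + 2) * L := by
      rw [← add_mul]; exact Nat.mul_le_mul_right L (by omega)
    have h1 : ((P.drop s).drop (i * L)).take (2 * L) =
        segment (fun k => f (k + i * L)) 0 (2 * L) := by
      refine List.ext_getElem (by simp; omega) fun j h1 h2 => ?_
      simp only [length_segment] at h2
      simp only [List.getElem_take, List.getElem_drop, getElem_segment, zero_add]
      have := hfP (i * L + j) (by omega)
      rw [List.getD_eq_getElem _ _ (by omega)] at this
      push_cast at this
      rw [add_comm (j : ℤ), this]
    rw [block, h1, hlook _ (hf.add _), Option.getD_some]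
    refine segment_congr fun j _ => ?_
    rw [letters, letters, ← haddm f hf]
    congr 2
    ring
  have hrow : (List.range (2 * H + 1)).flatMap (block L e (P.drop s)) =
      segment (letters (Φ f)) 0 ((2 * H + 1) * B) := by
    rw [segment_mul]
    exact List.flatMap_congr fun i hi => hblock i (List.mem_range.1 hi)
  have hrL : r * L ≤ H * B := (Nat.le_succ _).trans (Nat.le_mul_of_pos_right H hB)
  have hBB : (2 * H + 1) * B = 2 * (H * B) + B := by ring
  have hHB : (H + 1) * B = H * B + B := by ring
  have hH1 : 1 * B ≤ H * B := Nat.mul_le_mul_right B (by omega)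
  rw [hblock 0 (by omega), hrow]
  refine ⟨by simp, fun a ha => ?_, fun l hl => ?_, fun φ hφ => ?_⟩
  · simp only [segment, List.mem_map] at ha
    obtain ⟨j, -, rfl⟩ := ha
    exact (Φ f _).isLt
  · rw [List.mem_range] at hl
    rw [iterate_stepList_segment hG, show r * L + 2 = H + 1 by omega,
      getD_segment _ _ (by omega), getD_segment _ _ (by omega), hGg, hiter f hf,
      letters, letters, ← hadd f hf]
    congr 2
    push_cast [hrL]
    ring
  · rw [List.mem_range] at hφ
    have hrφ : r * (φ + 1) ≤ r * L := Nat.mul_le_mul_left r hφ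
    rw [iterate_stepList_segment hG, getD_segment _ _ (by omega), hGg]
    have hn : (r * L + 2) * L + φ < (2 * H + 2) * L := by
      have : (r * L + 2) * L + L ≤ (2 * H + 2) * L := by
        rw [← Nat.succ_mul]
        exact Nat.mul_le_mul_right L (by omega)
      omega
    have h1 := hfP _ hn
    rw [← add_assoc] at h1
    rw [← h1]
    have h2 := hlab _ (hf.add (H * L)) φ hφ
    rw [← funext (haddm f hf H), hg.iterate_comm] at h2
    refine (congrArg (letters (g^[φ + 1] (Φ f))) ?_).trans (h2.trans (congrArg (fun e => e.2.1)
      (congrArg f ?_)))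
    · rw [Nat.cast_sub (by omega)]
      push_cast
      ring
    · push_cast [hH]
      ring

theorem exists_certificate {c : GraphCode} {g : (ℤ → Fin c.1) → ℤ → Fin c.1} {r : ℕ}
    (hg : IsLocal g r) (h1 : Covers c g) (h2 : Realizes c g) :
    ∃ w : Certificate, w.Valid c := by
  obtain ⟨T, G, hG, hT, hGg⟩ := hg.exists_represents
  obtain ⟨J, R, C, hC⟩ := h1.exists_coverCheck hg hG hGg
  obtain ⟨L, B, δ, e, he⟩ := h2.exists_pathCheck hg hG hGg
  exact ⟨((r, T), (J, R, C), (L, B, δ, e)), hT, hC, he⟩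

/-! ## Cyclic paths -/

theorem IsPath.periodize {c : GraphCode} {f : ℕ → ℕ × ℕ × ℕ} (hf : IsPath c f) {i p : ℕ}
    (hp : 0 < p) (h : (f i).1 = (f (i + p)).1) :
    IsBiPath c fun k : ℤ => f (i + (k % p).toNat) := by
  refine fun k => ⟨(hf _).1, (hf _).2.1, (hf _).2.2.trans ?_⟩
  dsimp only
  have h1 := Int.emod_nonneg k (b := p) (by omega)
  have h2 := Int.emod_lt_of_pos k (b := p) (by omega)
  have h3 : (k + 1) % (p : ℤ) = (k % p + 1) % p := by rw [Int.emod_add_emod]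
  by_cases h4 : k % p + 1 = p
  · rw [h3, h4, Int.emod_self, show i + (k % (p : ℤ)).toNat + 1 = i + p by omega, ← h]
    simp
  · rw [h3, Int.emod_eq_of_lt (a := k % p + 1) (by omega) (by omega)]
    congr 2
    omega

theorem IsBiPath.isPath {c : GraphCode} {f : ℤ → ℕ × ℕ × ℕ} (hf : IsBiPath c f) :
    IsPath c fun i : ℕ => f i := fun i => by simpa using hf i

theorem IsBiPath.periodize {c : GraphCode} {f : ℤ → ℕ × ℕ × ℕ} (hf : IsBiPath c f) {i : ℤ} {p : ℕ}
    (hp : 0 < p) (h : (f i).1 = (f (i + p)).1) :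
    IsBiPath c fun k : ℤ => f (k % p + i) := by
  convert (hf.add i).isPath.periodize (i := 0) hp (by simpa [add_comm] using h) using 3 with k
  have := Int.emod_nonneg k (b := p) (by omega)
  omega

theorem exists_iterate_add_eq {A : Type*} [Finite A] (b : A → A) :
    ∃ J N, 0 < N ∧ b^[J + N] = b^[J] := by
  obtain ⟨i, j, hne, h⟩ := Finite.exists_ne_map_eq_of_infinite fun n : ℕ => b^[n]
  rcases lt_or_gt_of_ne hne with h' | h'
  · exact ⟨i, j - i, by omega, by rw [Nat.add_sub_cancel' h'.le]; exact h.symm⟩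
  · exact ⟨j, i - j, by omega, by rw [Nat.add_sub_cancel' h'.le]; exact h⟩

theorem iterate_add_eq_of_le {A : Type*} {b : A → A} {J J' N : ℕ} (h : b^[J + N] = b^[J])
    (hJ : J ≤ J') : b^[J' + N] = b^[J'] := by
  obtain ⟨s, rfl⟩ := Nat.exists_eq_add_of_le' hJ
  rw [add_assoc, Function.iterate_add, h, ← Function.iterate_add]

theorem iterate_add_mod {A : Type*} {b : A → A} {J N : ℕ} (h : b^[J + N] = b^[J]) (t : ℕ) :
    b^[J + t % N] = b^[J + t] := by
  have key : ∀ m s, b^[J + (s + N * m)] = b^[J + s] := by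
    intro m s
    induction m with
    | zero => rfl
    | succ m ih =>
      rw [show J + (s + N * (m + 1)) = J + (s + N * m) + N by ring,
        iterate_add_eq_of_le h (by omega), ih]
  conv_rhs => rw [← Nat.mod_add_div t N]
  rw [key]

/-- The orbits of `b` are eventually periodic, hence labels of closed paths. `Ω a` collects the
starting vertices of the bi-infinite paths labelled by the periodic part of the orbit of `a`, and
one step back along such a path gives the predecessor. -/
theorem exists_background {c : GraphCode} {b : Fin c.1 → Fin c.1}
    (h : ∀ a, (fun t => b^[t + 1] a) ∈ c.shift) :
    ∃ J₁, ∀ J, J₁ ≤ J → ∃ Ω : Fin c.1 → Set ℕ, (∀ a, (Ω a).Nonempty) ∧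
      ∀ a, ∀ v' ∈ Ω (b a), ∃ v ∈ Ω a, (v, (b^[J] a : ℕ), v') ∈ c.2 := by
  obtain ⟨J₀, N, hN, hJN⟩ := exists_iterate_add_eq b
  refine ⟨J₀ + 1, fun J hJ => ?_⟩
  have hJN' := iterate_add_eq_of_le hJN (show J₀ ≤ J by omega)
  refine ⟨fun a => {v | ∃ f, IsBiPath c f ∧ (f 0).1 = v ∧
    ∀ i : ℤ, (f i).2.1 = b^[J + (i % N).toNat] a}, fun a => ?_, ?_⟩
  · obtain ⟨p, hp, hpa⟩ := exists_isPath_of_mem_shift (h a)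
    -- Sampling at multiples of `N` makes the length of the cycle a multiple of the period of the
    -- labels. The offset is `J - 1` because the label at `t` is `b^[t + 1] a`.
    obtain ⟨i, j, hij, -, hpij⟩ := exists_repeat (E := c.2) (fun k => p (k * N + (J - 1)))
      fun i _ => (hp _).1
    obtain ⟨s, rfl⟩ := Nat.exists_eq_add_of_lt hij
    refine ⟨_, _, hp.periodize (i := i * N + (J - 1)) (p := (s + 1) * N) (by positivity) ?_, rfl,
      fun k => ?_⟩
    · rw [hpij]
      congr 2
      ring
    · rw [hpa]
      have e : i * N + (J - 1) + (k % ((s + 1) * N : ℕ)).toNat + 1 =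
        J + ((k % ((s + 1) * N : ℕ)).toNat + i * N) := by omega
      rw [e, ← iterate_add_mod hJN', Nat.add_mul_mod_self_right]
      congr 4
      have h1 := Int.emod_nonneg k (b := ((s + 1) * N : ℕ)) (by positivity)
      zify [h1]
      rw [Int.toNat_of_nonneg (by exact_mod_cast h1),
        Int.toNat_of_nonneg (Int.emod_nonneg _ (by omega)), Int.emod_emod_of_dvd]
      exact ⟨s + 1, by ring⟩
  · rintro a v' ⟨f, hf, rfl, hfa⟩
    refine ⟨_, ⟨_, hf.add (-1), rfl, fun i => ?_⟩, ?_⟩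
    · rw [hfa, ← Function.iterate_succ_apply]
      have h1 := Int.emod_nonneg (i + -1) (b := N) (by omega)
      have h2 := Int.emod_lt_of_pos (i + -1) (b := N) (by omega)
      have e : (i % N).toNat = (((i + -1) % N).toNat + 1) % N := by
        zify
        rw [Int.toNat_of_nonneg h1, Int.toNat_of_nonneg (Int.emod_nonneg _ (by omega)),
          Int.emod_add_emod]
        congr 1
        ring
      rw [e, iterate_add_mod hJN']
      rfl
    · have h1 := hf (-1)
      have h2 := hfa (-1)
      have e : ((-1 : ℤ) % N).toNat + 1 = N := by
        have h1 := Int.emod_nonneg (-1) (b := N) (by omega)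
        have : (-1 : ℤ) % N = N - 1 := by
          rw [← Int.add_emod_right, Int.emod_eq_of_lt] <;> omega
        omega
      rw [← Function.iterate_succ_apply, Nat.succ_eq_add_one, add_assoc, e, hJN'] at h2
      have h3 := h1.1
      have e3 : f (-1) = ((f (-1)).1, (b^[J] a : ℕ), (f 0).1) := by
        rw [← h2]
        have := h1.2.2
        rw [neg_add_cancel] at this
        rw [← this]
      rw [e3] at h3
      exact h3

/-! ## Systems of data carried by blocks -/

/-- A one-sided cellular automaton on a set of states in `ι → Fin c.1`, that simulates the paths
of the graph, and all of whose columns are labels of paths. -/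
structure DataSystem (c : GraphCode) (ι : Type*) where
  states : Set (ι → Fin c.1)
  next : (ι → Fin c.1) → (ι → Fin c.1) → ι → Fin c.1
  next_mem : ∀ q ∈ states, ∀ r, next q r ∈ states
  /-- the number of edges of a path that a block carries -/
  len : ℕ
  len_pos : 0 < len
  /-- the orbit of a block in the row of blocks that represents a path -/
  enc : (ℤ → ℕ × ℕ × ℕ) → ℕ → ι → Fin c.1
  display : ι
  enc_mem : ∀ f, IsBiPath c f → ∀ t, enc f t ∈ states
  enc_succ : ∀ f, IsBiPath c f → ∀ t,
    enc f (t + 1) = next (enc f t) (enc (fun k => f (k + len)) t)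
  enc_len : ∀ f, IsBiPath c f → enc f len = enc (fun k => f (k + len)) 0
  enc_congr : ∀ f f', IsBiPath c f → IsBiPath c f' → (∀ k : ℕ, k < 2 * len → f k = f' k) →
    enc f 0 = enc f' 0
  enc_display : ∀ f, IsBiPath c f → ∀ φ < len,
    (enc f (φ + 1) display : ℕ) = (f (φ + len : ℕ)).2.1
  -- The label read in a column may lag behind the states that determine its vertices, so that
  -- sources may depend on letters already passed.
  delay : ℕ
  memory : ℕ
  /-- the possible sources of the edges read in a column, from the orbit of the block -/
  sources : ι → (ℕ → ι → Fin c.1) → Set ℕ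
  sources_nonempty : ∀ k q, (∀ t, q t ∈ states ∧ ∃ r, q (t + 1) = next (q t) r) →
    (sources k q).Nonempty
  sources_congr : ∀ k q q', (∀ t ≤ memory, q t = q' t) → sources k q = sources k q'
  exists_edge : ∀ k q, (∀ t, q t ∈ states ∧ ∃ r, q (t + 1) = next (q t) r) →
    ∀ v' ∈ sources k fun t => q (t + 1), ∃ v ∈ sources k q, (v, (q delay k : ℕ), v') ∈ c.2

/-! ### From a data system to the covering and the realization of paths -/

namespace BlockSystem

variable {A ι : Type*} {S : BlockSystem A ι}

theorem isLocal_step (S : BlockSystem A ι) : IsLocal S.step (2 * S.width) where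
  comm := step_add
  congr x y i h := step_congr fun i' h1 h2 => h i' (by
    rw [_root_.abs_le]; push_cast; omega)

theorem row_add_width (hw : 0 < S.width) (a : A) (q : ℤ → ι → A) (i : ℤ) :
    S.row a q (i + S.width) = S.row a (fun i => q (i + 1)) i := by
  have e : (i + S.width) / (S.width : ℤ) = i / S.width + 1 := by
    rw [Int.add_ediv_of_dvd_right (dvd_refl _), Int.ediv_self (by omega)]
  have e' : (i + S.width) % (S.width : ℤ) = i % S.width := Int.add_emod_right _ _
  by_cases h : ∃ k, i % S.width = S.pos k
  · have h' : ∃ k, (i + S.width) % S.width = S.pos k := by rwa [e']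
    rw [row, row, dif_pos h, dif_pos h', e]
    congr 1
    refine S.pos_injective ?_
    have := h.choose_spec
    have := h'.choose_spec
    omega
  · rw [row, row, dif_neg h, dif_neg (by rwa [e']), e']

theorem row_congr {a : A} {q q' : ℤ → ι → A} (h : q 0 = q' 0) {i : ℕ} (hi : i < S.width) :
    S.row a q i = S.row a q' i := by
  simp only [row]
  rw [Int.ediv_eq_zero_of_lt (by omega) (by omega), h]

variable {c : GraphCode} {ι : Type*} {S : BlockSystem (Fin c.1) ι}

/-- In `D.len` steps the row that encodes a path moves by one block: the data by `enc_len`, and the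
padding because the background letter has come back to `a`. -/
theorem realizes (D : DataSystem c ι) (hstates : S.states = D.states) (hnext : S.next = D.next)
    (hs : S.Stackable) {a : Fin c.1} (ha : a ∈ S.palette) (hper : S.bg^[D.len] a = a) :
    Realizes c S.step := by
  have hw : 0 < S.width := (Nat.zero_le _).trans_lt (S.pos_lt D.display)
  have hadd : ∀ (f : ℤ → ℕ × ℕ × ℕ) (i : ℤ), (fun k => f (k + (i + 1) * D.len)) =
      fun k => f (k + D.len + i * D.len) := fun f i => by
    funext k
    congr 1
    ring
  have hiter : ∀ f, IsBiPath c f → ∀ t,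
      S.step^[t] (S.row a fun i => D.enc (fun k => f (k + i * D.len)) 0) =
      S.row (S.bg^[t] a) fun i => D.enc (fun k => f (k + i * D.len)) t := fun f hf =>
    hs.iterate_step_row hw ha (q := fun t i => D.enc (fun k => f (k + i * D.len)) t)
      (fun t i => by rw [hstates]; exact D.enc_mem _ (hf.add _) t)
      (fun t i => by
        rw [hnext, hadd]
        exact D.enc_succ _ (hf.add _) t)
  refine ⟨D.len, S.width, S.pos D.display,
    fun f => S.row a fun i => D.enc (fun k => f (k + i * D.len)) 0, D.len_pos, S.pos_lt _,
    fun f hf i => ?_, fun f f' hf hf' h i hi => ?_, fun f hf => ?_, fun f hf φ hφ => ?_⟩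
  · dsimp only
    rw [row_add_width hw]
    congr 1
    funext i
    rw [hadd]
    congr 1
    funext k
    congr 1
    ring
  · refine row_congr ?_ hi
    simpa using D.enc_congr f f' hf hf' h
  · simp only
    rw [hiter f hf, hper]
    congr 1
    funext i
    rw [D.enc_len _ (hf.add _)]
    congr 1
    funext k
    congr 1
    ring
  · simp only
    rw [hiter f hf]
    have := S.row_data (S.bg^[φ + 1] a) (fun i => D.enc (fun k => f (k + i * D.len)) (φ + 1)) 0
      D.display
    simp only [zero_mul, zero_add, add_zero] at this
    rw [this]
    exact D.enc_display f hf φ hφ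

/-- Once blocks have settled, the cell `0` is permanently a data cell, covered by `D.sources`, or
permanently background, covered by `Ω`; this alternative is local and invariant under the step. -/
theorem covers (D : DataSystem c ι) (hstates : S.states = D.states) (hnext : S.next = D.next)
    {J₀ : ℕ} (hs : S.SettledFrom J₀) (hbg : ∀ a, (fun t => S.bg^[t + 1] a) ∈ c.shift) :
    Covers c S.step := by
  obtain ⟨J₁, hJ₁⟩ := exists_background hbg
  -- The delay is imposed on the background too, so that both kinds of cells produce their labels at
  -- the same generation.
  obtain ⟨Ω, hΩ, hΩ'⟩ := hJ₁ (J₁ + D.delay) (by omega)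
  have hadm : ∀ x j, S.Active (S.step^[J₀] x) j → ∀ t,
      S.read (S.step^[J₀ + J₁ + t] x) j ∈ D.states ∧
      ∃ r, S.read (S.step^[J₀ + J₁ + (t + 1)] x) j =
        D.next (S.read (S.step^[J₀ + J₁ + t] x) j) r := fun x j h t => by
    have h' := (hs.active x (show J₀ ≤ J₀ + J₁ + t by omega) j).2 h
    refine ⟨hstates ▸ h'.1.2, S.read (S.step^[J₀ + J₁ + t] x) (j + S.width), ?_⟩
    rw [← add_assoc, Function.iterate_succ_apply', h'.read_step, hnext]
  have hpad : ∀ x, (∀ j k, (0 : ℤ) = j + S.pos k → ¬ S.Active (S.step^[J₀] x) j) → ∀ t,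
      S.step^[J₀ + t] x 0 = S.bg^[t] (S.step^[J₀] x 0) := fun x h t => by
    induction t with
    | zero => rfl
    | succ t ih =>
      rw [← add_assoc, Function.iterate_succ_apply', step_bg fun j k e h' =>
        h j k e ((hs.active x (by omega) j).1 h'), ih, Function.iterate_succ_apply']
  refine ⟨J₀ + J₁ + D.delay, J₀ + J₁ + D.memory, 2 * S.width, fun x =>
    {v | (∃ j k, (0 : ℤ) = j + S.pos k ∧ S.Active (S.step^[J₀] x) j ∧
        v ∈ D.sources k fun t => S.read (S.step^[J₀ + J₁ + t] x) j) ∨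
      ((∀ j k, (0 : ℤ) = j + S.pos k → ¬ S.Active (S.step^[J₀] x) j) ∧
        v ∈ Ω (S.step^[J₀] x 0))}, fun x => ?_, fun x y hxy => ?_, fun x v' hv' => ?_⟩
  · by_cases h : ∃ j k, (0 : ℤ) = j + S.pos k ∧ S.Active (S.step^[J₀] x) j
    · obtain ⟨j, k, e, h⟩ := h
      obtain ⟨v, hv⟩ := D.sources_nonempty k _ (hadm x j h)
      exact ⟨v, Or.inl ⟨j, k, e, h, hv⟩⟩
    · push Not at h
      obtain ⟨v, hv⟩ := hΩ (S.step^[J₀] x 0)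
      exact ⟨v, Or.inr ⟨h, hv⟩⟩
  · have hact : ∀ x y : ℤ → Fin c.1, (∀ t ≤ J₀ + J₁ + D.memory, ∀ i : ℤ,
        |i| ≤ (2 * S.width : ℕ) → S.step^[t] x i = S.step^[t] y i) → ∀ j k,
        (0 : ℤ) = j + S.pos k → S.Active (S.step^[J₀] x) j → S.Active (S.step^[J₀] y) j :=
      fun x y h j k e hx => hx.congr fun i h1 h2 => h _ (by omega) i (by
        have := S.pos_lt k
        rw [_root_.abs_le]
        omega)
    have key : ∀ x y : ℤ → Fin c.1, (∀ t ≤ J₀ + J₁ + D.memory, ∀ i : ℤ,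
        |i| ≤ (2 * S.width : ℕ) → S.step^[t] x i = S.step^[t] y i) → ∀ v,
        ((∃ j k, (0 : ℤ) = j + S.pos k ∧ S.Active (S.step^[J₀] x) j ∧
          v ∈ D.sources k fun t => S.read (S.step^[J₀ + J₁ + t] x) j) ∨
        ((∀ j k, (0 : ℤ) = j + S.pos k → ¬ S.Active (S.step^[J₀] x) j) ∧
          v ∈ Ω (S.step^[J₀] x 0))) →
        ((∃ j k, (0 : ℤ) = j + S.pos k ∧ S.Active (S.step^[J₀] y) j ∧
          v ∈ D.sources k fun t => S.read (S.step^[J₀ + J₁ + t] y) j) ∨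
        ((∀ j k, (0 : ℤ) = j + S.pos k → ¬ S.Active (S.step^[J₀] y) j) ∧
          v ∈ Ω (S.step^[J₀] y 0))) := by
      rintro x y h v (⟨j, k, e, hx, hv⟩ | ⟨hx, hv⟩)
      · refine Or.inl ⟨j, k, e, hact x y h j k e hx, ?_⟩
        rwa [D.sources_congr k _ _ fun t ht => ?_] at hv
        refine read_congr fun i h1 h2 => h _ (by omega) i ?_
        have := S.pos_lt k
        rw [_root_.abs_le]
        omega
      · refine Or.inr ⟨fun j k e hy => hx j k e (hact y x (fun t ht i hi => (h t ht i hi).symm)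
          j k e hy), ?_⟩
        rwa [← h J₀ (by omega) 0 (by simp)]
    ext v
    exact ⟨key x y hxy v, key y x (fun t ht i hi => (hxy t ht i hi).symm) v⟩
  · have hsucc : ∀ j, S.Active (S.step^[J₀] (S.step x)) j ↔ S.Active (S.step^[J₀] x) j :=
      fun j => by rw [← Function.iterate_succ_apply, hs.active_succ x le_rfl]
    rcases hv' with ⟨j, k, e, hx, hv'⟩ | ⟨hx, hv'⟩
    · rw [hsucc] at hx
      simp only [← Function.iterate_succ_apply] at hv'
      obtain ⟨v, hv, hE⟩ := D.exists_edge k (fun t => S.read (S.step^[J₀ + J₁ + t] x) j)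
        (hadm x j hx) v' hv'
      refine ⟨v, Or.inl ⟨j, k, e, hx, hv⟩, ?_⟩
      simp only [read, ← e] at hE
      exact hE
    · simp only [hsucc] at hx
      rw [← Function.iterate_succ_apply, Nat.succ_eq_add_one, hpad x hx 1] at hv'
      obtain ⟨v, hv, hE⟩ := hΩ' _ v' hv'
      refine ⟨v, Or.inr ⟨hx, hv⟩, ?_⟩
      rw [← hpad x hx, ← add_assoc] at hE
      exact hE

end BlockSystem

/-! ## Certificates from systems of data -/

/-- The constant automaton suits; it is covered by all sources of edges of bi-infinite paths. -/
theorem exists_certificate_of_labels_eq {c : GraphCode} {a : Fin c.1} {f : ℤ → ℕ × ℕ × ℕ}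
    (hf : IsBiPath c f) (h : ∀ f, IsBiPath c f → (f 0).2.1 = a) :
    ∃ w : Certificate, w.Valid c := by
  have hlab : ∀ f, IsBiPath c f → ∀ i, (f i).2.1 = a := fun f hf i => by
    simpa using h _ (hf.add i)
  refine exists_certificate (g := fun _ _ => a) (r := 0) ⟨fun _ _ _ => rfl, fun _ _ _ _ => rfl⟩
    ⟨1, 0, 0, fun _ => {v | ∃ f, IsBiPath c f ∧ (f 0).1 = v}, fun _ => ⟨_, f, hf, rfl⟩,
      fun _ _ _ => rfl, ?_⟩
    ⟨1, 1, 0, fun _ _ => a, one_pos, one_pos, fun _ _ _ => rfl, fun _ _ _ _ _ _ _ => rfl,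
      fun _ _ => rfl, fun f hf φ _ => ?_⟩
  · rintro x _ ⟨f, hf, rfl⟩
    refine ⟨(f (-1)).1, ⟨_, hf.add (-1), rfl⟩, ?_⟩
    have h1 := hf (-1)
    have h2 : f (-1) = ((f (-1)).1, (a : ℕ), (f 0).1) := by
      rw [← hlab f hf (-1), show (0 : ℤ) = -1 + 1 by norm_num, ← h1.2.2]
    rw [h2] at h1
    exact h1.1
  · rw [hlab f hf, Function.iterate_succ_apply']

theorem exists_certificate_of_dataSystem {c : GraphCode} (hdet : ContainsDeterministic c.shift)
    (hdata : ∀ (a : Fin c.1) (N : ℕ), 0 < N → (∃ f, IsBiPath c f ∧ (f 0).2.1 ≠ a) →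
      ∃ (ι : Type) (_ : Finite ι) (D : DataSystem c ι), N ∣ D.len ∧
        ∀ q ∈ D.states, ∃ k₁ k₂, k₁ ≠ k₂ ∧ q k₁ ≠ a ∧ q k₂ ≠ a) :
    ∃ w : Certificate, w.Valid c := by
  classical
  obtain ⟨A', ξ, ⟨a₀, ha₀⟩, hξ⟩ := hdet
  -- A fixed letter gives a constant background, which needs letters other than `a` to locate
  -- blocks; if no bi-infinite path shows any, a constant automaton is enough. Without fixed
  -- letters, the background moves and serves as a marker.
  by_cases hfix : ∃ a : A', ξ a = a
  · obtain ⟨a, ha⟩ := hfix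
    have hsh : (fun _ => (a : Fin c.1)) ∈ c.shift :=
      hξ ⟨a, funext fun j => by rw [Function.iterate_fixed ha]⟩
    by_cases h : ∃ f, IsBiPath c f ∧ (f 0).2.1 ≠ (a : Fin c.1)
    · obtain ⟨ι, _, D, -, hD⟩ := hdata a 1 one_pos h
      obtain ⟨d, ⟨e⟩⟩ := Finite.exists_equiv_fin ι
      have hb : (BlockSystem.onConstant (a : Fin c.1) e.toEmbedding D.states D.next
        D.next_mem).bg (a : Fin c.1) = a := rfl
      refine exists_certificate (BlockSystem.isLocal_step _)
        (BlockSystem.covers D (S := BlockSystem.onConstant (a : Fin c.1) e.toEmbedding _ _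
          D.next_mem) rfl rfl (BlockSystem.settledFrom_onConstant hD) fun b => ?_)
        (BlockSystem.realizes D rfl rfl (BlockSystem.stackable_onConstant hD)
          (a := (a : Fin c.1)) rfl (Function.iterate_fixed hb _))
      convert hsh using 2 with t
      rw [Function.iterate_succ_apply']
      rfl
    · push Not at h
      obtain ⟨f, hf, -⟩ := exists_isPath_of_mem_shift hsh
      obtain ⟨g, hg, -⟩ := hf.exists_isBiPath
      exact exists_certificate_of_labels_eq hg h
  · push Not at hfix
    -- After one step all letters lie in `A'`, where `b` is `ξ`; hence the orbits of `b` are in the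
    -- subshift from generation 1 on.
    set b : Fin c.1 → Fin c.1 := fun x => if h : x ∈ A' then ξ ⟨x, h⟩ else a₀ with hb
    have hbA : ∀ x, b x ∈ A' := fun x => by
      simp only [hb]
      split_ifs
      exacts [(ξ _).2, ha₀]
    have hbξ : ∀ x : A', b x = ξ x := fun x => by simp [hb]
    have hbt : ∀ (x : A') t, b^[t] x = (ξ^[t] x : A') := fun x t => by
      induction t with
      | zero => rfl
      | succ t ih => rw [Function.iterate_succ_apply', ih, hbξ, Function.iterate_succ_apply']
    have hbne : ∀ x ∈ A', b x ≠ x := fun x hx h => hfix ⟨x, hx⟩ (Subtype.ext (by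
      rw [← hbξ]; exact h))
    have hbs : ∀ x, (fun t => b^[t + 1] x) ∈ c.shift := fun x => by
      refine hξ ⟨⟨b x, hbA x⟩, funext fun t => ?_⟩
      rw [Function.iterate_succ_apply]
      exact hbt ⟨b x, hbA x⟩ t
    obtain ⟨J, N, hN, hJN⟩ := exists_iterate_add_eq b
    -- A letter on a cycle of `b`, so that the background of the row returns after `D.len` steps, a
    -- multiple of `N`.
    set a := b^[J + 1] a₀ with ha
    have haA : a ∈ A' := by rw [ha, Function.iterate_succ_apply']; exact hbA _
    have haN : b^[N] a = a := by
      rw [ha, ← Function.iterate_add_apply, add_comm, iterate_add_eq_of_le hJN (by omega)]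
    have hne : ∃ f, IsBiPath c f ∧ (f 0).2.1 ≠ a := by
      have := Set.mem_image_of_mem (shift c.2.length) (hbs a)
      rw [image_shift_eq le_rfl] at this
      obtain ⟨f, hf, hfa⟩ := this
      simp only [shift_apply] at hfa
      by_contra hcon
      push Not at hcon
      refine hbne a haA ?_
      have h0 := hfa 0
      have h1 := hfa 1
      rw [Nat.cast_zero, hcon f hf, ← Fin.ext_iff] at h0
      have h2 := hcon _ (hf.add 1)
      rw [zero_add] at h2
      rw [Nat.cast_one, h2, ← Fin.ext_iff, add_right_comm, Function.iterate_succ_apply'] at h1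
      rw [add_zero] at h0
      rw [← h0] at h1
      exact h1.symm
    obtain ⟨ι, _, D, ⟨m, hm⟩, -⟩ := hdata a N hN hne
    obtain ⟨d, ⟨e⟩⟩ := Finite.exists_equiv_fin ι
    refine exists_certificate (BlockSystem.isLocal_step _)
      (BlockSystem.covers D (S := BlockSystem.onMoving b A' (fun x _ => hbA x) e _ _
        D.next_mem) rfl rfl (BlockSystem.settledFrom_onMoving hbne hN hJN) hbs)
      (BlockSystem.realizes D rfl rfl (BlockSystem.stackable_onMoving hbne) (a := a) haA ?_)
    change b^[D.len] a = a
    rw [hm, Function.iterate_mul, Function.iterate_fixed haN]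

/-! ## Systems of data for the subshifts of finite type -/

/-- The labels of a bi-infinite path, as letters. -/
def label {c : GraphCode} (a : Fin c.1) (f : ℤ → ℕ × ℕ × ℕ) (i : ℤ) : Fin c.1 :=
  if h : (f i).2.1 < c.1 then ⟨(f i).2.1, h⟩ else a

theorem label_congr {c : GraphCode} {a : Fin c.1} {f f' : ℤ → ℕ × ℕ × ℕ} {i i' : ℤ}
    (h : f i = f' i') : label a f i = label a f' i' := by
  simp only [label, h]

theorem IsBiPath.label_eq {c : GraphCode} {f : ℤ → ℕ × ℕ × ℕ} (hf : IsBiPath c f) (a : Fin c.1)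
    (i : ℤ) : (label a f i : ℕ) = (f i).2.1 := by
  rw [label, dif_pos (hf i).2.1]

/-- The path is determined by its labels: the next edge exists if and only if the `K + 1` next
letters satisfy `P`, and its source is given by `V`. -/
structure IsWindowGraph (c : GraphCode) (K : ℕ) (P : (ℕ → Fin c.1) → Prop)
    (V : (ℕ → Fin c.1) → ℕ) : Prop where
  pred_congr : ∀ z z', (∀ i ≤ K, z i = z' i) → P z → P z'
  vertex_congr : ∀ z z', (∀ i ≤ K, z i = z' i) → V z = V z'
  edge_mem : ∀ z, P z → (V z, (z 0 : ℕ), V fun t => z (t + 1)) ∈ c.2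
  of_isBiPath : ∀ f, IsBiPath c f → ∀ z : ℕ → Fin c.1, ∀ i : ℤ,
    (∀ t : ℕ, (f (i + t)).2.1 = z t) → P z ∧ (f i).1 = V z

/-- Append a letter to a word and erase the first one. -/
def push {A : Type*} {d : ℕ} (w : Fin d → A) (y : A) : Fin d → A :=
  fun k => if h : k + 1 < d then w ⟨k + 1, h⟩ else y

section Windows

variable {A : Type*} {P : (ℕ → A) → Prop} {d : ℕ}

/-- The words of length `d` of the sequences whose tails satisfy `P`. -/
def windows (P : (ℕ → A) → Prop) (d : ℕ) : Set (Fin d → A) :=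
  {w | ∃ z : ℕ → A, (∀ i, P fun t => z (i + t)) ∧ ∀ k : Fin d, w k = z k}

theorem exists_push_mem_windows {w : Fin d → A} (hw : w ∈ windows P d) :
    ∃ y, push w y ∈ windows P d := by
  obtain ⟨z, hz, hwz⟩ := hw
  refine ⟨z d, fun i => z (i + 1), fun i => ?_, fun k => ?_⟩
  · have := hz (i + 1)
    simpa only [add_right_comm] using this
  · rw [push]
    split_ifs with h
    · exact hwz _
    · congr 1
      omega

open Classical in
/-- Append the letter `y` to the window, or any other possible letter. -/
noncomputable def nextWindow (P : (ℕ → A) → Prop) (w : Fin d → A) (y : A) : Fin d → A :=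
  if push w y ∈ windows P d then push w y
  else if h : ∃ y, push w y ∈ windows P d then push w h.choose else w

theorem nextWindow_of_mem {w : Fin d → A} {y : A} (h : push w y ∈ windows P d) :
    nextWindow P w y = push w y := if_pos h

theorem nextWindow_mem {w : Fin d → A} (hw : w ∈ windows P d) (y : A) :
    nextWindow P w y ∈ windows P d := by
  rw [nextWindow]
  split_ifs with h1 h2
  · exact h1
  · exact h2.choose_spec
  · exact hw

/-- A window can always be prolonged, so the letters move by one cell whether or not the proposed
letter is accepted. -/
theorem nextWindow_apply {w : Fin d → A} (hw : w ∈ windows P d) (y : A) {k : ℕ} (h : k + 1 < d) :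
    nextWindow P w y ⟨k, by omega⟩ = w ⟨k + 1, h⟩ := by
  rw [nextWindow, dif_pos (exists_push_mem_windows hw)]
  split_ifs <;> simp only [push, dif_pos h]

end Windows

section WindowGraph

variable {c : GraphCode} {K : ℕ} {P : (ℕ → Fin c.1) → Prop} {V : (ℕ → Fin c.1) → ℕ}

/-- The data consist of a window of a path and of a window of the periodic sequence `γ`. -/
noncomputable def IsWindowGraph.dataSystem (h : IsWindowGraph c K P V) (a : Fin c.1)
    {γ : ℤ → Fin c.1} {d m : ℕ} (hγ : ∀ i : ℤ, P fun t => γ (i + t)) (hm : 0 < m)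
    (hper : Function.Periodic γ (m : ℤ)) (hmd : m ∣ d) (hKd : 2 * K + 1 ≤ d) :
    DataSystem c (Fin d ⊕ Fin m) where
  states := {q | (fun k => q (Sum.inl k)) ∈ windows P d ∧
    ∃ s : ℤ, ∀ k : Fin m, q (Sum.inr k) = γ (s + k)}
  next q r := Sum.elim (nextWindow P (fun k => q (Sum.inl k)) (r (Sum.inl ⟨0, by omega⟩)))
    fun k => q (Sum.inr ⟨(k + 1) % m, Nat.mod_lt _ hm⟩)
  next_mem := by
    rintro q ⟨h1, s, h2⟩ r
    refine ⟨nextWindow_mem h1 _, s + 1, fun k => ?_⟩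
    simp only [Sum.elim_inr, h2]
    have := hper.int_mul (((k : ℕ) + 1) / m) (s + ((k + 1) % m : ℕ))
    rw [← this]
    congr 1
    have := Nat.mod_add_div (k + 1) m
    zify at this
    push_cast
    linarith
  len := d
  len_pos := by omega
  enc f t := Sum.elim (fun k => label a f (t + k)) fun k => γ (t + k)
  display := Sum.inl ⟨d - 1, by omega⟩
  enc_mem f hf t := ⟨⟨fun i => label a f (t + i), fun i => (h.of_isBiPath f hf _ (t + i)
    fun s => by rw [hf.label_eq]; congr 3; push_cast; ring).1, fun k => rfl⟩, t, fun k => rfl⟩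
  enc_succ f hf t := by
    have hpush : push (fun k : Fin d => label a f (t + (k : ℕ)))
        (label a (fun k => f (k + d)) (t + (0 : ℕ))) =
        fun k : Fin d => label a f ((t + 1 : ℕ) + (k : ℕ)) := by
      funext k
      rw [push]
      split_ifs with hk
      · congr 1
        push_cast
        ring
      · have : (k : ℕ) + 1 = d := by omega
        simp only [label]
        rw [show ((t + 1 : ℕ) : ℤ) + (k : ℕ) = t + (0 : ℕ) + d by omega]
    have hmem : (fun k : Fin d => label a f ((t + 1 : ℕ) + (k : ℕ))) ∈ windows P d :=
      ⟨fun i => label a f ((t + 1 : ℕ) + i), fun i => (h.of_isBiPath f hf _ ((t + 1 : ℕ) + i)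
        fun s => by rw [hf.label_eq]; congr 3; push_cast; ring).1, fun k => rfl⟩
    funext k
    rcases k with k | k
    · simp only [Sum.elim_inl]
      rw [nextWindow_of_mem (by rw [hpush]; exact hmem), hpush]
    · simp only [Sum.elim_inr]
      have := hper.int_mul (((k : ℕ) + 1) / m) (t + ((k + 1) % m : ℕ))
      rw [← this]
      congr 1
      have := Nat.mod_add_div (k + 1) m
      zify at this
      push_cast
      linarith
  enc_len f hf := by
    funext k
    rcases k with k | k
    · refine label_congr (congrArg f ?_)
      push_cast
      ring
    · obtain ⟨s, rfl⟩ := hmd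
      simp only [Sum.elim_inr]
      have := hper.int_mul s ((0 : ℕ) + (k : ℕ))
      rw [← this]
      congr 1
      push_cast
      ring
  enc_congr f f' hf hf' hff := by
    funext k
    rcases k with k | k
    · refine label_congr ?_
      rw [Nat.cast_zero, zero_add]
      exact hff k (by omega)
    · rfl
  enc_display f hf φ hφ := by
    simp only [Sum.elim_inl]
    rw [hf.label_eq]
    congr 3
    omega
  delay := 0
  memory := K
  sources k q := {V fun t => q t k}
  sources_nonempty k q _ := Set.singleton_nonempty _
  sources_congr k q q' hq := by
    rw [h.vertex_congr _ _ fun t ht => congrFun (hq t ht) k]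
  exists_edge k q hq := by
    rintro v' rfl
    refine ⟨_, rfl, ?_⟩
    refine h.edge_mem (fun t => q t k) ?_
    rcases k with k | k
    · have key : ∀ s t j (hj : j + s < d), q (t + s) (Sum.inl ⟨j, by omega⟩) =
          q t (Sum.inl ⟨j + s, hj⟩) := by
        intro s
        induction s with
        | zero => intros; rfl
        | succ s ih =>
          intro t j hj
          obtain ⟨hs, r, hr⟩ := hq (t + s)
          rw [← add_assoc, hr, Sum.elim_inl, nextWindow_apply hs.1 _ (by omega),
            ih t (j + 1) (by omega)]
          congr 3
          omega
      -- The `K + 1` successive letters of a column stand together in one window: to its right in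
      -- the first state, or, near the right end, to its left `K` steps later. The bound `2 * K + 1
      -- ≤ d` guarantees one of the two.
      by_cases hk : (k : ℕ) + K < d
      · obtain ⟨z, hz, hqz⟩ := (hq 0).1.1
        refine h.pred_congr _ _ (fun t ht => ?_) (hz k)
        have := key t 0 k (by omega)
        rw [zero_add] at this
        exact (hqz ⟨k + t, by omega⟩).symm.trans this.symm
      · obtain ⟨z, hz, hqz⟩ := (hq K).1.1
        refine h.pred_congr _ _ (fun t ht => ?_) (hz (k - K))
        have := key (K - t) t (k - K + t) (by omega)
        rw [Nat.add_sub_cancel' ht] at this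
        refine (hqz ⟨k - K + t, by omega⟩).symm.trans (this.trans ?_)
        congr 3
        omega
    -- The periodic part turns on itself independently of the neighbours, so its columns read `γ`.
    · obtain ⟨s, hs⟩ := (hq 0).1.2
      have key : ∀ t, ∀ k : Fin m, q t (Sum.inr k) = γ (s + t + k) := by
        intro t
        induction t with
        | zero => simpa using hs
        | succ t ih =>
          intro k
          obtain ⟨-, r, hr⟩ := hq t
          rw [hr, Sum.elim_inr, ih]
          have := hper.int_mul (((k : ℕ) + 1) / m) (s + t + ((k + 1) % m : ℕ))
          rw [← this]
          congr 1
          have := Nat.mod_add_div (k + 1) m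
          zify at this
          push_cast
          linarith
      refine h.pred_congr _ _ (fun t _ => ?_) (hγ (s + k))
      rw [key]
      congr 1
      ring

/-- The path contains a cycle before the time `0` and another one after it. If both have only the
label `a`, they pass through the same vertex, because labels determine vertices; the path between
them closes up and contains the edge at `0`. -/
theorem IsWindowGraph.exists_periodic (h : IsWindowGraph c K P V) {a : Fin c.1}
    {f : ℤ → ℕ × ℕ × ℕ} (hf : IsBiPath c f) (hfa : (f 0).2.1 ≠ a) :
    ∃ (g : ℤ → ℕ × ℕ × ℕ) (p : ℕ), IsBiPath c g ∧ 0 < p ∧ (∀ i, g (i + p) = g i) ∧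
      ∃ i, (g i).2.1 ≠ a := by
  have hper : ∀ (i : ℤ) (p : ℕ), 0 < p → (f i).1 = (f (i + p)).1 →
      (∃ k : ℕ, k < p ∧ (f (i + k)).2.1 ≠ a) → ∃ (g : ℤ → ℕ × ℕ × ℕ) (p : ℕ), IsBiPath c g ∧
        0 < p ∧ (∀ i, g (i + p) = g i) ∧ ∃ i, (g i).2.1 ≠ a := by
    rintro i p hp hi ⟨k, hk, hka⟩
    refine ⟨_, p, hf.periodize hp hi, hp, fun j => by simp, k, ?_⟩
    rwa [Int.emod_eq_of_lt (by omega) (by omega), add_comm]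
  have hconst : ∀ (i : ℤ) (p : ℕ), 0 < p → (f i).1 = (f (i + p)).1 →
      (∀ k : ℕ, k < p → (f (i + k)).2.1 = a) → (f i).1 = V fun _ => a := by
    intro i p hp hi hk
    have := (h.of_isBiPath _ (hf.periodize hp hi) (fun _ => a) 0 fun t => ?_).2
    · simpa using this
    · have h1 := Int.emod_nonneg (0 + (t : ℤ)) (b := p) (by omega)
      have h2 := Int.emod_lt_of_pos (0 + (t : ℤ)) (b := p) (by omega)
      obtain ⟨l, hl⟩ := Int.eq_ofNat_of_zero_le h1
      rw [hl, add_comm]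
      exact hk l (by omega)
  obtain ⟨i, j, hij, hj, hlij⟩ := exists_repeat (E := c.2) (fun k => f (k - c.2.length))
    fun k _ => (hf _).1
  obtain ⟨i', j', hij', hj', hlij'⟩ := exists_repeat (E := c.2) (fun k => f (k + 1))
    fun k _ => (hf _).1
  have e1 : (f (i - c.2.length)).1 = (f (i - c.2.length + (j - i : ℕ))).1 := by
    rw [hlij]
    congr 2
    omega
  have e2 : (f (i' + 1)).1 = (f (i' + 1 + (j' - i' : ℕ))).1 := by
    rw [hlij']
    congr 2
    omega
  by_cases h1 : ∃ k : ℕ, k < j - i ∧ (f (i - c.2.length + k)).2.1 ≠ a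
  · exact hper _ _ (by omega) e1 h1
  by_cases h2 : ∃ k : ℕ, k < j' - i' ∧ (f (i' + 1 + k)).2.1 ≠ a
  · exact hper _ _ (by omega) e2 h2
  push Not at h1 h2
  refine hper (i - c.2.length) (i' + 1 + c.2.length - i) (by omega) ?_
    ⟨c.2.length - i, by omega, ?_⟩
  · rw [hconst _ _ (by omega) e1 h1, ← hconst _ _ (by omega) e2 h2]
    congr 2
    omega
  · rwa [show (i : ℤ) - c.2.length + (c.2.length - i : ℕ) = 0 by omega]

theorem IsWindowGraph.exists_certificate (h : IsWindowGraph c K P V)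
    (hdet : ContainsDeterministic c.shift) : ∃ w : Certificate, w.Valid c := by
  refine exists_certificate_of_dataSystem hdet fun a N hN ⟨f, hf, hfa⟩ => ?_
  obtain ⟨g, p, hg, hp, hgp, i₀, hi₀⟩ := h.exists_periodic hf hfa
  have hγp : Function.Periodic (label a g) (p : ℤ) := fun i => by simp only [label, hgp]
  have hγ : ∀ i : ℤ, P fun t => label a g (i + t) := fun i =>
    (h.of_isBiPath g hg _ i fun t => by rw [hg.label_eq]).1
  have hi₀' : label a g i₀ ≠ a := fun e => hi₀ (by rw [← hg.label_eq a, e])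
  -- Two periods of `γ` show a letter other than `a` twice, as needed to locate blocks on a constant
  -- background; `d` is a multiple of `2 * p` and of `N`, and at least `2 * K + 1`.
  refine ⟨_, inferInstance, h.dataSystem a hγ (m := 2 * p) (d := 2 * p * N * (2 * K + 1))
    (by omega) (by push_cast; exact hγp.int_mul 2) ⟨N * (2 * K + 1), by ring⟩
    (Nat.le_mul_of_pos_left _ (by positivity)), ⟨2 * p * (2 * K + 1), ?_⟩, ?_⟩
  · change 2 * p * N * (2 * K + 1) = _
    ring
  · rintro q ⟨-, s, hs⟩
    have h1 := Int.emod_nonneg (i₀ - s) (b := p) (by omega)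
    have h2 := Int.emod_lt_of_pos (i₀ - s) (b := p) (by omega)
    obtain ⟨l, hl⟩ := Int.eq_ofNat_of_zero_le h1
    have hs1 : label a g (s + l) = label a g i₀ := by
      have := hγp.int_mul ((i₀ - s) / p) (s + l)
      rw [← this]
      congr 1
      have := Int.emod_add_mul_ediv (i₀ - s) p
      rw [hl] at this
      simp only [Int.cast_id] at *
      linarith
    refine ⟨Sum.inr ⟨l, by omega⟩, Sum.inr ⟨l + p, by omega⟩, by simp; omega, ?_, ?_⟩
    · rw [hs, hs1]
      exact hi₀'
    · rw [hs]
      push_cast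
      rw [← add_assoc, hγp, hs1]
      exact hi₀'

end WindowGraph

/-! ## Systems of data for the uncountable sofic subshifts -/

/-- The ends of the paths labelled by `w` whose sources are in `U`. -/
def post (c : GraphCode) (U : Set ℕ) (w : List (Fin c.1)) : Set ℕ :=
  w.foldl (fun (U : Set ℕ) (b : Fin c.1) => {v' | ∃ v ∈ U, (v, (b : ℕ), v') ∈ c.2}) U

theorem post_append (c : GraphCode) (U : Set ℕ) (w w' : List (Fin c.1)) :
    post c U (w ++ w') = post c (post c U w) w' := List.foldl_append

theorem mem_post_concat {c : GraphCode} {U : Set ℕ} {w : List (Fin c.1)} {b : Fin c.1} {v' : ℕ} :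
    v' ∈ post c U (w ++ [b]) ↔ ∃ v ∈ post c U w, (v, (b : ℕ), v') ∈ c.2 := by
  rw [post_append]
  rfl

theorem post_empty (c : GraphCode) (w : List (Fin c.1)) : post c ∅ w = ∅ := by
  induction w using List.reverseRecOn with
  | nil => rfl
  | append_singleton w b ih =>
    ext v'
    simp [mem_post_concat, ih]

theorem post_nonempty_of_append {c : GraphCode} {U : Set ℕ} {w w' : List (Fin c.1)}
    (h : (post c U (w ++ w')).Nonempty) : (post c U w).Nonempty := by
  rw [Set.nonempty_iff_ne_empty]
  intro h0
  rw [post_append, h0, post_empty] at h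
  exact Set.not_nonempty_empty h

/-- The paths of length `L`, as words of edges. -/
abbrev Seg (c : GraphCode) (L : ℕ) : Type := Fin L → {e : ℕ × ℕ × ℕ // e ∈ c.2}

/-- Two distinct words `C false` and `C true` of length `L` that are labels of paths from `U`
onto `U`, the former one being primitive. -/
structure IsClock (c : GraphCode) (L : ℕ) (C : Bool → ℕ → Fin c.1) (U : Set ℕ) : Prop where
  one_lt : 1 < L
  nonempty : U.Nonempty
  post_eq : ∀ β, post c U ((List.range L).map (C β)) = U
  primitive : ∀ s, 0 < s → s < L → ∃ i, C false (i % L) ≠ C false ((i + s) % L)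
  exists_ne : ∃ i < L, C false i ≠ C true i

section Clock

variable {c : GraphCode} {L : ℕ} {C : Bool → ℕ → Fin c.1} {U : Set ℕ}

open Classical in
/-- The content of the register `b` for the sequence of segments `S`: the word `C true` signals
the segment `b`. -/
noncomputable def tape (C : Bool → ℕ → Fin c.1) (S : ℕ → Seg c L) (b : Option (Seg c L)) (j : ℕ) :
    Fin c.1 := C (decide (b = some (S (j / L)))) (j % L)

theorem tape_congr {S S' : ℕ → Seg c L} (b : Option (Seg c L)) {j j' : ℕ}
    (h : S (j / L) = S' (j' / L)) (h' : j % L = j' % L) : tape C S b j = tape C S' b j' := by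
  simp only [tape, h, h']

theorem tape_add (S : ℕ → Seg c L) (b : Option (Seg c L)) (n j : ℕ) (hL : 0 < L) :
    tape C (fun m => S (m + n)) b j = tape C S b (j + n * L) := by
  simp only [tape, Nat.add_mul_mod_self_right, Nat.add_mul_div_right _ _ hL]

theorem tape_mul_add (S : ℕ → Seg c L) (b : Option (Seg c L)) (n : ℕ) :
    ∃ β, ∀ j < L, tape C S b (n * L + j) = C β j := by
  classical
  refine ⟨decide (b = some (S n)), fun j hj => ?_⟩
  rw [tape, add_comm, Nat.add_mul_div_right _ _ (by omega), Nat.div_eq_of_lt hj, zero_add,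
    Nat.add_mul_mod_self_right, Nat.mod_eq_of_lt hj]

/-- Two segments that follow each other in a bi-infinite path. -/
def Consecutive (s s' : Seg c L) : Prop :=
  ∃ f, IsBiPath c f ∧ (∀ k : Fin L, (s k : ℕ × ℕ × ℕ) = f k) ∧
    ∀ k : Fin L, (s' k : ℕ × ℕ × ℕ) = f (k + L)

/-- The state `q` shows the registers for the segments `S`, from the phase `φ` on. -/
def Shows (C : Bool → ℕ → Fin c.1) (q : (Option (Seg c L) × Fin (2 * L)) ⊕ Unit → Fin c.1)
    (φ : ℕ) (S : ℕ → Seg c L) : Prop :=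
  φ < L ∧ Consecutive (S 1) (S 2) ∧ ∀ b i, q (Sum.inl (b, i)) = tape C S b (φ + i)

/-- The register `none` only repeats the primitive word `C false`, which reveals the phase. The `2 *
L` cells always contain the whole word of rank 1, and there the register of the segment `S 1` alone
shows `C true`. -/
theorem IsClock.shows_unique (h : IsClock c L C U)
    {q : (Option (Seg c L) × Fin (2 * L)) ⊕ Unit → Fin c.1} {φ φ' : ℕ} {S S' : ℕ → Seg c L}
    (h1 : Shows C q φ S) (h2 : Shows C q φ' S') : φ = φ' ∧ S 1 = S' 1 := by
  have hL := h.one_lt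
  have key : ∀ {φ φ' : ℕ} {S S' : ℕ → Seg c L}, Shows C q φ S → Shows C q φ' S' → ¬ φ < φ' := by
    intro φ φ' S S' h1 h2 hlt
    obtain ⟨i, hi⟩ := h.primitive (φ' - φ) (by omega) (by have := h2.1; omega)
    refine hi ?_
    have hlt := Nat.mod_lt (i + (L - φ)) (show 0 < L by omega)
    have e1 := h1.2.2 none ⟨(i + (L - φ)) % L, by omega⟩
    have e2 := h2.2.2 none ⟨(i + (L - φ)) % L, by omega⟩
    rw [e1] at e2
    simp only [tape, reduceCtorEq, decide_false, Nat.add_mod_mod] at e2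
    have := h1.1
    rwa [show φ + (i + (L - φ)) = i + L by omega,
      show φ' + (i + (L - φ)) = i + (φ' - φ) + L by omega, Nat.add_mod_right,
      Nat.add_mod_right] at e2
  have hφ : φ = φ' := le_antisymm (not_lt.1 (key h2 h1)) (not_lt.1 (key h1 h2))
  refine ⟨hφ, ?_⟩
  subst hφ
  by_contra hne
  obtain ⟨i, hi, hne'⟩ := h.exists_ne
  have hlt := h1.1
  have e1 := h1.2.2 (some (S 1)) ⟨L + i - φ, by omega⟩
  have e2 := h2.2.2 (some (S 1)) ⟨L + i - φ, by omega⟩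
  rw [e1] at e2
  simp only [tape] at e2
  rw [show φ + (L + i - φ) = i + 1 * L by omega, Nat.add_mul_div_right _ _ (by omega),
    Nat.div_eq_of_lt hi, Nat.add_mul_mod_self_right, Nat.mod_eq_of_lt hi] at e2
  simp only [zero_add, decide_true, Option.some.injEq, hne, decide_false] at e2
  exact hne' e2.symm

/-- The segment of the path `f` from `m` on. -/
noncomputable def seg (L : ℕ) (e₀ : {e : ℕ × ℕ × ℕ // e ∈ c.2}) (f : ℤ → ℕ × ℕ × ℕ) (m : ℤ) :
    Seg c L :=
  fun k => if h : f (m + k) ∈ c.2 then ⟨f (m + k), h⟩ else e₀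

theorem seg_congr {e₀ : {e : ℕ × ℕ × ℕ // e ∈ c.2}} {f f' : ℤ → ℕ × ℕ × ℕ} {m m' : ℤ}
    (h : ∀ k : ℕ, k < L → f (m + k) = f' (m' + k)) : seg L e₀ f m = seg L e₀ f' m' := by
  funext k
  simp only [seg, h k k.2]

theorem IsBiPath.seg_apply {f : ℤ → ℕ × ℕ × ℕ} (hf : IsBiPath c f)
    (e₀ : {e : ℕ × ℕ × ℕ // e ∈ c.2}) (m : ℤ) (k : Fin L) :
    (seg L e₀ f m k : ℕ × ℕ × ℕ) = f (m + k) := by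
  rw [seg, dif_pos (hf _).1]

theorem IsBiPath.consecutive {f : ℤ → ℕ × ℕ × ℕ} (hf : IsBiPath c f)
    (e₀ : {e : ℕ × ℕ × ℕ // e ∈ c.2}) {m m' : ℤ} (hm : m' = m + L) :
    Consecutive (seg L e₀ f m) (seg L e₀ f m') := by
  refine ⟨_, hf.add m, fun k => ?_, fun k => ?_⟩
  · rw [hf.seg_apply, add_comm]
  · rw [hf.seg_apply, hm]
    congr 1
    ring

theorem Consecutive.exists_next {s s' : Seg c L} (h : Consecutive s s') :
    ∃ s'', Consecutive s' s'' := by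
  obtain ⟨f, hf, h1, h2⟩ := h
  refine ⟨fun k => ⟨f (k + L + L), (hf _).1⟩, _, hf.add L, fun k => ?_, fun k => rfl⟩
  rw [h2]

/-- The letter `s` shows at the phase `φ`. -/
noncomputable def segLetter (a : Fin c.1) (s : Seg c L) (φ : ℕ) : Fin c.1 :=
  if h : ∃ h : φ < L, (s ⟨φ, h⟩).1.2.1 < c.1 then ⟨(s ⟨φ, h.1⟩).1.2.1, h.2⟩ else a

open Classical in
/-- The phase and the segments that a state shows, in accordance with the next block. -/
noncomputable def decoded (C : Bool → ℕ → Fin c.1) (e₀ : {e : ℕ × ℕ × ℕ // e ∈ c.2})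
    (q r : (Option (Seg c L) × Fin (2 * L)) ⊕ Unit → Fin c.1) : ℕ × (ℕ → Seg c L) :=
  if h : ∃ p : ℕ × (ℕ → Seg c L), Shows C q p.1 p.2 ∧
    ∃ φ S, Shows C r φ S ∧ S 1 = p.2 2 then h.choose
  else if h : ∃ p : ℕ × (ℕ → Seg c L), Shows C q p.1 p.2 then h.choose else (0, fun _ _ => e₀)

theorem shows_decoded (e₀ : {e : ℕ × ℕ × ℕ // e ∈ c.2})
    {q : (Option (Seg c L) × Fin (2 * L)) ⊕ Unit → Fin c.1} (hq : ∃ φ S, Shows C q φ S)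
    (r : (Option (Seg c L) × Fin (2 * L)) ⊕ Unit → Fin c.1) :
    Shows C q (decoded C e₀ q r).1 (decoded C e₀ q r).2 := by
  rw [decoded]
  split_ifs with h1 h2
  · exact h1.choose_spec.1
  · exact h2.choose_spec
  · obtain ⟨φ, S, h⟩ := hq
    exact absurd ⟨(φ, S), h⟩ h2

/-- At best a part of the word for `S 2` is visible in `q`; but the block to the right shows that
segment as its own `S 1`, so the choice made with its help is the right one. -/
theorem IsClock.decoded_eq (h : IsClock c L C U) (e₀ : {e : ℕ × ℕ × ℕ // e ∈ c.2})
    {q r : (Option (Seg c L) × Fin (2 * L)) ⊕ Unit → Fin c.1} {φ φ' : ℕ} {S S' : ℕ → Seg c L}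
    (hq : Shows C q φ S) (hr : Shows C r φ' S') (hS : S' 1 = S 2) :
    (decoded C e₀ q r).1 = φ ∧ (decoded C e₀ q r).2 1 = S 1 ∧
      (decoded C e₀ q r).2 2 = S 2 := by
  have hex : ∃ p : ℕ × (ℕ → Seg c L), Shows C q p.1 p.2 ∧
    ∃ φ S, Shows C r φ S ∧ S 1 = p.2 2 := ⟨(φ, S), hq, φ', S', hr, hS⟩
  rw [decoded, dif_pos hex]
  obtain ⟨h1, φ'', S'', h2, h3⟩ := hex.choose_spec
  obtain ⟨e1, e2⟩ := h.shows_unique h1 hq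
  exact ⟨e1, e2, by rw [← h3, ← hS, (h.shows_unique h2 hr).2]⟩

/-- Move the registers by one cell, and show the next letter. -/
noncomputable def nextState (C : Bool → ℕ → Fin c.1) (a : Fin c.1)
    (e₀ : {e : ℕ × ℕ × ℕ // e ∈ c.2})
    (q r : (Option (Seg c L) × Fin (2 * L)) ⊕ Unit → Fin c.1) :
    (Option (Seg c L) × Fin (2 * L)) ⊕ Unit → Fin c.1 :=
  Sum.elim (fun k => if h : (k.2 : ℕ) + 1 < 2 * L then q (Sum.inl (k.1, ⟨k.2 + 1, h⟩))
      else tape C (decoded C e₀ q r).2 k.1 ((decoded C e₀ q r).1 + 2 * L))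
    fun _ => segLetter a ((decoded C e₀ q r).2 1) (decoded C e₀ q r).1

theorem IsClock.nextState_spec (h : IsClock c L C U) (a : Fin c.1)
    (e₀ : {e : ℕ × ℕ × ℕ // e ∈ c.2}) {q : (Option (Seg c L) × Fin (2 * L)) ⊕ Unit → Fin c.1}
    (hq : ∃ φ S, Shows C q φ S)
    (r : (Option (Seg c L) × Fin (2 * L)) ⊕ Unit → Fin c.1) :
    ∃ φ S, Shows C q φ S ∧ nextState C a e₀ q r (Sum.inr ()) = segLetter a (S 1) φ ∧
      ((φ + 1 < L ∧ Shows C (nextState C a e₀ q r) (φ + 1) S) ∨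
        (φ + 1 = L ∧ ∃ S', S' 1 = S 2 ∧ Shows C (nextState C a e₀ q r) 0 S')) := by
  have hL := h.one_lt
  have hs := shows_decoded e₀ hq r
  refine ⟨_, _, hs, rfl, ?_⟩
  set φ := (decoded C e₀ q r).1 with hφ
  set S := (decoded C e₀ q r).2 with hS
  have hnext : ∀ b i, nextState C a e₀ q r (Sum.inl (b, i)) = tape C S b (φ + 1 + i) := by
    intro b i
    simp only [nextState, Sum.elim_inl]
    split_ifs with hi
    · rw [hs.2.2]
      congr 1
      simp only
      omega
    · rw [← hφ, ← hS]
      congr 1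
      omega
  rcases (Nat.succ_le_of_lt hs.1).lt_or_eq with h1 | h1
  · exact Or.inl ⟨h1, h1, hs.2.1, hnext⟩
  · obtain ⟨s, hs'⟩ := hs.2.1.exists_next
    -- At the phase `0` exactly two words are visible, so the segment of rank 2 can still be any
    -- successor.
    refine Or.inr ⟨h1, fun m => if m = 2 then s else S (m + 1), rfl, by omega, hs', fun b i => ?_⟩
    rw [hnext]
    have e : φ + 1 + i = (0 + i) + 1 * L := by omega
    rw [e, ← tape_add S b 1 _ (by omega)]
    have : (0 + (i : ℕ)) / L ≠ 2 := by
      have := Nat.div_lt_of_lt_mul (show 0 + (i : ℕ) < L * 2 by omega)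
      omega
    simp only [tape, this, if_false]

section Orbit

variable {a : Fin c.1} {e₀ : {e : ℕ × ℕ × ℕ // e ∈ c.2}}
  {q : ℕ → (Option (Seg c L) × Fin (2 * L)) ⊕ Unit → Fin c.1}

/-- The phase advances by one at each step, whatever the neighbours contain. -/
theorem IsClock.phase_add (h : IsClock c L C U)
    (hq : ∀ t, (∃ φ S, Shows C (q t) φ S) ∧ ∃ r, q (t + 1) = nextState C a e₀ (q t) r)
    {t s φ φ' : ℕ} {S S' : ℕ → Seg c L} (h1 : Shows C (q t) φ S)
    (h2 : Shows C (q (t + s)) φ' S') : φ' = (φ + s) % L := by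
  induction s generalizing φ' S' with
  | zero => rw [(h.shows_unique h2 h1).1, add_zero, Nat.mod_eq_of_lt h1.1]
  | succ s ih =>
    obtain ⟨hs, r, hr⟩ := hq (t + s)
    obtain ⟨φ₁, S₁, h3, -, h4⟩ := h.nextState_spec a e₀ hs r
    rw [← hr] at h4
    rw [← add_assoc, ← Nat.mod_add_mod, ← ih h3]
    rcases h4 with ⟨h4, h5⟩ | ⟨h4, S₂, -, h5⟩
    · rw [(h.shows_unique h2 h5).1, Nat.mod_eq_of_lt h4]
    · rw [(h.shows_unique h2 h5).1, h4, Nat.mod_self]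

theorem register_add
    (hq : ∀ t, (∃ φ S, Shows C (q t) φ S) ∧ ∃ r, q (t + 1) = nextState C a e₀ (q t) r)
    (b : Option (Seg c L)) (t s j : ℕ) (hj : j + s < 2 * L) :
    q (t + s) (Sum.inl (b, ⟨j, by omega⟩)) = q t (Sum.inl (b, ⟨j + s, hj⟩)) := by
  induction s generalizing j with
  | zero => rfl
  | succ s ih =>
    obtain ⟨-, r, hr⟩ := hq (t + s)
    rw [← add_assoc, hr, nextState, Sum.elim_inl, dif_pos (by simp only; omega)]
    simp only
    rw [ih (j + 1) (by omega)]
    congr 4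
    omega

/-- At time `L`, the cell `i` shows the letter of rank `(φ + i) % L` of some word `C β`. The earlier
letters of that word passed through the same cell during the preceding steps, since registers only
move. -/
theorem IsClock.register_prefix (h : IsClock c L C U)
    (hq : ∀ t, (∃ φ S, Shows C (q t) φ S) ∧ ∃ r, q (t + 1) = nextState C a e₀ (q t) r)
    (b : Option (Seg c L)) (i : Fin (2 * L)) {φ : ℕ} {S : ℕ → Seg c L}
    (hL : Shows C (q L) φ S) :
    ∃ β, ∀ m ≤ (φ + i) % L, q (L - (φ + i) % L + m) (Sum.inl (b, i)) = C β m := by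
  have hL1 := h.one_lt
  have hψ := Nat.mod_lt (φ + i) (show 0 < L by omega)
  have hdiv := Nat.mod_add_div' (φ + i) L
  set ψ := (φ + i) % L with hψ'
  by_cases hi : ψ ≤ i
  -- The letters that have passed are still in the register at time `L`, to the left of the cell.
  · obtain ⟨β, hβ⟩ := tape_mul_add (C := C) S b ((φ + i) / L)
    refine ⟨β, fun m hm => ?_⟩
    have := register_add hq b (L - ψ + m) (ψ - m) (i - (ψ - m)) (by omega)
    simp only [show L - ψ + m + (ψ - m) = L by omega,
      show (i : ℕ) - (ψ - m) + (ψ - m) = i by omega] at this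
    rw [← hβ m (by omega), ← this, hL.2.2]
    congr 1
    simp only
    omega
  -- Otherwise, `ψ` steps earlier the word started at this cell, and its prefix stood to the right
  -- of it in the register.
  · obtain ⟨φ₁, S₁, h1⟩ := (hq (L - ψ)).1
    have hph := h.phase_add hq (s := ψ) h1 (by rwa [Nat.sub_add_cancel hψ.le])
    have hmod : (φ₁ + i) % L = 0 := by
      have : (φ₁ + i + ψ) % L = (0 + ψ) % L := calc
        (φ₁ + i + ψ) % L = ((φ₁ + ψ) % L + i) % L := by rw [Nat.mod_add_mod, add_right_comm]
        _ = ψ := by rw [← hph]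
        _ = (0 + ψ) % L := by rw [zero_add, Nat.mod_eq_of_lt hψ]
      exact Nat.ModEq.add_right_cancel' ψ this
    obtain ⟨n, hn⟩ := Nat.dvd_of_mod_eq_zero hmod
    obtain ⟨β, hβ⟩ := tape_mul_add (C := C) S₁ b n
    refine ⟨β, fun m hm => ?_⟩
    rw [register_add hq b (L - ψ) m i (by omega), h1.2.2, ← hβ m (by omega)]
    congr 1
    simp only
    rw [← add_assoc, hn, mul_comm]

theorem Shows.segLetter_eq {q : (Option (Seg c L) × Fin (2 * L)) ⊕ Unit → Fin c.1} {φ : ℕ}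
    {S : ℕ → Seg c L} (h : Shows C q φ S) :
    (segLetter a (S 1) φ : ℕ) = (S 1 ⟨φ, h.1⟩).1.2.1 := by
  obtain ⟨f, hf, h1, -⟩ := h.2.1
  rw [segLetter, dif_pos ⟨h.1, by rw [h1]; exact (hf _).2.1⟩]

end Orbit

end Clock

/-! ### The data system of a clock -/

section Clock

variable {c : GraphCode} {L : ℕ} {C : Bool → ℕ → Fin c.1} {U : Set ℕ}

/-- The orbit of a block in the row of blocks that represents the path `f`. -/
noncomputable def clockEnc (C : Bool → ℕ → Fin c.1) (a : Fin c.1)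
    (e₀ : {e : ℕ × ℕ × ℕ // e ∈ c.2}) (f : ℤ → ℕ × ℕ × ℕ) (t : ℕ) :
    (Option (Seg c L) × Fin (2 * L)) ⊕ Unit → Fin c.1 :=
  Sum.elim (fun k => tape C (fun m => seg L e₀ f (m * L : ℕ)) k.1 (t + k.2))
    fun _ => label a f (t + L - 1)

theorem shows_clockEnc (hL : 0 < L) (a : Fin c.1) (e₀ : {e : ℕ × ℕ × ℕ // e ∈ c.2})
    {f : ℤ → ℕ × ℕ × ℕ} (hf : IsBiPath c f) (t : ℕ) :
    Shows C (clockEnc (L := L) C a e₀ f t) (t % L)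
      fun m => seg L e₀ f ((m + t / L) * L : ℕ) := by
  refine ⟨Nat.mod_lt _ hL, hf.consecutive e₀ (by push_cast; ring), fun b i => ?_⟩
  rw [tape_add (fun m => seg L e₀ f (m * L : ℕ)) b (t / L) _ hL, clockEnc, Sum.elim_inl]
  congr 1
  have := Nat.mod_add_div' t L
  simp only
  omega

theorem clockEnc_add {a : Fin c.1} {e₀ : {e : ℕ × ℕ × ℕ // e ∈ c.2}} (hL : 0 < L)
    (f : ℤ → ℕ × ℕ × ℕ) (t : ℕ) :
    clockEnc C a e₀ (fun k => f (k + L)) t = clockEnc (L := L) C a e₀ f (t + L) := by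
  funext k
  rcases k with ⟨b, i⟩ | _
  · simp only [clockEnc, Sum.elim_inl]
    rw [add_right_comm]
    have := tape_add (C := C) (fun m => seg L e₀ f (m * L : ℕ)) b 1 (t + i) hL
    rw [one_mul] at this
    rw [← this]
    congr 1
    funext m
    refine seg_congr fun k _ => congrArg f ?_
    push_cast
    ring
  · refine label_congr (congrArg f ?_)
    push_cast
    ring

open Classical in
/-- The data system of a clock: the registers cover the graph by paths from and to `U`, and the
last column displays the path that is read in the registers. -/
noncomputable def IsClock.dataSystem (h : IsClock c L C U) (a : Fin c.1)
    (e₀ : {e : ℕ × ℕ × ℕ // e ∈ c.2}) :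
    DataSystem c ((Option (Seg c L) × Fin (2 * L)) ⊕ Unit) where
  states := {q | ∃ φ S, Shows C q φ S}
  next := nextState C a e₀
  next_mem q hq r := by
    obtain ⟨φ, S, -, -, ⟨-, h1⟩ | ⟨-, S', -, h1⟩⟩ := h.nextState_spec a e₀ hq r
    exacts [⟨_, _, h1⟩, ⟨_, _, h1⟩]
  len := L
  len_pos := by have := h.one_lt; omega
  enc := clockEnc C a e₀
  display := Sum.inr ()
  enc_mem f hf t := ⟨_, _, shows_clockEnc (by have := h.one_lt; omega) a e₀ hf t⟩
  enc_succ f hf t := by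
    have hL : 0 < L := by have := h.one_lt; omega
    have h1 := shows_clockEnc (C := C) hL a e₀ hf t
    have h2 := shows_clockEnc (C := C) hL a e₀ (hf.add L) t
    obtain ⟨e1, e2, e3⟩ := h.decoded_eq e₀ h1 h2 (by
      refine seg_congr fun k _ => congrArg f ?_
      push_cast
      ring)
    funext k
    rcases k with ⟨b, i⟩ | _
    · simp only [nextState, Sum.elim_inl]
      split_ifs with hi
      · simp only [clockEnc, Sum.elim_inl]
        congr 1
        omega
      · change tape C (fun m => seg L e₀ f (m * L : ℕ)) b (t + 1 + i) = _
        have hi' : (i : ℕ) + 1 = 2 * L := by omega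
        have e4 : (t % L + 2 * L) / L = 2 := by
          rw [Nat.add_mul_div_right _ _ hL, Nat.div_eq_of_lt (Nat.mod_lt _ hL)]
        have e5 : t + 1 + (i : ℕ) = t + 2 * L := by omega
        refine tape_congr b ?_ ?_
        · rw [e1, e4, e3, e5, Nat.add_mul_div_right _ _ hL, add_comm 2]
        · rw [e1, e5, Nat.add_mul_mod_self_right, Nat.add_mul_mod_self_right, Nat.mod_mod]
    · simp only [nextState, Sum.elim_inr]
      have h3 := h1.segLetter_eq (a := a)
      rw [e1, e2]
      refine Fin.ext ?_
      rw [h3, hf.seg_apply, clockEnc, Sum.elim_inr, hf.label_eq]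
      congr 3
      have := Nat.mod_add_div' t L
      zify at this
      push_cast
      linarith
  enc_len f hf := by
    rw [clockEnc_add (by have := h.one_lt; omega), zero_add]
  enc_congr f f' hf hf' hff := by
    have hL := h.one_lt
    funext k
    rcases k with ⟨b, i⟩ | _
    · have : (0 + (i : ℕ)) / L < 2 := Nat.div_lt_of_lt_mul (by omega)
      have hmul : (0 + (i : ℕ)) / L * L ≤ 1 * L := Nat.mul_le_mul_right L (by omega)
      refine tape_congr (S := fun m => seg L e₀ f (m * L : ℕ))
        (S' := fun m => seg L e₀ f' (m * L : ℕ)) b (seg_congr fun k hk => ?_) rfl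
      rw [← Nat.cast_add]
      exact hff _ (by simp only; omega)
    · refine label_congr ?_
      rw [show ((0 : ℕ) : ℤ) + L - 1 = (L - 1 : ℕ) by omega]
      exact hff _ (by omega)
  enc_display f hf φ hφ := by
    simp only [clockEnc, Sum.elim_inr]
    rw [hf.label_eq]
    congr 3
    push_cast
    ring
  -- In a register, the vertices are those reached from `U` by the letters of the current word that
  -- have passed, which requires looking back by fewer than `L` steps. In the last cell, the vertex
  -- is the source of the displayed edge, decoded one step before.
  delay := L
  memory := L
  sources k q := Sum.elim
    (fun k => {v | ∃ φ S, Shows C (q L) φ S ∧ v ∈ post c U ((List.range ((φ + k.2) % L)).map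
      fun m => q (L - (φ + k.2) % L + m) (Sum.inl k))})
    (fun _ => {v | ∃ φ S, ∃ hs : Shows C (q (L - 1)) φ S, v = (S 1 ⟨φ, hs.1⟩).1.1}) k
  sources_nonempty k q hq := by
    rcases k with ⟨b, i⟩ | _
    · obtain ⟨φ, S, hs⟩ := (hq L).1
      obtain ⟨β, hβ⟩ := h.register_prefix hq b i hs
      have hψ := Nat.mod_lt (φ + i) (show 0 < L by have := h.one_lt; omega)
      obtain ⟨v, hv⟩ : (post c U ((List.range ((φ + i) % L)).map (C β))).Nonempty := by
        refine post_nonempty_of_append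
          (w' := ((List.range L).map (C β)).drop ((φ + i) % L)) ?_
        have : (List.range ((φ + i) % L)).map (C β) =
            ((List.range L).map (C β)).take ((φ + i) % L) := by
          rw [← List.map_take, List.take_range, min_eq_left hψ.le]
        rw [this, List.take_append_drop, h.post_eq]
        exact h.nonempty
      refine ⟨v, φ, S, hs, ?_⟩
      convert hv using 2
      refine List.map_congr_left fun m hm => hβ m ?_
      exact (List.mem_range.1 hm).le
    · obtain ⟨φ, S, hs⟩ := (hq (L - 1)).1
      exact ⟨_, φ, S, hs, rfl⟩
  sources_congr k q q' hqq := by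
    rcases k with ⟨b, i⟩ | _
    · simp only [Sum.elim_inl]
      rw [hqq L le_rfl]
      ext v
      refine exists_congr fun φ => exists_congr fun S => and_congr_right fun hs => ?_
      have hψ := Nat.mod_lt (φ + i) (show 0 < L by have := h.one_lt; omega)
      rw [List.map_congr_left fun m hm => ?_]
      rw [hqq _ (by have := List.mem_range.1 hm; omega)]
    · simp only [Sum.elim_inr]
      rw [hqq (L - 1) (by omega)]
  exists_edge k q hq := by
    have hL1 := h.one_lt
    rintro v' hv'
    rcases k with ⟨b, i⟩ | _
    · obtain ⟨φ', S', hs', hv'⟩ := hv'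
      obtain ⟨φ, S, hs⟩ := (hq L).1
      have hph : φ' = (φ + 1) % L := h.phase_add hq hs hs'
      have hψ := Nat.mod_lt (φ + i) (show 0 < L by omega)
      have hψ' : (φ' + i) % L = ((φ + i) % L + 1) % L := by
        rw [hph, Nat.mod_add_mod, Nat.mod_add_mod, add_right_comm]
      suffices hs : v' ∈ post c U ((List.range ((φ + i) % L)).map (fun m =>
          q (L - (φ + i) % L + m) (Sum.inl (b, i))) ++ [q L (Sum.inl (b, i))]) by
        obtain ⟨v, hv, hE⟩ := mem_post_concat.1 hs
        exact ⟨v, ⟨φ, S, ‹_›, hv⟩, hE⟩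
      have hlist : (List.range ((φ + i) % L)).map (fun m =>
          q (L - (φ + i) % L + m) (Sum.inl (b, i))) ++ [q L (Sum.inl (b, i))] =
          (List.range ((φ + i) % L + 1)).map fun m =>
            q (L - (φ + i) % L + m) (Sum.inl (b, i)) := by
        rw [List.range_succ, List.map_append, List.map_singleton, Nat.sub_add_cancel hψ.le]
      rw [hlist]
      rcases (Nat.succ_le_of_lt hψ).lt_or_eq with h1 | h1
      · simp only [hψ', Nat.mod_eq_of_lt h1] at hv'
        convert hv' using 2
        refine List.map_congr_left fun m _ => ?_
        congr 1
        omega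
      -- The word is complete. The next set of sources is `U` itself, which is what the whole word
      -- `C β` makes of `U`.
      · obtain ⟨β, hβ⟩ := h.register_prefix hq b i hs
        have h2 : (φ + (i : ℕ)) % L + 1 = L := h1
        simp only [hψ', h2, Nat.mod_self, List.range_zero, List.map_nil] at hv'
        rw [h2, List.map_congr_left (g := C β) fun m hm => hβ m ?_, h.post_eq]
        · exact hv'
        · have := List.mem_range.1 hm
          omega
    · obtain ⟨φ', S', hs', rfl⟩ := hv'
      obtain ⟨hex, r, hr⟩ := hq (L - 1)
      obtain ⟨φ, S, hs, hd, hn⟩ := h.nextState_spec a e₀ hex r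
      rw [← hr] at hd hn
      refine ⟨_, ⟨φ, S, hs, rfl⟩, ?_⟩
      obtain ⟨f, hf, hf1, hf2⟩ := hs.2.1
      rw [Nat.sub_add_cancel hL1.le] at hd
      rw [hd, hs.segLetter_eq]
      -- The next edge displayed is the following one of `S 1`, or the first one of `S 2`; these
      -- segments are consecutive in a bi-infinite path.
      have htarget : (S' 1 ⟨φ', hs'.1⟩).1.1 = (S 1 ⟨φ, hs.1⟩).1.2.2 := by
        rw [hf1, (hf _).2.2]
        rcases hn with ⟨h1, h2⟩ | ⟨h1, S₂, hS₂, h2⟩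
        · obtain ⟨rfl, e2⟩ := h.shows_unique hs' h2
          refine (congrArg (fun s : Seg c L => (s ⟨φ + 1, hs'.1⟩).1.1) e2).trans ?_
          simp only [hf1]
          push_cast
          rfl
        · obtain ⟨rfl, e2⟩ := h.shows_unique hs' h2
          refine (congrArg (fun s : Seg c L => (s ⟨0, hs'.1⟩).1.1) (e2.trans hS₂)).trans ?_
          simp only [hf2]
          congr 2
          push_cast
          omega
      rw [htarget]
      exact (S 1 ⟨φ, hs.1⟩).2

/-- A primitive word of length at least 2 is not constant, and the register `none` shows each of its
letters twice. -/
theorem IsClock.exists_ne_states (h : IsClock c L C U) (a : Fin c.1)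
    {q : (Option (Seg c L) × Fin (2 * L)) ⊕ Unit → Fin c.1} (hq : ∃ φ S, Shows C q φ S) :
    ∃ k₁ k₂, k₁ ≠ k₂ ∧ q k₁ ≠ a ∧ q k₂ ≠ a := by
  have hL := h.one_lt
  obtain ⟨i, hi⟩ : ∃ i, C false (i % L) ≠ a := by
    by_contra hcon
    push Not at hcon
    obtain ⟨i, hi⟩ := h.primitive 1 one_pos hL
    exact hi ((hcon _).trans (hcon _).symm)
  obtain ⟨φ, S, hs⟩ := hq
  have hlt := Nat.mod_lt (i + (L - φ)) (show 0 < L by omega)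
  have hmod : (φ + (i + (L - φ)) % L) % L = i % L := by
    have := hs.1
    rw [Nat.add_mod_mod, show φ + (i + (L - φ)) = i + L by omega, Nat.add_mod_right]
  refine ⟨Sum.inl (none, ⟨(i + (L - φ)) % L, by omega⟩),
    Sum.inl (none, ⟨(i + (L - φ)) % L + L, by omega⟩), by simp; omega, ?_, ?_⟩
  · rw [hs.2.2]
    simpa [tape, hmod] using hi
  · rw [hs.2.2]
    simpa [tape, ← add_assoc, hmod] using hi

end Clock

/-! ## Clocks in the uncountable sofic subshifts -/

theorem countable_of_eventually_periodic {A : Type*} [Finite A] {S : Set (ℕ → A)}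
    (h : ∀ z ∈ S, ∃ n p, 0 < p ∧ ∀ i, n ≤ i → z (i + p) = z i) : S.Countable := by
  have hsub : S ⊆ ⋃ (n : ℕ) (p : ℕ), {z : ℕ → A | 0 < p ∧ ∀ i, n ≤ i → z (i + p) = z i} :=
    fun z hz => by
      obtain ⟨n, p, hz⟩ := h z hz
      exact Set.mem_iUnion₂.2 ⟨n, p, hz⟩
  refine Set.Countable.mono hsub (Set.countable_iUnion fun n => Set.countable_iUnion fun p => ?_)
  refine Set.Finite.countable (Set.Finite.of_finite_image (f := fun z (i : Fin (n + p)) => z i)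
    (Set.toFinite _) ?_)
  rintro z ⟨hp, hz⟩ z' ⟨-, hz'⟩ hzz
  funext i
  induction i using Nat.strong_induction_on with
  | _ i ih =>
    by_cases hi : i < n + p
    · exact congrFun hzz ⟨i, hi⟩
    · have h1 := hz (i - p) (by omega)
      have h2 := hz' (i - p) (by omega)
      rw [Nat.sub_add_cancel (by omega)] at h1 h2
      rw [h1, h2, ih _ (by omega)]

theorem map_range_add {A : Type*} (z : ℕ → A) (m n : ℕ) :
    (List.range (m + n)).map z = (List.range m).map z ++ (List.range n).map fun i => z (m + i) := by
  rw [List.range_add, List.map_append, List.map_map]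
  rfl

/-- Follow the sets of vertices reached by the prefixes of `z`; one of them, `U`, recurs for ever.
If words of equal length looping at `U` had to be equal, any two loops would commute, `z` would be
eventually periodic, and there are only countably many such sequences. -/
theorem exists_loops_of_not_countable {c : GraphCode} (h : ¬ c.shift.Countable) :
    ∃ (U : Set ℕ) (u v : List (Fin c.1)), U.Nonempty ∧ u.length = v.length ∧ u ≠ v ∧
      post c U u = U ∧ post c U v = U := by
  by_contra hcon
  push Not at hcon
  refine h (countable_of_eventually_periodic fun z hz => ?_)
  obtain ⟨f, hf, hfz⟩ := exists_isPath_of_mem_shift hz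
  set V₀ : Set ℕ := {v | ∃ e ∈ c.2, e.1 = v} with hV₀
  have hfin : (V₀ ∪ {v | ∃ e ∈ c.2, e.2.2 = v}).Finite := by
    refine Set.Finite.union ?_ ?_
    · exact ((c.2.map Prod.fst).finite_toSet).subset fun v ⟨e, he, hv⟩ =>
        List.mem_map.2 ⟨e, he, hv⟩
    · exact ((c.2.map fun e => e.2.2).finite_toSet).subset fun v ⟨e, he, hv⟩ =>
        List.mem_map.2 ⟨e, he, hv⟩
  have hsucc : ∀ t, (List.range (t + 1)).map z = (List.range t).map z ++ [z t] := fun t => by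
    rw [List.range_succ, List.map_append, List.map_singleton]
  have hmem : ∀ t, (f t).1 ∈ post c V₀ ((List.range t).map z) := fun t => by
    induction t with
    | zero => exact ⟨_, (hf 0).1, rfl⟩
    | succ t ih =>
      rw [hsucc, mem_post_concat]
      refine ⟨_, ih, ?_⟩
      rw [← (hf t).2.2, ← hfz]
      exact (hf t).1
  have hsub : ∀ t, post c V₀ ((List.range t).map z) ⊆ V₀ ∪ {v | ∃ e ∈ c.2, e.2.2 = v} := by
    intro t
    cases t with
    | zero => exact Set.subset_union_left
    | succ t =>
      intro v' hv'
      rw [hsucc, mem_post_concat] at hv'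
      obtain ⟨v, -, hE⟩ := hv'
      exact Or.inr ⟨_, hE, rfl⟩
  have := hfin.finite_subsets.to_subtype
  obtain ⟨⟨U, hU⟩, hinf⟩ := Finite.exists_infinite_fiber fun t =>
    (⟨post c V₀ ((List.range t).map z), hsub t⟩ :
      {U // U ∈ {U | U ⊆ V₀ ∪ {v | ∃ e ∈ c.2, e.2.2 = v}}})
  rw [Set.infinite_coe_iff] at hinf
  have hgt : ∀ n, ∃ t, n < t ∧ post c V₀ ((List.range t).map z) = U := fun n => by
    obtain ⟨t, ht, hnt⟩ := hinf.exists_gt n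
    exact ⟨t, hnt, congrArg Subtype.val ht⟩
  obtain ⟨t₀, -, ht₀⟩ := hgt 0
  obtain ⟨t₁, h01, ht₁⟩ := hgt t₀
  have hloop : ∀ l, post c V₀ ((List.range (t₀ + l)).map z) = U →
      post c U ((List.range l).map fun i => z (t₀ + i)) = U := fun l hl => by
    rwa [map_range_add, post_append, ht₀] at hl
  obtain ⟨p, rfl⟩ := Nat.exists_eq_add_of_lt h01
  refine ⟨t₀, p + 1, by omega, fun i hi => ?_⟩
  obtain ⟨t₂, h12, ht₂⟩ := hgt (i + (p + 1))
  obtain ⟨l, rfl⟩ := Nat.exists_eq_add_of_le (show t₀ ≤ t₂ by omega)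
  have hw := hloop (p + 1) ht₁
  have hy := hloop l ht₂
  have hUne : U.Nonempty := ht₀ ▸ ⟨_, hmem t₀⟩
  -- Comparing the two products at one place gives the period `p + 1`, up to a return time chosen
  -- beyond `i + (p + 1)`.
  have hcomm : (List.range (p + 1)).map (fun i => z (t₀ + i)) ++
      (List.range l).map (fun i => z (t₀ + i)) = (List.range l).map (fun i => z (t₀ + i)) ++
      (List.range (p + 1)).map (fun i => z (t₀ + i)) := by
    by_contra hne
    exact hcon U _ _ hUne (by simp [add_comm]) hne (by rw [post_append, hw, hy])
      (by rw [post_append, hy, hw])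
  have hi2 := congrArg (fun w => w[i + (p + 1) - t₀]?) hcomm
  rw [List.getElem?_append_right (by simp; omega), List.getElem?_append_left (by simp; omega),
    List.getElem?_map, List.getElem?_map, List.getElem?_range (by simp; omega),
    List.getElem?_range (by omega)] at hi2
  simp only [List.length_map, List.length_range, Option.map_some, Option.some.injEq] at hi2
  rw [show t₀ + (i + (p + 1) - t₀ - (p + 1)) = i by omega,
    show t₀ + (i + (p + 1) - t₀) = i + (p + 1) by omega] at hi2
  exact hi2.symm

/-- This is the primitivity of `u³v` for `u ≠ v` of length `n`. A cyclic period yields a period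
between `n` and `2 * n`, which carries both the final `v` and the `u` just before it to places in
`u³` that agree modulo `n`. -/
theorem exists_ne_mod {A : Type*} {n : ℕ} {u v : ℕ → A} (h : ∃ i < n, u i ≠ v i) {s : ℕ}
    (hs : 0 < s) (hs' : s < 4 * n) :
    ∃ i, (fun i => if i < 3 * n then u (i % n) else v (i % n)) (i % (4 * n)) ≠
      (fun i => if i < 3 * n then u (i % n) else v (i % n)) ((i + s) % (4 * n)) := by
  by_contra hcon
  push Not at hcon
  set X : ℕ → A := fun i => (fun i => if i < 3 * n then u (i % n) else v (i % n)) (i % (4 * n))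
    with hX
  have hcon : ∀ i, X (i + s) = X i := fun i => (hcon i).symm
  have hper : ∀ i, X (i + 4 * n) = X i := fun i => by simp only [hX, Nat.add_mod_right]
  have key : ∀ s, 0 < s → s ≤ 2 * n → (∀ i, X (i + s) = X i) → False := by
    intro s hs hsn hX'
    have hmul : ∀ k i, X (i + k * s) = X i := fun k => by
      induction k with
      | zero => simp
      | succ k ih => intro i; rw [Nat.succ_mul, ← add_assoc, hX', ih]
    -- The largest multiple of `s` up to `2 * n`; it exceeds `n` because `s ≤ p` and `2 * n < p +
    -- s`.
    set p := 2 * n / s * s with hp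
    have h1 : p ≤ 2 * n := Nat.div_mul_le_self _ _
    have h2 : 2 * n < p + s := by
      have := Nat.lt_div_mul_add (a := 2 * n) hs
      omega
    have h3 : s ≤ p := Nat.le_mul_of_pos_left s (Nat.div_pos hsn hs)
    obtain ⟨i, hi, hne⟩ := h
    refine hne ?_
    have e1 : X (3 * n + i) = v i := by
      simp only [hX]
      rw [Nat.mod_eq_of_lt (by omega), if_neg (by omega), mul_comm, Nat.mul_add_mod,
        Nat.mod_eq_of_lt hi]
    have e2 : ∀ j, j < 3 * n → X j = u (j % n) := fun j hj => by
      simp only [hX]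
      rw [Nat.mod_eq_of_lt (by omega), if_pos hj]
    have e3 := hmul (2 * n / s) (3 * n + i - p)
    rw [Nat.sub_add_cancel (by omega), e1, e2 _ (by omega)] at e3
    have e4 := hmul (2 * n / s) (2 * n + i - p)
    rw [Nat.sub_add_cancel (by omega), e2 _ (by omega), e2 _ (by omega), mul_comm,
      Nat.mul_add_mod, Nat.mod_eq_of_lt hi, mul_comm] at e4
    rw [e3, e4, show 3 * n + i - p = 2 * n + i - p + n by omega, Nat.add_mod_right]
  by_cases h2 : s ≤ 2 * n
  · exact key s hs h2 hcon
  · refine key (4 * n - s) (by omega) (by omega) fun i => ?_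
    rw [← hcon, add_assoc, Nat.sub_add_cancel hs'.le, hper]

theorem exists_isClock {c : GraphCode} (h : ¬ c.shift.Countable) (a : Fin c.1) {N : ℕ}
    (hN : 0 < N) : ∃ L C U, N ∣ L ∧ IsClock c L C U := by
  obtain ⟨U, u, v, hU, huv, hne, hu, hv⟩ := exists_loops_of_not_countable h
  have hpow : ∀ k, post c U (List.replicate k u).flatten = U := fun k => by
    induction k with
    | zero => rfl
    | succ k ih => rw [List.replicate_succ, List.flatten_cons, post_append, hu, ih]
  set w := (List.replicate (N - 1) u).flatten with hw
  have hlen : (w ++ u).length = N * u.length := by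
    obtain ⟨k, rfl⟩ := Nat.exists_eq_succ_of_ne_zero hN.ne'
    simp [hw, Nat.succ_mul]
  set n := N * u.length with hn
  have hlen' : (w ++ v).length = n := by rw [← hlen]; simp [huv]
  have hu0 : 0 < u.length := by
    by_contra h0
    have h1 : u.length = 0 := by omega
    exact hne ((List.length_eq_zero_iff.1 h1).trans (List.length_eq_zero_iff.1 (huv ▸ h1)).symm)
  have hn0 : 0 < n := Nat.mul_pos hN hu0
  have hget : ∀ l : List (Fin c.1), l.length = n →
      (List.range n).map (fun i => l.getD i a) = l := fun l hl => by
    refine List.ext_getElem (by simp [hl]) fun i h1 h2 => ?_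
    simp [h2]
  have hget' : ∀ l : List (Fin c.1), l.length = n → ∀ m,
      (List.range n).map (fun i => l.getD ((m * n + i) % n) a) = l := fun l hl m => by
    conv_rhs => rw [← hget l hl]
    refine List.map_congr_left fun i hi => ?_
    rw [add_comm, Nat.add_mul_mod_self_right, Nat.mod_eq_of_lt (List.mem_range.1 hi)]
  have hpu : post c U (w ++ u) = U := by rw [post_append, hpow, hu]
  have hpv : post c U (w ++ v) = U := by rw [post_append, hpow, hv]
  have hex : ∃ i < n, (w ++ u).getD i a ≠ (w ++ v).getD i a := by
    by_contra hcon
    push Not at hcon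
    refine hne (List.append_cancel_left (as := w) ?_)
    rw [← hget _ hlen, ← hget _ hlen']
    exact List.map_congr_left fun i hi => hcon i (List.mem_range.1 hi)
  have hsplit : ∀ z : ℕ → Fin c.1, (List.range (4 * n)).map z =
      (((List.range n).map fun i => z (0 * n + i)) ++ ((List.range n).map fun i => z (1 * n + i)) ++
        ((List.range n).map fun i => z (2 * n + i))) ++
        ((List.range n).map fun i => z (3 * n + i)) := fun z => by
    rw [show 4 * n = n + n + n + n by ring, map_range_add, map_range_add, map_range_add]
    simp only [zero_mul, zero_add, one_mul, show 2 * n = n + n by ring,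
      show 3 * n = n + n + n by ring]
  have h4 : ∀ y x, post c U y = U → post c U (y ++ y ++ y ++ x) = post c U x := fun y x hy => by
    rw [post_append, post_append, post_append, hy, hy, hy]
  -- With `w` made of `N - 1` copies of `u`, the words `wu` and `wv` are distinct loops of length
  -- `n`, a multiple of `N`. The clock is made of `(wu)⁴` and of the primitive word `(wu)³(wv)`.
  refine ⟨4 * n, fun β i => if β then (w ++ u).getD (i % n) a else
      if i < 3 * n then (w ++ u).getD (i % n) a else (w ++ v).getD (i % n) a, U,
    ⟨4 * u.length, by rw [hn]; ring⟩, by omega, hU, fun β => ?_, fun s hs hs' => ?_, ?_⟩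
  · cases β
    · simp only [Bool.false_eq_true, if_false]
      rw [hsplit]
      have e : ∀ m < 3, (List.range n).map (fun i => if m * n + i < 3 * n then
          (w ++ u).getD ((m * n + i) % n) a else (w ++ v).getD ((m * n + i) % n) a) = w ++ u := by
        intro m hm
        conv_rhs => rw [← hget' _ hlen m]
        refine List.map_congr_left fun i hi => if_pos ?_
        have := List.mem_range.1 hi
        have : m * n ≤ 2 * n := Nat.mul_le_mul_right n (by omega)
        omega
      rw [e 0 (by omega), e 1 (by omega), e 2 (by omega), h4 _ _ hpu]
      conv_rhs => rw [← hpv, ← hget' _ hlen' 3]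
      congr 1
      exact List.map_congr_left fun i _ => if_neg (by omega)
    · simp only [if_true]
      rw [hsplit, hget' _ hlen, hget' _ hlen, hget' _ hlen, hget' _ hlen, h4 _ _ hpu, hpu]
  · simpa only [Bool.false_eq_true, if_false] using exists_ne_mod hex hs hs'
  · obtain ⟨i, hi, hi'⟩ := hex
    refine ⟨3 * n + i, by omega, ?_⟩
    simp only [Bool.false_eq_true, if_false, if_true]
    rw [if_neg (by omega), mul_comm, Nat.mul_add_mod, Nat.mod_eq_of_lt hi]
    exact hi'.symm

theorem exists_certificate_of_not_countable {c : GraphCode} (h : ¬ c.shift.Countable)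
    (hdet : ContainsDeterministic c.shift) : ∃ w : Certificate, w.Valid c := by
  refine exists_certificate_of_dataSystem hdet fun a N hN ⟨f, hf, _⟩ => ?_
  obtain ⟨L, C, U, hNL, hC⟩ := exists_isClock h a hN
  exact ⟨_, inferInstance, hC.dataSystem a ⟨f 0, (hf 0).1⟩, hNL,
    fun q hq => hC.exists_ne_states a hq⟩

/-! ## The graph of a subshift of finite type -/

/-- No word of `F` is a prefix of `w`. -/
def NoPrefix (F : List (List ℕ)) (w : List ℕ) : Prop := ∀ u ∈ F, w.take u.length ≠ u

open Classical in
/-- The graph whose vertices are the words of length `K` and whose edges are the words of length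
`K + 1` without forbidden prefixes, where `K` is the total length of the forbidden words. -/
noncomputable abbrev SFTCode.graph (c : SFTCode) : ℕ × List (ℕ × ℕ × ℕ) :=
  (c.1, (words (List.range c.1) (c.2.flatten.length + 1)).filterMap fun w =>
    if NoPrefix c.2 w then some (Encodable.encode (w.take c.2.flatten.length), w.headD 0,
      Encodable.encode (w.drop 1)) else none)

theorem primrec_graph : Primrec SFTCode.graph := by
  classical
  have hF : Primrec fun c : SFTCode => c.2 := Primrec.snd
  have hK : Primrec fun c : SFTCode => c.2.flatten.length :=
    Primrec.list_length.comp (Primrec.list_flatten.comp hF)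
  refine Primrec.pair Primrec.fst (Primrec.listFilterMap
    (primrec_words (Primrec.list_range.comp Primrec.fst) (Primrec.succ.comp hK)) ?_)
  change Primrec fun p : SFTCode × List ℕ => _
  refine Primrec.ite ?_ (Primrec.option_some.comp (Primrec.pair (Primrec.encode.comp
    (Primrec.list_take.comp (hK.comp Primrec.fst) Primrec.snd)) (Primrec.pair ?_
    (Primrec.encode.comp (Primrec.list_drop.comp (Primrec.const 1) Primrec.snd)))))
    (Primrec.const none)
  · refine primrecPred_forall_mem (hF.comp Primrec.fst) ?_
    exact (Primrec.eq.comp (Primrec.list_take.comp (Primrec.list_length.comp Primrec.snd)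
      (Primrec.snd.comp Primrec.fst)) Primrec.snd).not
  · refine ((Primrec.list_getD 0).comp Primrec.snd (Primrec.const 0)).of_eq fun p => ?_
    cases p.2 <;> rfl

section Graph

variable {c : SFTCode}

/-- The first `d` letters of a sequence. -/
def initial {n : ℕ} (z : ℕ → Fin n) (d : ℕ) : List ℕ := (List.range d).map fun i => (z i : ℕ)

theorem mem_graph {e : ℕ × ℕ × ℕ} : e ∈ c.graph.2 ↔
    ∃ w, w.length = c.2.flatten.length + 1 ∧ (∀ a ∈ w, a < c.1) ∧ NoPrefix c.2 w ∧
      e = (Encodable.encode (w.take c.2.flatten.length), w.headD 0,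
        Encodable.encode (w.drop 1)) := by
  simp only [List.mem_filterMap, mem_words, List.mem_range]
  constructor
  · rintro ⟨w, ⟨h1, h2⟩, h⟩
    split_ifs at h with h3
    exact ⟨w, h1, h2, h3, (Option.some_injective _ h).symm⟩
  · rintro ⟨w, h1, h2, h3, rfl⟩
    exact ⟨w, ⟨h1, h2⟩, if_pos h3⟩

/-- Each edge is labelled by the first letter of its word and overlaps the next one in all the other
letters, so the labels spell the words. -/
theorem IsPath.initial_of_graph {f : ℕ → ℕ × ℕ × ℕ} (hf : IsPath c.graph f) {z : ℕ → Fin c.1}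
    (hz : ∀ t, (f t).2.1 = z t) : NoPrefix c.2 (initial z (c.2.flatten.length + 1)) ∧
      (f 0).1 = Encodable.encode (initial z c.2.flatten.length) := by
  choose w h1 h2 h3 h4 using fun t => mem_graph.1 (hf t).1
  have hhead : ∀ t (h : 0 < (w t).length), (w t)[0] = z t := fun t h => by
    rw [← hz, h4]
    generalize w t = l at h
    cases l with
    | nil => simp at h
    | cons a l => rfl
  have hnext : ∀ t, (w t).drop 1 = (w (t + 1)).take c.2.flatten.length := fun t => by
    have := (hf t).2.2
    rw [h4, h4 (t + 1)] at this
    exact Encodable.encode_injective this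
  have key : ∀ i t (hi : i < (w t).length), (w t)[i] = z (t + i) := by
    intro i
    induction i with
    | zero => exact hhead
    | succ i ih =>
      intro t hi
      have hi' : i < c.2.flatten.length := by have := h1 t; omega
      have := congrArg (fun l => l[i]?) (hnext t)
      rw [List.getElem?_drop, List.getElem?_take_of_lt hi', List.getElem?_eq_getElem (by omega),
        List.getElem?_eq_getElem (by rw [h1]; omega), Option.some.injEq, ih] at this
      rw [show t + (i + 1) = t + 1 + i by ring, ← this]
      congr 1
      ring
  have hw : w 0 = initial z (c.2.flatten.length + 1) := by
    refine List.ext_getElem (by simp [h1, initial]) fun i hi _ => ?_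
    rw [key]
    simp [initial]
  refine ⟨hw ▸ h3 0, ?_⟩
  rw [h4, hw]
  simp only [initial]
  rw [← List.map_take, List.take_range, min_eq_left (Nat.le_succ _)]

theorem isWindowGraph_graph (c : SFTCode) : IsWindowGraph c.graph c.2.flatten.length
    (fun z : ℕ → Fin c.1 => NoPrefix c.2 (initial z (c.2.flatten.length + 1)))
    fun z => Encodable.encode (initial z c.2.flatten.length) where
  pred_congr z z' h h' := by
    have : initial z' (c.2.flatten.length + 1) = initial z (c.2.flatten.length + 1) :=
      List.map_congr_left fun i hi => by rw [h i (Nat.lt_succ_iff.1 (List.mem_range.1 hi))]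
    rwa [this]
  vertex_congr z z' h := by
    have : initial z c.2.flatten.length = initial z' c.2.flatten.length :=
      List.map_congr_left fun i hi => by rw [h i (List.mem_range.1 hi).le]
    rw [this]
  edge_mem z h := by
    refine mem_graph.2 ⟨_, by simp [initial], by simp [initial], h, ?_⟩
    simp only [initial]
    rw [← List.map_take, List.take_range, min_eq_left (Nat.le_succ _), List.range_succ_eq_map]
    simp
  of_isBiPath f hf z i hz := by
    have := (hf.add i).isPath.initial_of_graph (z := z) fun t => by rw [add_comm]; exact hz t
    simpa using this

theorem initial_add_take {n : ℕ} (z : ℕ → Fin n) (d d' : ℕ) (h : d' ≤ d) :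
    (initial z d).take d' = initial z d' := by
  rw [initial, ← List.map_take, List.take_range, min_eq_left h, initial]

theorem shift_graph (c : SFTCode) : GraphCode.shift c.graph = c.shift := by
  have hlen : ∀ u ∈ c.2, u.length ≤ c.2.flatten.length + 1 := fun u hu =>
    ((List.sublist_flatten_of_mem hu).length_le).trans (Nat.le_succ _)
  ext z
  constructor
  · intro hz
    obtain ⟨f, hf, hfz⟩ := exists_isPath_of_mem_shift hz
    rintro w hw ⟨i, hi⟩
    have hfi : IsPath c.graph fun t => f (i + t) := fun t => by
      simpa only [add_assoc] using hf (i + t)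
    refine (hfi.initial_of_graph (z := fun t => z (i + t)) fun t => hfz _).1 _ hw ?_
    rw [initial_add_take _ _ _ (hlen _ hw), List.length_map]
    refine List.ext_getElem (by simp [initial]) fun j h1 h2 => ?_
    simp only [List.length_map] at h2
    rw [List.getElem_map, List.getElem_of_eq hi h2]
    simp [initial]
  · intro hz
    have hz' : ∀ i, NoPrefix c.2 (initial (fun t => z (i + t)) (c.2.flatten.length + 1)) := by
      intro i u hu h
      rw [initial_add_take _ _ _ (hlen _ hu)] at h
      have hm : (List.ofFn fun j : Fin u.length => z (i + j)).map Fin.val = u := by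
        conv_rhs => rw [← h]
        refine List.ext_getElem (by simp [initial]) fun j h1 h2 => ?_
        simp [initial]
      refine hz (List.ofFn fun j : Fin u.length => z (i + j)) (by
        change List.map Fin.val _ ∈ c.2
        rwa [hm]) ⟨i, ?_⟩
      refine List.ext_getElem (by simp) fun j h1 h2 => ?_
      simp
    refine ⟨fun i => Encodable.encode (initial (fun t => z (i + t)) c.2.flatten.length),
      fun i => ?_⟩
    have := (isWindowGraph_graph c).edge_mem _ (hz' i)
    convert this using 5
    congr 2
    funext t
    congr 1
    ring

theorem SFTCode.exists_certificate (h : ContainsDeterministic c.shift) :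
    ∃ w : Certificate, w.Valid c.graph :=
  (isWindowGraph_graph c).exists_certificate (by rwa [shift_graph])

end Graph

theorem effectivelyUltimatelyTraceable_sftCode :
    EffectivelyUltimatelyTraceable (D := SFTCode) Prod.fst SFTCode.shift
      fun c => ContainsDeterministic c.shift :=
  effectivelyUltimatelyTraceable_of_certificate primrec_graph
    (fun _ h => SFTCode.exists_certificate h) fun d _ J G C hC hG =>
      ⟨G, hC, by rwa [shift_graph] at hG⟩

theorem effectivelyUltimatelyTraceable_graphCode :
    EffectivelyUltimatelyTraceable (D := GraphCode) Prod.fst GraphCode.shift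
      fun c => ¬ c.shift.Countable ∧ ContainsDeterministic c.shift :=
  effectivelyUltimatelyTraceable_of_certificate Primrec.id
    (fun _ h => exists_certificate_of_not_countable h.1 h.2) fun _ _ _ G _ hC hG => ⟨G, hC, hG⟩

/-! ## Arbitrary finite alphabets -/

theorem Certificate.Valid.ultimatelyTraceable {c : GraphCode} {w : Certificate}
    (h : w.Valid c) : UltimatelyTraceable c.shift := by
  obtain ⟨G, -, hG⟩ := h.exists_coincideFrom
  exact ⟨G, _, hG⟩

theorem UltimatelyTraceable.of_equiv {A B : Type*} (e : A ≃ B) {S : Set (ℕ → A)}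
    (h : UltimatelyTraceable ((fun z i => e (z i)) '' S)) : UltimatelyTraceable S := by
  obtain ⟨G, J, hG⟩ := h
  set G' : CellularAutomaton A :=
    ⟨G.anchor, G.diameter, G.diameter_pos, fun w => e.symm (G.rule fun j => e (w j))⟩ with hG'
  have hglob : ∀ t (x : ℤ → A), (fun i => e (G'.global^[t] x i)) =
      G.global^[t] fun i => e (x i) := fun t x => by
    induction t with
    | zero => rfl
    | succ t ih =>
      rw [Function.iterate_succ_apply', Function.iterate_succ_apply', ← ih]
      funext i
      exact e.apply_symm_apply _
  have htrace : G.trace = (fun z i => e (z i)) '' G'.trace := by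
    ext z
    constructor
    · rintro ⟨x, rfl⟩
      refine ⟨_, ⟨fun i => e.symm (x i), rfl⟩, funext fun t => ?_⟩
      have := congrFun (hglob t fun i => e.symm (x i)) 0
      simpa using this
    · rintro ⟨_, ⟨x, rfl⟩, rfl⟩
      exact ⟨fun i => e (x i), funext fun t => (congrFun (hglob t x) 0).symm⟩
  have hinj : Function.Injective fun (z : ℕ → A) i => e (z i) := fun z z' h =>
    funext fun i => e.injective (congrFun h i)
  refine ⟨G', J, hinj.image_injective ?_⟩
  rw [CoincideFrom, htrace] at hG
  simp only [Set.image_image] at hG ⊢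
  exact hG

theorem ContainsDeterministic.image_equiv {A B : Type*} (e : A ≃ B) {S : Set (ℕ → A)}
    (h : ContainsDeterministic S) : ContainsDeterministic ((fun z i => e (z i)) '' S) := by
  obtain ⟨A', ξ, ⟨a, ha⟩, hξ⟩ := h
  refine ⟨{b | e.symm b ∈ A'}, fun b => ⟨e (ξ ⟨e.symm b, b.2⟩), by simp⟩, ⟨e a, by simpa using ha⟩,
    ?_⟩
  rintro _ ⟨b, rfl⟩
  have key : ∀ t, ((fun b : {b | e.symm b ∈ A'} =>
      (⟨e (ξ ⟨e.symm b, b.2⟩), by simp⟩ : {b | e.symm b ∈ A'}))^[t] b : B) =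
      e (ξ^[t] ⟨e.symm b, b.2⟩ : A') := fun t => by
    induction t with
    | zero => simp
    | succ t ih =>
      rw [Function.iterate_succ_apply', Function.iterate_succ_apply']
      simp only [ih, Equiv.symm_apply_apply]
  exact ⟨_, hξ ⟨⟨e.symm b, b.2⟩, rfl⟩, funext fun t => (key t).symm⟩

theorem isFactor_map {A B : Type*} (e : A ≃ B) {w : List A} {z : ℕ → A} :
    IsFactor (w.map e) (fun i => e (z i)) ↔ IsFactor w z := by
  refine exists_congr fun i => ?_
  have : List.ofFn (fun j : Fin (w.map e).length => e (z (i + j))) =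
      (List.ofFn fun j : Fin w.length => z (i + j)).map e :=
    List.ext_getElem (by simp) fun j h1 h2 => by simp
  rw [this]
  exact (List.map_injective_iff.2 e.injective).eq_iff

theorem IsSFT.exists_code {A : Type*} [TopologicalSpace A] {S : Subshift A ℕ} (h : IsSFT S)
    {n : ℕ} (e : A ≃ Fin n) : ∃ F, SFTCode.shift (n, F) = (fun z i => e (z i)) '' S.carrier := by
  obtain ⟨F, hF, hS⟩ := h
  refine ⟨(hF.image fun w => w.map fun a => (e a : ℕ)).toFinset.toList, ?_⟩
  have hmem : ∀ w : List A, (w.map e).map Fin.val ∈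
      (hF.image fun w => w.map fun a => (e a : ℕ)).toFinset.toList ↔ w ∈ F := fun w => by
    rw [Finset.mem_toList, Set.Finite.mem_toFinset, List.map_map]
    have hinj : Function.Injective fun a => (e a : ℕ) := Fin.val_injective.comp e.injective
    exact (List.map_injective_iff.2 hinj).mem_set_image
  rw [hS]
  ext z
  constructor
  · intro hz
    refine ⟨fun i => e.symm (z i), fun w hw hf => hz (w.map e) ((hmem w).2 hw) ?_, by simp⟩
    rw [← isFactor_map e] at hf
    simpa using hf
  · rintro ⟨z, hz, rfl⟩ w hw hf
    obtain ⟨w, rfl⟩ := List.map_surjective_iff.2 e.surjective w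
    exact hz w ((hmem w).1 hw) ((isFactor_map e).1 hf)

theorem isFactor_initial {A : Type*} (z : ℕ → A) (i n : ℕ) :
    IsFactor ((List.range n).map fun j => z (i + j)) z :=
  ⟨i, List.ext_getElem (by simp) fun j h1 h2 => by simp⟩

/-- Shifted elements of `S` that begin with longer and longer prefixes of `z` converge to `z`, and
`S` is closed and stable under the shift. -/
theorem mem_subshift_iff {A : Type*} [TopologicalSpace A] [DiscreteTopology A]
    (S : Subshift A ℕ) (z : ℕ → A) :
    z ∈ S.carrier ↔ ∀ n, (List.range n).map z ∈ language S.carrier := by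
  constructor
  · intro hz n
    have := isFactor_initial z 0 n
    simp only [zero_add] at this
    exact ⟨z, hz, this⟩
  · intro h
    choose y hy hf using h
    choose i hi using hf
    have hyz : ∀ n j, j < n → y n (i n + j) = z j := fun n j hj => by
      have := congrArg (fun w => w[j]?) (hi n)
      simpa [hj] using this.symm
    refine S.isClosed.mem_of_tendsto (f := fun n => shift (i n) (y n)) (b := Filter.atTop)
      (tendsto_pi_nhds.2 fun j => ?_) (Filter.Eventually.of_forall fun n => S.mapsTo _ (hy n))
    refine tendsto_const_nhds.congr' ?_
    filter_upwards [Filter.eventually_gt_atTop j] with n hn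
    exact (hyz n j hn).symm

/-- The graph is the automaton of the language restricted to the accepting states that can be
reached. A path starts at the state of some word `w`, so `w` followed by any prefix of its label is
in the language, and factors of elements of `S` suffice to recognise `S`. -/
theorem IsSofic.exists_code {A : Type*} [Finite A] [TopologicalSpace A] [DiscreteTopology A]
    {S : Subshift A ℕ} (h : IsSofic S) {n : ℕ} (e : A ≃ Fin n) :
    ∃ E, GraphCode.shift (n, E) = (fun z i => e (z i)) '' S.carrier := by
  obtain ⟨σ, _, M, hM⟩ := h
  obtain ⟨m, ⟨s⟩⟩ := Finite.exists_equiv_fin σ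
  set edges : Set (ℕ × ℕ × ℕ) := {t | ∃ w a, M.eval w ∈ M.accept ∧ M.eval (w ++ [a]) ∈ M.accept ∧
    t = ((s (M.eval w) : ℕ), (e a : ℕ), (s (M.eval (w ++ [a])) : ℕ))} with hedges
  have hfin : edges.Finite := by
    refine (Set.finite_range fun p : σ × A × σ => ((s p.1 : ℕ), (e p.2.1 : ℕ), (s p.2.2 : ℕ))).subset
      ?_
    rintro _ ⟨w, a, -, -, rfl⟩
    exact ⟨(M.eval w, a, M.eval (w ++ [a])), rfl⟩
  have hlang : ∀ w, M.eval w ∈ M.accept ↔ w ∈ language S.carrier := fun w => by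
    rw [← hM]; rfl
  have hs : ∀ {q q' : σ}, (s q : ℕ) = s q' → q = q' := fun h => s.injective (Fin.ext h)
  refine ⟨hfin.toFinset.toList, ?_⟩
  ext z
  constructor
  · rintro ⟨v, hv⟩
    simp only [Finset.mem_toList, Set.Finite.mem_toFinset] at hv
    refine ⟨fun i => e.symm (z i), (mem_subshift_iff S _).2 fun n => ?_, by simp⟩
    obtain ⟨w, a, hw, -, h0⟩ := hv 0
    have key : ∀ n, v n = s (M.eval (w ++ (List.range n).map fun i => e.symm (z i))) ∧
        M.eval (w ++ (List.range n).map fun i => e.symm (z i)) ∈ M.accept := by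
      intro n
      induction n with
      | zero =>
        simp only [List.range_zero, List.map_nil, List.append_nil]
        exact ⟨(Prod.ext_iff.1 h0).1, hw⟩
      | succ n ih =>
        obtain ⟨w', a', -, h2, h3⟩ := hv n
        simp only [Prod.mk.injEq] at h3
        obtain ⟨h3, h4, h5⟩ := h3
        have h6 := hs (ih.1.symm.trans h3)
        have h7 : e.symm (z n) = a' := by rw [e.symm_apply_eq]; exact Fin.ext h4
        have h8 : M.eval (w ++ (List.range (n + 1)).map fun i => e.symm (z i)) =
            M.eval (w' ++ [a']) := by
          rw [List.range_succ, List.map_append, List.map_singleton, h7, ← List.append_assoc,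
            M.eval_append_singleton, M.eval_append_singleton, h6]
        rw [h8]
        exact ⟨h5, h2⟩
    obtain ⟨y, hy, i, hi⟩ := (hlang _).1 (key n).2
    refine ⟨y, hy, i + w.length, ?_⟩
    refine List.ext_getElem (by simp) fun j h1 h2 => ?_
    simp only [List.length_map, List.length_range] at h1
    have := congrArg (fun l => l[w.length + j]?) hi
    simp [h1] at this
    simp [this, add_assoc]
  · rintro ⟨z, hz, rfl⟩
    have hpre := (mem_subshift_iff S z).1 hz
    refine ⟨fun i => s (M.eval ((List.range i).map z)), fun i => ?_⟩
    simp only [Finset.mem_toList, Set.Finite.mem_toFinset]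
    have hsucc : (List.range (i + 1)).map z = (List.range i).map z ++ [z i] := by
      rw [List.range_succ, List.map_append, List.map_singleton]
    exact ⟨_, z i, (hlang _).2 (hpre i), (hlang _).2 (hsucc ▸ hpre (i + 1)), by rw [hsucc]⟩

theorem ultimatelyTraceable_of_containsDeterministic {A : Type*} [Finite A] [TopologicalSpace A]
    [DiscreteTopology A] {S : Subshift A ℕ}
    (h : IsSFT S ∨ (IsSofic S ∧ ¬ S.carrier.Countable))
    (hdet : ContainsDeterministic S.carrier) : UltimatelyTraceable S.carrier := by
  obtain ⟨n, ⟨e⟩⟩ := Finite.exists_equiv_fin A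
  refine UltimatelyTraceable.of_equiv e ?_
  have hdet' := hdet.image_equiv e
  rcases h with h | ⟨h, hc⟩
  · obtain ⟨F, hF⟩ := h.exists_code e
    rw [← hF] at hdet' ⊢
    obtain ⟨w, hw⟩ := SFTCode.exists_certificate hdet'
    rw [← shift_graph]
    exact hw.ultimatelyTraceable
  · obtain ⟨E, hE⟩ := h.exists_code e
    have hinj : Function.Injective fun (z : ℕ → A) i => e (z i) := fun z z' h =>
      funext fun i => e.injective (congrFun h i)
    have hc' : ¬ (GraphCode.shift (n, E)).Countable := fun h =>
      hc (Set.countable_of_injective_of_countable_image hinj.injOn (hE ▸ h))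
    rw [← hE] at hdet' ⊢
    obtain ⟨w, hw⟩ := exists_certificate_of_not_countable hc' hdet'
    exact hw.ultimatelyTraceable

end UltimateTrace

theorem mainTheorem4 :
    -- every finite alphabet, every one-sided subshift on it
    (∀ (A : Type u) [Finite A] [TopologicalSpace A] [DiscreteTopology A]
        (S : SymbolicDynamics.FullShift.Subshift A ℕ),
      (UltimateTrace.IsSFT S ∨ (UltimateTrace.IsSofic S ∧ ¬ S.carrier.Countable)) →
      UltimateTrace.ContainsDeterministic S.carrier →
      UltimateTrace.UltimatelyTraceable S.carrier) ∧
    -- effectiveness, from a finite list of forbidden words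
    UltimateTrace.EffectivelyUltimatelyTraceable (D := UltimateTrace.SFTCode) Prod.fst
      UltimateTrace.SFTCode.shift
      (fun c => UltimateTrace.ContainsDeterministic c.shift) ∧
    -- effectiveness, from a finite labelled graph
    UltimateTrace.EffectivelyUltimatelyTraceable (D := UltimateTrace.GraphCode) Prod.fst
      UltimateTrace.GraphCode.shift
      (fun c => ¬ c.shift.Countable ∧ UltimateTrace.ContainsDeterministic c.shift) :=
  ⟨fun _ _ _ _ _ h hdet => UltimateTrace.ultimatelyTraceable_of_containsDeterministic h hdet,
    UltimateTrace.effectivelyUltimatelyTraceable_sftCode,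
    UltimateTrace.effectivelyUltimatelyTraceable_graphCode⟩
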